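/- Let $n\ge 2$, $1\le k<n$, and call $\mathbf P\in[0,1]^{n\times n}$ strongly stochastic transitive (SST) if $\mathbf P_{u,l}\ge \mathbf P_{v,l}$ for all $u<v$ and all $l$, $\mathbf P_{v,u}=1-\mathbf P_{u,v}$ and $\mathbf P_{u,u}=\tfrac12$. In the problem Top-$K(n,k,\mathbf P,r)$ a permutation $\pi$ of $[n]$ is drawn uniformly at random, and the algorithm, which knows $n,k,r$ but neither $\pi$ nor $\mathbf P$, is given independent samples $X_{i,j,l}\in\{0,1\}$ ($i,j\in[n]$, $l\in[r]$), where $X_{i,j,l}$ is Bernoulli with mean $\mathbf P_{\pi^{-1}(i),\pi^{-1}(j)}$; it succeeds if it outputs the set $\{\pi(1),\dots,\pi(k)\}$. For $p,q\in[0,1]$ put $$\mathbb I(p,q)=\bigl(p(1-q)+q(1-p)\bigr)\Bigl(1-H\Bigl(\tfrac{p(1-q)}{p(1-q)+q(1-p)}\Bigr)\Bigr)$$ (read as $0$ if $p(1-q)+q(1-p)=0$), where $H$ is the binary entropy in bits, and $\mathbb I(\mathbf p,\mathbf q)=\sum_{i=1}^n\mathbb I(p_i,q_i)$ for $\mathbf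 p,\mathbf q\in[0,1]^n$. Write $\log$ for the logarithm to base $2$, and $\mathbf P_k,\mathbf P_{k+1}$ for the rows $k$ and $k+1$ of $\mathbf P$. Theorem. There are a single randomized algorithm $A$, which besides $n,k,r$ and the samples is given an error parameter $\alpha\in(0,1)$ (through its binary digits), and an absolute constant $C$, such that for all $\alpha\in(0,1)$ and all $1\le k<n$: 1. for every $r\ge 1$ and every array of samples, $A$ always halts within $C\,n^2\,r\,\max\{1,\log(1/\alpha)\}$ steps of a unit-cost random-access machine; in particular, its running time is $O(n^2r\log(1/\alpha))$ for $\alpha\le\tfrac12$; 2. for every SST matrix $\mathbf P\in[0,1]^{n\times n}$, $A$ succeeds on Top-$K(n,k,\mathbf P,r)$ with probability at least $1-\alpha$ for every integer $$r\ \ge\ \frac{7776\,\sqrt n\,\log(2n\alpha^{-1})}{\mathbb I(\mathbf P_k,\mathbf P_{k+1})}$$ (no claim is made if $\mathbb I(\mathbf P_k,\mathbf P_{k+1})=0$). Consequently $$r_{min}(S,A,1-\alpha)\le \frac{7776\sqrt n\,\log(2n\alpha^{-1})}{\mathbb I(\mathbf P_k,\mathbf P_{k+1})}\qquad\text{for }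 S=(n,k,\mathbf P),$$ where $r_{min}(S,A,p)$ is the infimum of the reals $\rho\ge0$ such that $A$ succeeds on $S$ with probability at least $p$ for every number $r\ge\rho$ of samples. -/

import Mathlib

open scoped ENNReal

noncomputable section

namespace TopK

/-! ## A randomized random-access machine with unit costs -/

/-- Programs of a random-access machine.  Every argument of type `ℕ` is a fixed register number,
except `v` in `const`, which is a fixed constant.  The only arithmetic operations are addition and
truncated subtraction. -/
inductive Cmd : Type
  /-- `reg d := v` -/
  | const (d v : ℕ)
  /-- `reg d := reg a + reg b` -/
  | add (d a b : ℕ)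
  /-- `reg d := reg a - reg b` (truncated at zero) -/
  | sub (d a b : ℕ)
  /-- `reg d := mem (reg a)` -/
  | load (d a : ℕ)
  /-- `mem (reg a) := reg b` -/
  | store (a b : ℕ)
  /-- `reg d :=` the sample with index `(reg i, reg j, reg l)` -/
  | sample (d i j l : ℕ)
  /-- `reg d :=` the binary digit of the error parameter with weight `2 ^ (-reg a)` -/
  | digit (d a : ℕ)
  /-- `reg d :=` a fresh uniformly random element of `{0, …, reg a - 1}` -/
  | rand (d a : ℕ)
  /-- first `c₁`, then `c₂` -/
  | seq (c₁ c₂ : Cmd)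
  /-- `if reg a < reg b then c₁ else c₂` -/
  | ite (a b : ℕ) (c₁ c₂ : Cmd)
  /-- `while reg a < reg b do c` -/
  | loop (a b : ℕ) (c : Cmd)

/-- The store of the machine: registers, and a memory that is addressed indirectly. -/
@[ext]
structure Store where
  reg : ℕ → ℕ
  mem : ℕ → ℕ

/-- The store with register `d` set to `v`. -/
def Store.setReg (s : Store) (d v : ℕ) : Store :=
  { s with reg := Function.update s.reg d v }

/-- The store with memory cell `a` set to `v`. -/
def Store.setMem (s : Store) (a v : ℕ) : Store :=
  { s with mem := Function.update s.mem a v }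

/-- A configuration: the commands that remain to be executed, and the store.  The machine has
halted when no command remains. -/
abbrev Config := List Cmd × Store

/-- Arrays of comparison outcomes `z i j l`, where `i`, `j` are labels of items and `l` is the
number of the sample; `true` means that `i` is preferred to `j`. -/
abbrev Samples (n r : ℕ) := Fin n → Fin n → Fin r → Bool

/-- Reading an entry of the array of samples, as `0` or `1` (`0` outside of the array). -/
def readSample {n r : ℕ} (z : Samples n r) (i j l : ℕ) : ℕ :=
  if h : i < n ∧ j < n ∧ l < r then (z ⟨i, h.1⟩ ⟨j, h.2.1⟩ ⟨l, h.2.2⟩).toNat else 0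

/-- The binary digit of `α ≥ 0` with weight `2 ^ (-t)`. -/
def binaryDigit (α : ℝ) (t : ℕ) : ℕ := ⌊2 ^ t * α⌋₊ % 2

/-- A uniformly random element of `{0, …, m - 1}` (and `0` if `m = 0`). -/
def randBelow (m : ℕ) : PMF ℕ :=
  if h : 0 < m then PMF.uniformOfFinset (Finset.range m) ⟨0, Finset.mem_range.2 h⟩ else PMF.pure 0

/-- One step of the machine: one elementary operation, or one test of a branch or of a loop. -/
def step {n r : ℕ} (z : Samples n r) (α : ℝ) : Config → PMF Config
  | ([], s) => PMF.pure ([], s)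
  | (Cmd.const d v :: K, s) => PMF.pure (K, s.setReg d v)
  | (Cmd.add d a b :: K, s) => PMF.pure (K, s.setReg d (s.reg a + s.reg b))
  | (Cmd.sub d a b :: K, s) => PMF.pure (K, s.setReg d (s.reg a - s.reg b))
  | (Cmd.load d a :: K, s) => PMF.pure (K, s.setReg d (s.mem (s.reg a)))
  | (Cmd.store a b :: K, s) => PMF.pure (K, s.setMem (s.reg a) (s.reg b))
  | (Cmd.sample d i j l :: K, s) =>
      PMF.pure (K, s.setReg d (readSample z (s.reg i) (s.reg j) (s.reg l)))
  | (Cmd.digit d a :: K, s) => PMF.pure (K, s.setReg d (binaryDigit α (s.reg a)))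
  | (Cmd.rand d a :: K, s) => (randBelow (s.reg a)).map fun v => (K, s.setReg d v)
  | (Cmd.seq c₁ c₂ :: K, s) => PMF.pure (c₁ :: c₂ :: K, s)
  | (Cmd.ite a b c₁ c₂ :: K, s) =>
      PMF.pure (if s.reg a < s.reg b then (c₁ :: K, s) else (c₂ :: K, s))
  | (Cmd.loop a b c :: K, s) =>
      PMF.pure (if s.reg a < s.reg b then (c :: Cmd.loop a b c :: K, s) else (K, s))

/-- The law of the configuration after `t` steps. -/
def exec {n r : ℕ} (z : Samples n r) (α : ℝ) : ℕ → Config → PMF Config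
  | 0, c => PMF.pure c
  | t + 1, c => (step z α c).bind (exec z α t)

/-- The initial configuration: registers `0`, `1`, `2` hold `n`, `k`, `r`, and everything else
is `0`. -/
def initConfig (A : Cmd) (n k r : ℕ) : Config :=
  ([A], ⟨fun i => if i = 0 then n else if i = 1 then k else if i = 2 then r else 0, fun _ => 0⟩)

/-- The output is the set of the labels `i` whose memory cell holds `1`. -/
def outputSet (n : ℕ) (s : Store) : Set (Fin n) := {i | s.mem i = 1}

/-- On these inputs, `A` always halts within `t` steps, whatever its random choices are. -/
def HaltsWithin (A : Cmd) (α : ℝ) (k : ℕ) {n r : ℕ} (z : Samples n r) (t : ℕ) : Prop :=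
  ∀ c ∈ (exec z α t (initConfig A n k r)).support, c.1 = []

/-- The probability, over the random choices of `A`, that `A` halts with output `T`. -/
def outputProb (A : Cmd) (α : ℝ) (k : ℕ) {n r : ℕ} (z : Samples n r) (T : Set (Fin n)) : ℝ≥0∞ :=
  ⨆ t : ℕ, (exec z α t (initConfig A n k r)).toOuterMeasure
    {c | c.1 = [] ∧ outputSet n c.2 = T}

/-! ## The Top-K problem -/

/-- Strongly stochastic transitive matrices of probabilities. -/
structure IsSST {n : ℕ} (P : Matrix (Fin n) (Fin n) ℝ) : Prop where
  mem_Icc : ∀ u v, P u v ∈ Set.Icc (0 : ℝ) 1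
  antitone : ∀ u v, u < v → ∀ l, P v l ≤ P u l
  skew : ∀ u v, P v u = 1 - P u v
  diag : ∀ u, P u u = 1 / 2

/-- The weight of the outcome `b` under the Bernoulli distribution with mean `p`. -/
def bernoulliWeight (p : ℝ) (b : Bool) : ℝ≥0∞ :=
  if b then ENNReal.ofReal p else ENNReal.ofReal (1 - p)

theorem sum_bernoulliWeight {p : ℝ} (hp : p ∈ Set.Icc (0 : ℝ) 1) :
    bernoulliWeight p true + bernoulliWeight p false = 1 := by
  have h0 : 0 ≤ p := hp.1
  have h1 : 0 ≤ 1 - p := by linarith [hp.2]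
  simp [bernoulliWeight, ← ENNReal.ofReal_add h0 h1]

/-- The law of the samples when the item of rank `u` has the label `π u`: all `z i j l` are
independent, and `z i j l` is Bernoulli with mean `P (π⁻¹ i) (π⁻¹ j)`. -/
def sampleLaw {n : ℕ} {P : Matrix (Fin n) (Fin n) ℝ} (hP : IsSST P) (π : Equiv.Perm (Fin n))
    (r : ℕ) : PMF (Samples n r) :=
  PMF.ofFintype
    (fun z => ∏ i, ∏ j, ∏ l, bernoulliWeight (P (π.symm i) (π.symm j)) (z i j l))
    (by
      have h : ∀ i j, ∑ y : Fin r → Bool,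
          ∏ l, bernoulliWeight (P (π.symm i) (π.symm j)) (y l) = 1 := fun i j => by
        rw [← Fintype.prod_sum]
        simp [sum_bernoulliWeight (hP.mem_Icc _ _)]
      have h' : ∀ i, ∑ y : Fin n → Fin r → Bool,
          ∏ j, ∏ l, bernoulliWeight (P (π.symm i) (π.symm j)) (y j l) = 1 := fun i => by
        rw [← Fintype.prod_sum
          (fun j (y : Fin r → Bool) => ∏ l, bernoulliWeight (P (π.symm i) (π.symm j)) (y l))]
        simp [h]
      rw [← Fintype.prod_sum (fun i (y : Fin n → Fin r → Bool) =>
          ∏ j, ∏ l, bernoulliWeight (P (π.symm i) (π.symm j)) (y j l))]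
      simp [h'])

/-- The labels of the `k` best items. -/
def topSet {n : ℕ} (π : Equiv.Perm (Fin n)) (k : ℕ) : Set (Fin n) :=
  {i | (π.symm i : ℕ) < k}

/-- The probability that `A`, run with error parameter `α`, solves the Top-K problem for
`(n, k, P)` with `r` samples: the permutation is uniform, and then the samples and the random
choices of `A` are drawn. -/
def successProb (A : Cmd) (α : ℝ) {n : ℕ} (k : ℕ) {P : Matrix (Fin n) (Fin n) ℝ} (hP : IsSST P)
    (r : ℕ) : ℝ≥0∞ :=
  ∑ π : Equiv.Perm (Fin n), PMF.uniformOfFintype (Equiv.Perm (Fin n)) π *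
    ∑ z : Samples n r, sampleLaw hP π r z * outputProb A α k z (topSet π k)

/-- For every number of samples `r ≥ ρ`, the algorithm succeeds with probability at
least `p`. -/
def SucceedsFrom (A : Cmd) (α : ℝ) {n : ℕ} (k : ℕ) {P : Matrix (Fin n) (Fin n) ℝ} (hP : IsSST P)
    (p ρ : ℝ≥0∞) : Prop :=
  ∀ r : ℕ, ρ ≤ r → p ≤ successProb A α k hP r

/-- The sample complexity of `A`, run with error parameter `α`, on the instance `(n, k, P)`, for
the success probability `p`. -/
def rMin (A : Cmd) (α : ℝ) {n : ℕ} (k : ℕ) {P : Matrix (Fin n) (Fin n) ℝ} (hP : IsSST P)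
    (p : ℝ≥0∞) : ℝ≥0∞ :=
  sInf {ρ | SucceedsFrom A α k hP p ρ}

/-! ## The information of a pair of rows -/

/-- The binary entropy in bits. -/
def entropyBits (p : ℝ) : ℝ := Real.binEntropy p / Real.log 2

/-- The information of one coordinate (it is `0` for `p = q = 0` and for `p = q = 1`). -/
def info (p q : ℝ) : ℝ :=
  (p * (1 - q) + q * (1 - p)) *
    (1 - entropyBits (p * (1 - q) / (p * (1 - q) + q * (1 - p))))

/-- The information of a pair of vectors of probabilities. -/
def infoVec {n : ℕ} (p q : Fin n → ℝ) : ℝ := ∑ i, info (p i) (q i)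

end TopK

end

open scoped ENNReal

noncomputable section

namespace TopK

/-! ## Deterministic runs of the machine -/

-- The algorithm is quickselect with random pivots, run on a noisy comparison of labels, and the
-- proof has two halves joined by a union bound.
--
-- Comparison. For labels y and x, each column c yields r sample pairs; the pairs that differ give
-- signs, which are sent alternately to two classes. If the samples have means p and q, they differ
-- with probability s = p(1-q) + q(1-p), and a sign then has mean μ = (p-q)/s. With m signs and
-- class sums X, Y, the column contributes roughly (|X|+1)·Y/m. This is quadratic in the bias: at μ
-- = 0 it has mean zero and bounded fluctuation, otherwise its mean is of order mμ², about
-- r(p-q)²/s. So n columns produce noise of order √n only, whence the factor √n. Precisely, the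
-- moment of exp(-θ·statistic) is at most exp(36θ² - (θ/32)·r(p-q)²/s) for 0 ≤ θ ≤ 1/40
-- (`iterate_tallyStep_exp_le`): condition on X and apply Hoeffding's lemma to Y, then bound an
-- exponential moment of (X-E X)² (`iterate_signStep_exp_sq_le`), then average over the binomial
-- number of signs.
--
-- The quantity (p-q)²/s dominates ln 2 times the information (`log_two_mul_info_le`) and grows when
-- the interval [q,p] grows (`sqGap_mono`), so rows k and k+1 control every pair separated by the
-- cut. With θ = 1/(40√n), Chernoff's bound and at most n² pairs, all comparisons across the cut are
-- right except with probability at most α/2 (`prob_not_separates_le`).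
--
-- Selection. The comparison is antisymmetric but need not be transitive; only correctness across
-- the cut is used. It lets the number of labels beating a pivot decide on which side of the cut the
-- pivot lies (`card_beaters_lt_iff`). On average over pivots a quarter of the m active labels
-- disappears (`sq_card_active_le`). A round with m active labels costs m units of a budget b, and
-- exp((8m-b)/(8n)) is a supermartingale that is at least 1 when the budget runs out
-- (`sum_exp_nextSize_le`, `le_prob_selectCmd`). The initial budget 8n(τ+2), with τ the position of
-- the first nonzero binary digit of α, makes the failure probability at most α/2. The budget also
-- caps the running time for every input: one comparison takes O(nr) steps and at most 8n(τ+2) of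
-- them are made.

infixr:65 " ⨾ " => Cmd.seq

section Logic

variable {n r : ℕ} (z : Samples n r) (α : ℝ)

/-- From the store `s`, the command `c` runs for exactly `t` steps and leaves the store `s'`. -/
def Runs (c : Cmd) (s s' : Store) (t : ℕ) : Prop :=
  ∀ K u, exec z α (u + t) (c :: K, s) = exec z α u (K, s')

/-- From the store `s`, the command `c` finishes within `T` steps in a store satisfying `Q`. -/
def Reaches (c : Cmd) (s : Store) (T : ℕ) (Q : Store → Prop) : Prop :=
  ∃ s' t, t ≤ T ∧ Runs z α c s s' t ∧ Q s'

/-- The commands without loops and random choices. -/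
def Cmd.IsSimple : Cmd → Prop
  | .seq c₁ c₂ => c₁.IsSimple ∧ c₂.IsSimple
  | .ite _ _ c₁ c₂ => c₁.IsSimple ∧ c₂.IsSimple
  | .loop _ _ _ => False
  | .rand _ _ => False
  | _ => True

/-- A bound for the number of steps of a simple command. -/
def Cmd.cost : Cmd → ℕ
  | .seq c₁ c₂ => c₁.cost + c₂.cost + 1
  | .ite _ _ c₁ c₂ => max c₁.cost c₂.cost + 1
  | _ => 1

/-- The effect of a simple command. -/
def interp : Cmd → Store → Store
  | .const d v, s => s.setReg d v
  | .add d a b, s => s.setReg d (s.reg a + s.reg b)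
  | .sub d a b, s => s.setReg d (s.reg a - s.reg b)
  | .load d a, s => s.setReg d (s.mem (s.reg a))
  | .store a b, s => s.setMem (s.reg a) (s.reg b)
  | .sample d i j l, s => s.setReg d (readSample z (s.reg i) (s.reg j) (s.reg l))
  | .digit d a, s => s.setReg d (binaryDigit α (s.reg a))
  | .seq c₁ c₂, s => interp c₂ (interp c₁ s)
  | .ite a b c₁ c₂, s => if s.reg a < s.reg b then interp c₁ s else interp c₂ s
  | _, s => s

variable {z α}

theorem Runs.seq {c₁ c₂ : Cmd} {s s₁ s₂ : Store} {t₁ t₂ : ℕ} (h₁ : Runs z α c₁ s s₁ t₁)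
    (h₂ : Runs z α c₂ s₁ s₂ t₂) : Runs z α (c₁ ⨾ c₂) s s₂ (t₁ + t₂ + 1) := by
  intro K u
  rw [show u + (t₁ + t₂ + 1) = (u + t₂ + t₁) + 1 by ring]
  simp only [exec, step, PMF.pure_bind]
  rw [h₁, h₂]

theorem Runs.ite_true {a b : ℕ} {c₁ c₂ : Cmd} {s s' : Store} {t : ℕ} (h : s.reg a < s.reg b)
    (h₁ : Runs z α c₁ s s' t) : Runs z α (.ite a b c₁ c₂) s s' (t + 1) := by
  intro K u
  rw [← add_assoc]
  simp only [exec, step, PMF.pure_bind, if_pos h]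
  rw [h₁]

theorem Runs.ite_false {a b : ℕ} {c₁ c₂ : Cmd} {s s' : Store} {t : ℕ} (h : ¬ s.reg a < s.reg b)
    (h₂ : Runs z α c₂ s s' t) : Runs z α (.ite a b c₁ c₂) s s' (t + 1) := by
  intro K u
  rw [← add_assoc]
  simp only [exec, step, PMF.pure_bind, if_neg h]
  rw [h₂]

theorem Runs.loop_true {a b : ℕ} {c : Cmd} {s s₁ s₂ : Store} {t₁ t₂ : ℕ}
    (h : s.reg a < s.reg b) (h₁ : Runs z α c s s₁ t₁) (h₂ : Runs z α (.loop a b c) s₁ s₂ t₂) :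
    Runs z α (.loop a b c) s s₂ (t₁ + 1 + t₂) := by
  intro K u
  rw [show u + (t₁ + 1 + t₂) = (u + t₂ + t₁) + 1 by ring]
  simp only [exec, step, PMF.pure_bind, if_pos h]
  rw [h₁, h₂]

theorem Runs.loop_false {a b : ℕ} {c : Cmd} {s : Store} (h : ¬ s.reg a < s.reg b) :
    Runs z α (.loop a b c) s s 1 := by
  intro K u
  simp only [exec, step, PMF.pure_bind, if_neg h]

/-- Straight-line code can be evaluated, so that loop bodies and initializations are verified by
simplifying `interp`. -/
theorem runs_interp {c : Cmd} (hc : c.IsSimple) (s : Store) :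
    ∃ t ≤ c.cost, Runs z α c s (interp z α c s) t := by
  induction c generalizing s with
  | seq c₁ c₂ ih₁ ih₂ =>
    obtain ⟨t₁, h₁, r₁⟩ := ih₁ hc.1 s
    obtain ⟨t₂, h₂, r₂⟩ := ih₂ hc.2 (interp z α c₁ s)
    exact ⟨_, by simp only [Cmd.cost]; omega, r₁.seq r₂⟩
  | ite a b c₁ c₂ ih₁ ih₂ =>
    by_cases h : s.reg a < s.reg b
    · obtain ⟨t, ht, hr⟩ := ih₁ hc.1 s
      refine ⟨t + 1, by simp only [Cmd.cost]; omega, ?_⟩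
      simpa only [interp, if_pos h] using hr.ite_true h
    · obtain ⟨t, ht, hr⟩ := ih₂ hc.2 s
      refine ⟨t + 1, by simp only [Cmd.cost]; omega, ?_⟩
      simpa only [interp, if_neg h] using hr.ite_false h
  | loop => exact hc.elim
  | rand => exact hc.elim
  | _ => exact ⟨1, le_rfl, fun K u => by simp only [exec, step, PMF.pure_bind, interp]⟩

theorem Reaches.mono {c : Cmd} {s : Store} {T T' : ℕ} {Q Q' : Store → Prop}
    (h : Reaches z α c s T Q) (hT : T ≤ T') (hQ : ∀ s, Q s → Q' s) : Reaches z α c s T' Q' := by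
  obtain ⟨s', t, ht, hr, hq⟩ := h
  exact ⟨s', t, ht.trans hT, hr, hQ _ hq⟩

theorem Reaches.simple {c : Cmd} {s : Store} {Q : Store → Prop} (hc : c.IsSimple)
    (hQ : Q (interp z α c s)) : Reaches z α c s c.cost Q := by
  obtain ⟨t, ht, hr⟩ := runs_interp (z := z) (α := α) hc s
  exact ⟨_, t, ht, hr, hQ⟩

theorem Reaches.seq {c₁ c₂ : Cmd} {s : Store} {T₁ T₂ : ℕ} {Q₁ Q : Store → Prop}
    (h₁ : Reaches z α c₁ s T₁ Q₁) (h₂ : ∀ s₁, Q₁ s₁ → Reaches z α c₂ s₁ T₂ Q) :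
    Reaches z α (c₁ ⨾ c₂) s (T₁ + T₂ + 1) Q := by
  obtain ⟨s₁, t₁, ht₁, hr₁, hq₁⟩ := h₁
  obtain ⟨s₂, t₂, ht₂, hr₂, hq₂⟩ := h₂ s₁ hq₁
  exact ⟨s₂, _, by omega, hr₁.seq hr₂, hq₂⟩

theorem Reaches.ite {a b : ℕ} {c₁ c₂ : Cmd} {s : Store} {T₁ T₂ : ℕ} {Q : Store → Prop}
    (h₁ : s.reg a < s.reg b → Reaches z α c₁ s T₁ Q)
    (h₂ : ¬ s.reg a < s.reg b → Reaches z α c₂ s T₂ Q) :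
    Reaches z α (.ite a b c₁ c₂) s ((if s.reg a < s.reg b then T₁ else T₂) + 1) Q := by
  by_cases h : s.reg a < s.reg b
  · obtain ⟨s', t, ht, hr, hq⟩ := h₁ h
    exact ⟨s', t + 1, by simp only [if_pos h]; omega, hr.ite_true h, hq⟩
  · obtain ⟨s', t, ht, hr, hq⟩ := h₂ h
    exact ⟨s', t + 1, by simp only [if_neg h]; omega, hr.ite_false h, hq⟩

/-- A loop that runs for exactly `J` rounds, with an invariant indexed by the round. -/
theorem Reaches.loop {a b : ℕ} {c : Cmd} (Inv : ℕ → Store → Prop) (T : ℕ → ℕ) (J : ℕ)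
    (hstep : ∀ j < J, ∀ s, Inv j s → s.reg a < s.reg b ∧ Reaches z α c s (T j) (Inv (j + 1)))
    (hend : ∀ s, Inv J s → ¬ s.reg a < s.reg b) {s : Store} (h0 : Inv 0 s) :
    Reaches z α (.loop a b c) s (∑ j ∈ Finset.range J, (T j + 1) + 1) (Inv J) := by
  -- Induction on the number i of remaining rounds, because a loop unfolds at its front.
  suffices h : ∀ i j, i + j = J → ∀ s, Inv j s →
      Reaches z α (.loop a b c) s (∑ j ∈ Finset.Ico j J, (T j + 1) + 1) (Inv J) by
    simpa using h J 0 (by simp) s h0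
  intro i
  induction i with
  | zero =>
    intro j hj s hs
    obtain rfl : j = J := by omega
    exact ⟨s, 1, by omega, Runs.loop_false (hend s hs), hs⟩
  | succ i ih =>
    intro j hj s hs
    obtain ⟨hg, s₁, t₁, ht₁, hr₁, hq₁⟩ := hstep j (by omega) s hs
    obtain ⟨s₂, t₂, ht₂, hr₂, hq₂⟩ := ih (j + 1) (by omega) s₁ hq₁
    refine ⟨s₂, _, ?_, Runs.loop_true hg hr₁ hr₂, hq₂⟩
    rw [Finset.sum_eq_sum_Ico_succ_bot (by omega : j < J)]
    omega

end Logic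

/-! ## The comparison of two labels -/

/-- A tally of signs in two classes, as numbers of positive and negative signs. -/
@[ext]
structure Tally where
  ap : ℕ
  am : ℕ
  bp : ℕ
  bm : ℕ

/-- Adds the sign of `x - y` to the first class and exchanges the classes, if `x ≠ y`. -/
def Tally.push (T : Tally) (x y : ℕ) : Tally :=
  if y < x then ⟨T.bp, T.bm, T.ap + 1, T.am⟩
  else if x < y then ⟨T.bp, T.bm, T.ap, T.am + 1⟩ else T

/-- The tally of the first `l` pairs of entries. -/
def tally (f g : ℕ → ℕ) : ℕ → Tally
  | 0 => ⟨0, 0, 0, 0⟩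
  | l + 1 => (tally f g l).push (f l) (g l)

/-- The number of signs in a tally. -/
def Tally.total (T : Tally) : ℕ := T.ap + T.am + T.bp + T.bm

/-- The weight given to the second class of a tally. -/
def Tally.weight (r : ℕ) (T : Tally) : ℕ :=
  (r + T.total) / (T.total + 1) * (T.ap - T.am + (T.am - T.ap) + 1)

theorem Tally.total_push_le (T : Tally) (x y : ℕ) : (T.push x y).total ≤ T.total + 1 := by
  unfold Tally.push
  split_ifs <;> simp only [Tally.total] <;> omega

theorem total_tally_le (f g : ℕ → ℕ) (l : ℕ) : (tally f g l).total ≤ l := by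
  induction l with
  | zero => simp [tally, Tally.total]
  | succ l ih => exact (Tally.total_push_le _ _ _).trans (by omega)

/-- The exchange of positive and negative signs. -/
def Tally.neg (T : Tally) : Tally := ⟨T.am, T.ap, T.bm, T.bp⟩

/-- The classes alternate whenever the entries differ, whatever the sign, so exchanging the
sequences only flips signs inside each class. -/
theorem tally_swap (f g : ℕ → ℕ) (l : ℕ) : tally g f l = (tally f g l).neg := by
  induction l with
  | zero => rfl
  | succ l ih =>
    simp only [tally, ih, Tally.push]
    split_ifs <;> first | rfl | omega

theorem Tally.total_neg (T : Tally) : T.neg.total = T.total := by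
  simp only [Tally.total, Tally.neg]; ring

theorem Tally.weight_neg (r : ℕ) (T : Tally) : T.neg.weight r = T.weight r := by
  simp only [Tally.weight, Tally.total_neg]
  simp only [Tally.neg]
  congr 2
  omega

section Compare

variable {n r : ℕ} (z : Samples n r)

/-- The tally of the labels `y` and `x` in the coordinate `c`. -/
def coordTally (y x c : ℕ) : Tally :=
  tally (fun l => readSample z y c l) (fun l => readSample z x c l) r

/-- The evidence for `y` against `x`. -/
def evidence (y x : ℕ) : ℕ :=
  ∑ c ∈ Finset.range n, (coordTally z y x c).weight r * (coordTally z y x c).bp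

/-- The evidence for `x` against `y`. -/
def counterEvidence (y x : ℕ) : ℕ :=
  ∑ c ∈ Finset.range n, (coordTally z y x c).weight r * (coordTally z y x c).bm

/-- The outcome of the comparison of `y` and `x`, where ties are broken by the labels. -/
def Beats (y x : ℕ) : Prop :=
  counterEvidence z y x < (if y < x then 1 else 0) + evidence z y x

/-- The weight sees only the number of signs and an absolute value, hence is invariant under
flipping all signs. This antisymmetry makes the comparison a tournament. -/
theorem counterEvidence_eq (y x : ℕ) : counterEvidence z y x = evidence z x y := by
  unfold counterEvidence evidence
  refine Finset.sum_congr rfl fun c _ => ?_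
  rw [coordTally, coordTally, tally_swap (fun l => readSample z y c l), Tally.weight_neg]
  rfl

theorem not_beats_self (x : ℕ) : ¬ Beats z x x := by
  simp [Beats, counterEvidence_eq]

theorem beats_iff_not_beats {x y : ℕ} (h : x ≠ y) : Beats z y x ↔ ¬ Beats z x y := by
  simp only [Beats, counterEvidence_eq]
  rcases lt_or_gt_of_ne h with h | h
  · simp only [h, if_true, not_lt.2 h.le, if_false]; omega
  · simp only [h, if_true, not_lt.2 h.le, if_false]; omega

end Compare

/-! ## The program -/

/-- A command that only spoils a scratch register. -/
def skip : Cmd := .const 30 0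

/-- Reads the samples of the labels in the registers `11` and `10` and pushes them. -/
def pushCmd : Cmd :=
  .sample 22 11 15 21 ⨾ .sample 23 10 15 21 ⨾
  .ite 23 22
    (.add 24 16 3 ⨾ .add 16 18 4 ⨾ .add 18 24 4 ⨾ .add 24 17 4 ⨾ .add 17 19 4 ⨾ .add 19 24 4)
    (.ite 22 23
      (.add 24 16 4 ⨾ .add 16 18 4 ⨾ .add 18 24 4 ⨾ .add 24 17 3 ⨾ .add 17 19 4 ⨾ .add 19 24 4)
      skip) ⨾
  .add 21 21 3

/-- Computes a tally in the registers `16` to `19`. -/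
def tallyCmd : Cmd :=
  (.const 16 0 ⨾ .const 17 0 ⨾ .const 18 0 ⨾ .const 19 0 ⨾ .const 21 0) ⨾ .loop 21 2 pushCmd

/-- Computes the weight of the tally in the register `22`. -/
def weightCmd : Cmd :=
  (.add 20 16 17 ⨾ .add 20 20 18 ⨾ .add 20 20 19 ⨾ .add 20 20 3 ⨾ .sub 21 16 17 ⨾ .sub 22 17 16 ⨾
    .add 21 21 22 ⨾ .add 21 21 3 ⨾ .const 22 0 ⨾ .const 23 0) ⨾
  .loop 23 2 (.add 23 23 20 ⨾ .add 22 22 21)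

/-- Adds the product of the registers `22` and `a` to the register `d`. -/
def mulAddCmd (d a : ℕ) : Cmd := .const 24 0 ⨾ .loop 24 a (.add d d 22 ⨾ .add 24 24 3)

/-- Adds the contributions of one coordinate to the registers `13` and `14`. -/
def coordCmd : Cmd := tallyCmd ⨾ weightCmd ⨾ mulAddCmd 13 18 ⨾ mulAddCmd 14 19 ⨾ .add 15 15 3

/-- Compares the labels in the registers `11` and `10`. -/
def compareCmd : Cmd :=
  (.const 13 0 ⨾ .const 14 0 ⨾ .ite 11 10 (.const 13 1) skip ⨾ .const 15 0) ⨾ .loop 15 0 coordCmd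

/-! ### Correctness and cost of one comparison -/

section Specs

variable {n r : ℕ} {z : Samples n r} {α : ℝ}

/-- Registers 3 and 4 hold 1 and 0, so that adding them increments or copies. Register 24 is the
temporary for exchanging the classes. -/
theorem reaches_pushCmd {s : Store} (h3 : s.reg 3 = 1) (h4 : s.reg 4 = 0) {T : Tally}
    (h16 : s.reg 16 = T.ap) (h17 : s.reg 17 = T.am) (h18 : s.reg 18 = T.bp)
    (h19 : s.reg 19 = T.bm) :
    Reaches z α pushCmd s 20 fun s' =>
      (∀ i < 16, s'.reg i = s.reg i) ∧ s'.mem = s.mem ∧ s'.reg 21 = s.reg 21 + 1 ∧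
      let T' := T.push (readSample z (s.reg 11) (s.reg 15) (s.reg 21))
        (readSample z (s.reg 10) (s.reg 15) (s.reg 21))
      s'.reg 16 = T'.ap ∧ s'.reg 17 = T'.am ∧ s'.reg 18 = T'.bp ∧ s'.reg 19 = T'.bm := by
  refine (Reaches.simple (by simp [pushCmd, skip, Cmd.IsSimple]) ?_).mono
    (by simp [pushCmd, skip, Cmd.cost]) fun _ h => h
  simp only [pushCmd, skip, interp, Store.setReg, Function.update_apply, Nat.reduceEqDiff,
    if_true, if_false, Tally.push]
  split_ifs with c₁ c₂
  all_goals
    refine ⟨fun i hi => ?_, rfl, ?_⟩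
    · rw [if_neg (by omega)]
      simp (disch := omega) only [Function.update_of_ne]
    · simp [h3, h4, h16, h17, h18, h19]

theorem reaches_tallyCmd {s : Store} (h2 : s.reg 2 = r) (h3 : s.reg 3 = 1) (h4 : s.reg 4 = 0) :
    Reaches z α tallyCmd s (21 * r + 11) fun s' =>
      (∀ i < 16, s'.reg i = s.reg i) ∧ s'.mem = s.mem ∧
      let T := coordTally z (s.reg 11) (s.reg 10) (s.reg 15)
      s'.reg 16 = T.ap ∧ s'.reg 17 = T.am ∧ s'.reg 18 = T.bp ∧ s'.reg 19 = T.bm := by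
  let Inv : ℕ → Store → Prop := fun l s' =>
    (∀ i < 16, s'.reg i = s.reg i) ∧ s'.mem = s.mem ∧ s'.reg 21 = l ∧
      let T := tally (fun l => readSample z (s.reg 11) (s.reg 15) l)
        (fun l => readSample z (s.reg 10) (s.reg 15) l) l
      s'.reg 16 = T.ap ∧ s'.reg 17 = T.am ∧ s'.reg 18 = T.bp ∧ s'.reg 19 = T.bm
  have hinit : Reaches z α
      (.const 16 0 ⨾ .const 17 0 ⨾ .const 18 0 ⨾ .const 19 0 ⨾ .const 21 0) s 9 (Inv 0) := by
    refine (Reaches.simple (by simp [Cmd.IsSimple]) ?_).mono (by simp [Cmd.cost]) fun _ h => h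
    refine ⟨fun i hi => ?_, rfl, ?_⟩
    · simp (disch := omega) only [interp, Store.setReg, Function.update_of_ne]
    · simp [interp, Store.setReg, tally]
  refine (hinit.seq fun s₁ h₁ => Reaches.loop Inv (fun _ => 20) r ?_ ?_ h₁).mono ?_ ?_
  · rintro l hl s' ⟨hf, hm, h21, h16, h17, h18, h19⟩
    refine ⟨by rw [h21, hf 2 (by norm_num), h2]; exact hl, ?_⟩
    refine (reaches_pushCmd (by rw [hf 3 (by norm_num), h3]) (by rw [hf 4 (by norm_num), h4])
      h16 h17 h18 h19).mono le_rfl ?_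
    rintro s'' ⟨hf', hm', h21', h16', h17', h18', h19'⟩
    rw [hf 10 (by norm_num), hf 11 (by norm_num), hf 15 (by norm_num), h21] at h16' h17' h18' h19'
    exact ⟨fun i hi => (hf' i hi).trans (hf i hi), hm'.trans hm, by rw [h21', h21],
      h16', h17', h18', h19'⟩
  · rintro s' ⟨hf, -, h21, -⟩
    rw [h21, hf 2 (by norm_num), h2]
    exact lt_irrefl _
  · simp; omega
  · rintro s' ⟨hf, hm, -, h⟩
    exact ⟨hf, hm, h⟩

theorem reaches_weightCmd {s : Store} (h2 : s.reg 2 = r) (h3 : s.reg 3 = 1) {T : Tally}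
    (h16 : s.reg 16 = T.ap) (h17 : s.reg 17 = T.am) (h18 : s.reg 18 = T.bp)
    (h19 : s.reg 19 = T.bm) :
    Reaches z α weightCmd s (4 * r + 21) fun s' =>
      (∀ i < 20, s'.reg i = s.reg i) ∧ s'.mem = s.mem ∧ s'.reg 22 = T.weight r := by
  let Inv : ℕ → Store → Prop := fun j s' =>
    (∀ i < 20, s'.reg i = s.reg i) ∧ s'.mem = s.mem ∧ s'.reg 20 = T.total + 1 ∧
      s'.reg 21 = T.ap - T.am + (T.am - T.ap) + 1 ∧ s'.reg 23 = j * (T.total + 1) ∧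
      s'.reg 22 = j * (T.ap - T.am + (T.am - T.ap) + 1)
  have hinit : Reaches z α (.add 20 16 17 ⨾ .add 20 20 18 ⨾ .add 20 20 19 ⨾ .add 20 20 3 ⨾
      .sub 21 16 17 ⨾ .sub 22 17 16 ⨾ .add 21 21 22 ⨾ .add 21 21 3 ⨾ .const 22 0 ⨾ .const 23 0)
      s 19 (Inv 0) := by
    refine (Reaches.simple (by simp [Cmd.IsSimple]) ?_).mono (by simp [Cmd.cost]) fun _ h => h
    refine ⟨fun i hi => ?_, rfl, ?_⟩
    · simp (disch := omega) only [interp, Store.setReg, Function.update_of_ne]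
    · simp [interp, Store.setReg, h3, h16, h17, h18, h19, Tally.total]
  -- Division by repeated addition: multiples of `T.total + 1` stay below r for exactly ⌈r/(T.total
  -- + 1)⌉ rounds, and each round adds one copy of the second factor of the weight.
  have hJ : ∀ j, j * (T.total + 1) < r ↔ j < (r + T.total) / (T.total + 1) := fun j => by
    rw [← Nat.succ_le_iff (m := j), Nat.le_div_iff_mul_le (by omega), Nat.succ_mul]
    omega
  have hJr : (r + T.total) / (T.total + 1) ≤ r := by
    by_contra! h
    have := (hJ r).2 h
    nlinarith
  refine (hinit.seq fun s₁ h₁ => Reaches.loop Inv (fun _ => 3)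
    ((r + T.total) / (T.total + 1)) ?_ ?_ h₁).mono ?_ ?_
  · rintro j hj s' ⟨hf, hm, h20, h21, h23, h22⟩
    refine ⟨by rw [h23, hf 2 (by norm_num), h2, hJ]; exact hj, ?_⟩
    refine (Reaches.simple (by simp [Cmd.IsSimple]) ?_).mono (by simp [Cmd.cost]) fun _ h => h
    refine ⟨fun i hi => ?_, hm, ?_⟩
    · simp (disch := omega) only [interp, Store.setReg, Function.update_of_ne]
      exact hf i hi
    · simp only [interp, Store.setReg, Function.update_apply, Nat.reduceEqDiff, if_true, if_false,
        h20, h21, h22, h23]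
      refine ⟨trivial, trivial, by ring, by ring⟩
  · rintro s' ⟨hf, -, -, -, h23, -⟩
    rw [h23, hf 2 (by norm_num), h2, hJ]
    exact lt_irrefl _
  · simp only [Finset.sum_const, Finset.card_range, smul_eq_mul]; omega
  · rintro s' ⟨hf, hm, -, -, -, h⟩
    exact ⟨hf, hm, h⟩

theorem reaches_mulAddCmd {s : Store} {d a : ℕ} (hd : d < 15) (ha : a ≠ d) (ha' : a < 20)
    (hd3 : d ≠ 3) (h3 : s.reg 3 = 1) :
    Reaches z α (mulAddCmd d a) s (4 * s.reg a + 3) fun s' =>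
      (∀ i < 24, i ≠ d → s'.reg i = s.reg i) ∧ s'.mem = s.mem ∧
      s'.reg d = s.reg d + s.reg 22 * s.reg a := by
  let Inv : ℕ → Store → Prop := fun j s' =>
    (∀ i < 24, i ≠ d → s'.reg i = s.reg i) ∧ s'.mem = s.mem ∧ s'.reg 24 = j ∧
      s'.reg d = s.reg d + s.reg 22 * j
  have hinit : Reaches z α (.const 24 0) s 1 (Inv 0) := by
    refine (Reaches.simple (by simp [Cmd.IsSimple]) ?_).mono (by simp [Cmd.cost]) fun _ h => h
    refine ⟨fun i hi _ => ?_, rfl, ?_⟩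
    · simp (disch := omega) only [interp, Store.setReg, Function.update_of_ne]
    · simp (disch := omega) [interp, Store.setReg, Function.update_of_ne]
  refine (hinit.seq fun s₁ h₁ => Reaches.loop Inv (fun _ => 3) (s.reg a) ?_ ?_ h₁).mono ?_ ?_
  · rintro j hj s' ⟨hf, hm, h24, hd'⟩
    refine ⟨by rw [h24, hf a (by omega) ha]; exact hj, ?_⟩
    refine (Reaches.simple (by simp [Cmd.IsSimple]) ?_).mono (by simp [Cmd.cost]) fun _ h => h
    refine ⟨fun i hi hid => ?_, hm, ?_⟩
    · simp (disch := omega) only [interp, Store.setReg, Function.update_of_ne]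
      exact hf i hi hid
    · have h3' : s'.reg 3 = 1 := (hf 3 (by norm_num) hd3.symm).trans h3
      simp (disch := omega) only [interp, Store.setReg, Function.update_self,
        Function.update_of_ne, h24, h3', hd', hf 22 (by norm_num) (by omega)]
      exact ⟨trivial, by ring⟩
  · rintro s' ⟨hf, -, h24, -⟩
    rw [h24, hf a (by omega) ha]
    exact lt_irrefl _
  · simp only [Finset.sum_const, Finset.card_range, smul_eq_mul]; omega
  · rintro s' ⟨hf, hm, -, h⟩
    exact ⟨hf, hm, h⟩

theorem reaches_coordCmd {s : Store} (h2 : s.reg 2 = r) (h3 : s.reg 3 = 1) (h4 : s.reg 4 = 0) :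
    Reaches z α coordCmd s (33 * r + 43) fun s' =>
      (∀ i < 13, s'.reg i = s.reg i) ∧ s'.mem = s.mem ∧ s'.reg 15 = s.reg 15 + 1 ∧
      let T := coordTally z (s.reg 11) (s.reg 10) (s.reg 15)
      s'.reg 13 = s.reg 13 + T.weight r * T.bp ∧ s'.reg 14 = s.reg 14 + T.weight r * T.bm := by
  set T := coordTally z (s.reg 11) (s.reg 10) (s.reg 15) with hT
  -- Multiplication is repeated addition; bounding the multipliers by r keeps the cost of a column
  -- linear in r.
  have hle : T.total ≤ r := total_tally_le _ _ _
  have hbp : T.bp ≤ r := le_trans (by unfold Tally.total; omega) hle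
  have hbm : T.bm ≤ r := le_trans (by unfold Tally.total; omega) hle
  refine ((reaches_tallyCmd h2 h3 h4).seq (T₂ := 12 * r + 31) fun s₁ h₁ => ?_).mono
    (by omega) fun _ h => h
  obtain ⟨f₁, m₁, a₁, a₂, a₃, a₄⟩ := h₁
  refine ((reaches_weightCmd (T := T) (by rw [f₁ 2 (by norm_num), h2])
    (by rw [f₁ 3 (by norm_num), h3]) a₁ a₂ a₃ a₄).seq (T₂ := 8 * r + 9) fun s₂ h₂ => ?_).mono
    (by omega) fun _ h => h
  obtain ⟨f₂, m₂, b₁⟩ := h₂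
  refine ((reaches_mulAddCmd (d := 13) (a := 18) (by norm_num) (by norm_num) (by norm_num)
    (by norm_num) (by rw [f₂ 3 (by norm_num), f₁ 3 (by norm_num), h3])).seq
    (T₂ := 4 * r + 5) fun s₃ h₃ => ?_).mono
    (by rw [f₂ 18 (by norm_num), a₃]; simp only [← hT]; omega) fun _ h => h
  obtain ⟨f₃, m₃, c₁⟩ := h₃
  refine ((reaches_mulAddCmd (d := 14) (a := 19) (by norm_num) (by norm_num) (by norm_num)
    (by norm_num) (by rw [f₃ 3 (by norm_num) (by norm_num), f₂ 3 (by norm_num),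
      f₁ 3 (by norm_num), h3])).seq
    (T₂ := 1) fun s₄ h₄ => ?_).mono
    (by rw [f₃ 19 (by norm_num) (by norm_num), f₂ 19 (by norm_num), a₄]; simp only [← hT]; omega)
    fun _ h => h
  obtain ⟨f₄, m₄, d₁⟩ := h₄
  refine (Reaches.simple (by simp [Cmd.IsSimple]) ?_).mono (by simp [Cmd.cost]) fun _ h => h
  have e3 : s₄.reg 3 = 1 := by
    rw [f₄ 3 (by norm_num) (by norm_num), f₃ 3 (by norm_num) (by norm_num), f₂ 3 (by norm_num),
      f₁ 3 (by norm_num), h3]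
  have e15 : s₄.reg 15 = s.reg 15 := by
    rw [f₄ 15 (by norm_num) (by norm_num), f₃ 15 (by norm_num) (by norm_num),
      f₂ 15 (by norm_num), f₁ 15 (by norm_num)]
  have e22 : s₃.reg 22 = T.weight r := by rw [f₃ 22 (by norm_num) (by norm_num), b₁]
  refine ⟨fun i hi => ?_, ?_, ?_, ?_, ?_⟩
  · simp (disch := omega) only [interp, Store.setReg, Function.update_of_ne]
    rw [f₄ i (by omega) (by omega), f₃ i (by omega) (by omega), f₂ i (by omega), f₁ i (by omega)]
  · exact m₄.trans (m₃.trans (m₂.trans m₁))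
  · simp only [interp, Store.setReg, Function.update_self, e3, e15]
  · simp only [interp, Store.setReg, Function.update_apply, Nat.reduceEqDiff, if_false]
    rw [f₄ 13 (by norm_num) (by norm_num), c₁, b₁, f₂ 13 (by norm_num), f₁ 13 (by norm_num),
      f₂ 18 (by norm_num), a₃]
  · simp only [interp, Store.setReg, Function.update_apply, Nat.reduceEqDiff, if_false]
    rw [d₁, e22, f₃ 14 (by norm_num) (by norm_num), f₂ 14 (by norm_num), f₁ 14 (by norm_num),
      f₃ 19 (by norm_num) (by norm_num), f₂ 19 (by norm_num), a₄]

theorem reaches_compareCmd {s : Store} (h0 : s.reg 0 = n) (h2 : s.reg 2 = r) (h3 : s.reg 3 = 1)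
    (h4 : s.reg 4 = 0) :
    Reaches z α compareCmd s ((33 * r + 44) * n + 10) fun s' =>
      (∀ i < 13, s'.reg i = s.reg i) ∧ s'.mem = s.mem ∧
      (s'.reg 14 < s'.reg 13 ↔ Beats z (s.reg 11) (s.reg 10)) := by
  let Inv : ℕ → Store → Prop := fun c s' =>
    (∀ i < 13, s'.reg i = s.reg i) ∧ s'.mem = s.mem ∧ s'.reg 15 = c ∧
      s'.reg 13 = (if s.reg 11 < s.reg 10 then 1 else 0) + ∑ c ∈ Finset.range c,
        (coordTally z (s.reg 11) (s.reg 10) c).weight r *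
          (coordTally z (s.reg 11) (s.reg 10) c).bp ∧
      s'.reg 14 = ∑ c ∈ Finset.range c,
        (coordTally z (s.reg 11) (s.reg 10) c).weight r *
          (coordTally z (s.reg 11) (s.reg 10) c).bm
  have hinit : Reaches z α
      (.const 13 0 ⨾ .const 14 0 ⨾ .ite 11 10 (.const 13 1) skip ⨾ .const 15 0) s 8 (Inv 0) := by
    refine (Reaches.simple (by simp [Cmd.IsSimple, skip]) ?_).mono (by simp [Cmd.cost, skip])
      fun _ h => h
    simp only [Inv, skip, interp, Store.setReg, Function.update_apply, Nat.reduceEqDiff, if_true,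
      if_false, Finset.range_zero, Finset.sum_empty]
    split_ifs
    all_goals
      refine ⟨fun i hi => ?_, rfl, ?_⟩
      · rw [if_neg (by omega)]
        simp (disch := omega) only [Function.update_of_ne]
      · simp
  refine (hinit.seq fun s₁ h₁ => Reaches.loop Inv (fun _ => 33 * r + 43) n ?_ ?_ h₁).mono ?_ ?_
  · rintro c hc s' ⟨hf, hm, h15, h13, h14⟩
    refine ⟨by rw [h15, hf 0 (by norm_num), h0]; exact hc, ?_⟩
    refine (reaches_coordCmd (by rw [hf 2 (by norm_num), h2]) (by rw [hf 3 (by norm_num), h3])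
      (by rw [hf 4 (by norm_num), h4])).mono le_rfl ?_
    rintro s'' ⟨f, m, a15, a13, a14⟩
    refine ⟨fun i hi => (f i hi).trans (hf i hi), m.trans hm, by rw [a15, h15], ?_, ?_⟩
    · rw [a13, hf 10 (by norm_num), hf 11 (by norm_num), h15, h13, Finset.sum_range_succ, add_assoc]
    · rw [a14, hf 10 (by norm_num), hf 11 (by norm_num), h15, h14, Finset.sum_range_succ]
  · rintro s' ⟨hf, -, h15, -⟩
    rw [h15, hf 0 (by norm_num), h0]
    exact lt_irrefl _
  · simp only [Finset.sum_const, Finset.card_range, smul_eq_mul]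
    linarith [mul_comm n (33 * r + 43 + 1)]
  · rintro s' ⟨hf, hm, -, h13, h14⟩
    refine ⟨hf, hm, ?_⟩
    rw [h13, h14]
    rfl

end Specs

/-! ## One round of the selection -/

/-- Finds the active label whose number is in the register `12`. -/
def scanCmd : Cmd :=
  (.const 11 0 ⨾ .const 13 0) ⨾
  .loop 11 0 (.load 14 11 ⨾
    .ite 14 3 (.ite 12 13 skip (.add 10 11 4) ⨾ .add 13 13 3) skip ⨾ .add 11 11 3)

/-- Marks and counts the active labels that beat the pivot. -/
def sweepCmd : Cmd :=
  (.const 11 0 ⨾ .const 12 0) ⨾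
  .loop 11 0 (.load 13 11 ⨾
    .ite 13 3 (compareCmd ⨾ .ite 14 13 (.const 13 3 ⨾ .store 11 13 ⨾ .add 12 12 3) skip) skip ⨾
    .add 11 11 3)

/-- Accepts the marked labels and the pivot, if there is room for them, and rejects the other
active labels otherwise. -/
def updateCmd : Cmd :=
  (.ite 12 1 (.const 13 0 ⨾ .const 14 1 ⨾ .const 15 1 ⨾ .add 12 12 3 ⨾ .sub 8 8 12 ⨾ .sub 1 1 12)
    (.const 13 2 ⨾ .const 14 0 ⨾ .const 15 2 ⨾ .add 8 12 4) ⨾ .const 11 0) ⨾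
  .loop 11 0 (.load 16 11 ⨾
    .ite 16 3 (.store 11 13) (.ite 5 16 (.store 11 14) skip) ⨾ .add 11 11 3) ⨾
  .store 10 15

open Classical in
/-- The active labels. -/
def active (n : ℕ) (st : ℕ → ℕ) : Finset ℕ := {x ∈ Finset.range n | st x = 0}

open Classical in
/-- The active labels that beat the pivot. -/
def beaters {n r : ℕ} (z : Samples n r) (st : ℕ → ℕ) (p : ℕ) : Finset ℕ :=
  {x ∈ Finset.range n | st x = 0 ∧ Beats z x p}

open Classical in
/-- The status of the labels after one round. -/
def nextStatus {n r : ℕ} (z : Samples n r) (k : ℕ) (st : ℕ → ℕ) (p : ℕ) : ℕ → ℕ :=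
  if (beaters z st p).card < k then fun x => if x = p ∨ x ∈ beaters z st p then 1 else st x
  else fun x => if x ∈ active n st ∧ x ∉ beaters z st p then 2 else st x

/-- The number of labels that remain to be selected after one round. -/
def nextQuota {n r : ℕ} (z : Samples n r) (k : ℕ) (st : ℕ → ℕ) (p : ℕ) : ℕ :=
  if (beaters z st p).card < k then k - ((beaters z st p).card + 1) else k

/-- The number of active labels after one round. -/
def nextSize {n r : ℕ} (z : Samples n r) (k : ℕ) (st : ℕ → ℕ) (p : ℕ) : ℕ :=
  if (beaters z st p).card < k then (active n st).card - ((beaters z st p).card + 1)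
  else (beaters z st p).card

/-- The registers hold the constants, the quota `k`, the number of active labels and the
budget `b`. -/
structure Ready (n r k b : ℕ) (s : Store) : Prop where
  h0 : s.reg 0 = n
  h1 : s.reg 1 = k
  h2 : s.reg 2 = r
  h3 : s.reg 3 = 1
  h4 : s.reg 4 = 0
  h5 : s.reg 5 = 2
  h8 : s.reg 8 = (active n s.mem).card
  h9 : s.reg 9 = b
  le_two : ∀ x < n, s.mem x ≤ 2

/-! ### Correctness and cost of one round of selection -/

section Specs

variable {n r : ℕ} {z : Samples n r} {α : ℝ}

theorem count_eq_card_active (st : ℕ → ℕ) :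
    Nat.count (fun x => st x = 0) n = (active n st).card := by
  rw [Nat.count_eq_card_filter_range, active]

/-- Register 10 is overwritten at each active label as long as the count of earlier active labels
has not exceeded the wanted index. The last overwriting happens when the two are equal, at the
wanted label. -/
theorem reaches_scanCmd {s : Store} (h0 : s.reg 0 = n) (h3 : s.reg 3 = 1) (h4 : s.reg 4 = 0)
    (hv : s.reg 12 < (active n s.mem).card) :
    Reaches z α scanCmd s (10 * n + 5) fun s' =>
      (∀ i < 10, s'.reg i = s.reg i) ∧ s'.mem = s.mem ∧
      s'.reg 10 = Nat.nth (fun x => s.mem x = 0) (s.reg 12) := by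
  let Inv : ℕ → Store → Prop := fun j s' =>
    (∀ i < 13, i ≠ 10 → i ≠ 11 → s'.reg i = s.reg i) ∧ s'.mem = s.mem ∧ s'.reg 11 = j ∧
      s'.reg 13 = Nat.count (fun x => s.mem x = 0) j ∧
      (s.reg 12 < Nat.count (fun x => s.mem x = 0) j →
        s'.reg 10 = Nat.nth (fun x => s.mem x = 0) (s.reg 12))
  have hinit : Reaches z α (.const 11 0 ⨾ .const 13 0) s 3 (Inv 0) := by
    refine (Reaches.simple (by simp [Cmd.IsSimple]) ?_).mono (by simp [Cmd.cost]) fun _ h => h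
    refine ⟨fun i hi _ _ => ?_, rfl, ?_⟩
    · simp (disch := omega) only [interp, Store.setReg, Function.update_of_ne]
    · simp [interp, Store.setReg]
  refine (hinit.seq fun s₁ h₁ => Reaches.loop Inv (fun _ => 9) n ?_ ?_ h₁).mono ?_ ?_
  · rintro j hj s' ⟨hf, hm, h11, h13, h10⟩
    have e3 : s'.reg 3 = 1 := by rw [hf 3 (by norm_num) (by norm_num) (by norm_num), h3]
    have e4 : s'.reg 4 = 0 := by rw [hf 4 (by norm_num) (by norm_num) (by norm_num), h4]
    have e12 : s'.reg 12 = s.reg 12 := hf 12 (by norm_num) (by norm_num) (by norm_num)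
    refine ⟨by rw [h11, hf 0 (by norm_num) (by norm_num) (by norm_num), h0]; exact hj, ?_⟩
    refine (Reaches.simple (by simp [Cmd.IsSimple, skip]) ?_).mono (by simp [Cmd.cost, skip])
      fun _ h => h
    simp only [Inv, skip, interp, Store.setReg, Function.update_apply, Nat.reduceEqDiff, if_true,
      if_false, hm, h11, h13, e3, e12, Nat.lt_one_iff, Nat.count_succ]
    by_cases hz : s.mem j = 0
    · by_cases hlt : s.reg 12 < Nat.count (fun x => s.mem x = 0) j
      · simp only [hz, hlt, if_true]
        refine ⟨fun i hi h hh => ?_, ?_⟩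
        · simp (disch := omega) only [Function.update_of_ne, if_neg]
          exact hf i hi h hh
        · simpa [h11, h13, e3] using fun _ : s.reg 12 ≤ Nat.count _ j => h10 hlt
      · simp only [hz, hlt, if_true, if_false]
        refine ⟨fun i hi h hh => ?_, ?_⟩
        · simp (disch := omega) only [Function.update_of_ne, if_neg]
          exact hf i hi h hh
        · simp only [Function.update_apply, Nat.reduceEqDiff, if_true, if_false, h11, h13, e3, e4]
          refine ⟨trivial, trivial, trivial, fun h => ?_⟩
          rw [show s.reg 12 = Nat.count (fun x => s.mem x = 0) j by omega,
            Nat.nth_count (p := fun x => s.mem x = 0) hz, add_zero]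
    · simp only [hz, if_false]
      refine ⟨fun i hi h hh => ?_, ?_⟩
      · simp (disch := omega) only [Function.update_of_ne, if_neg]
        exact hf i hi h hh
      · simpa [h11, h13, e3] using h10
  · rintro s' ⟨hf, -, h11, -⟩
    rw [h11, hf 0 (by norm_num) (by norm_num) (by norm_num), h0]
    exact lt_irrefl _
  · simp only [Finset.sum_const, Finset.card_range, smul_eq_mul]; omega
  · rintro s' ⟨hf, hm, -, -, h⟩
    exact ⟨fun i hi => hf i (by omega) (by omega) (by omega), hm,
      h (by rwa [count_eq_card_active])⟩

-- The provisional mark 3 is needed because the fate of the beaters depends on their number, known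
-- only after the sweep. A mark is written only in the turn of its own label, so every label is
-- tested with its old status. Only active labels are charged for a comparison.
open Classical in
theorem reaches_sweepCmd {s : Store} (h0 : s.reg 0 = n) (h2 : s.reg 2 = r) (h3 : s.reg 3 = 1)
    (h4 : s.reg 4 = 0) :
    Reaches z α sweepCmd s ((active n s.mem).card * ((33 * r + 44) * n + 18) + 7 * n + 5)
      fun s' => (∀ i < 11, s'.reg i = s.reg i) ∧
        s'.mem = (fun x => if x ∈ beaters z s.mem (s.reg 10) then 3 else s.mem x) ∧
        s'.reg 12 = (beaters z s.mem (s.reg 10)).card := by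
  let Inv : ℕ → Store → Prop := fun j s' =>
    (∀ i < 11, s'.reg i = s.reg i) ∧ s'.reg 11 = j ∧
      s'.mem = (fun x => if x ∈ {x ∈ Finset.range j | s.mem x = 0 ∧ Beats z x (s.reg 10)} then 3
        else s.mem x) ∧
      s'.reg 12 = {x ∈ Finset.range j | s.mem x = 0 ∧ Beats z x (s.reg 10)}.card
  have hinit : Reaches z α (.const 11 0 ⨾ .const 12 0) s 3 (Inv 0) := by
    refine (Reaches.simple (by simp [Cmd.IsSimple]) ?_).mono (by simp [Cmd.cost]) fun _ h => h
    refine ⟨fun i hi => ?_, ?_⟩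
    · simp (disch := omega) only [interp, Store.setReg, Function.update_of_ne]
    · simp [interp, Store.setReg]
  refine (hinit.seq fun s₁ h₁ => Reaches.loop Inv
    (fun j => 6 + if s.mem j = 0 then (33 * r + 44) * n + 18 else 0) n ?_ ?_ h₁).mono ?_ ?_
  · rintro j hj s' ⟨hf, h11, hm, h12⟩
    have e3 : s'.reg 3 = 1 := by rw [hf 3 (by norm_num), h3]
    refine ⟨by rw [h11, hf 0 (by norm_num), h0]; exact hj, ?_⟩
    have hmj : s'.mem j = s.mem j := by simp [hm]
    have hload : Reaches z α (.load 13 11) s' 1 fun t => t = s'.setReg 13 (s'.mem j) :=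
      (Reaches.simple (by simp [Cmd.IsSimple]) (by simp [interp, h11])).mono (by simp [Cmd.cost])
        fun _ h => h
    refine (hload.seq (T₂ := 4 + if s.mem j = 0 then (33 * r + 44) * n + 18 else 0)
      fun t ht => ?_).mono (by omega) fun _ h => h
    have hbody : Reaches z α (.ite 13 3
        (compareCmd ⨾ .ite 14 13 (.const 13 3 ⨾ .store 11 13 ⨾ .add 12 12 3) skip) skip) t
        (2 + if s.mem j = 0 then (33 * r + 44) * n + 18 else 0)
        fun s'' => (∀ i < 12, s''.reg i = s'.reg i) ∧
          s''.mem = (fun x => if x = j ∧ s.mem j = 0 ∧ Beats z j (s.reg 10) then 3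
            else s'.mem x) ∧
          s''.reg 12 = s'.reg 12 + if s.mem j = 0 ∧ Beats z j (s.reg 10) then 1 else 0 := by
      subst ht
      refine (Reaches.ite (T₁ := (33 * r + 44) * n + 18) (T₂ := 1)
        (fun hlt => ?_) fun hlt => ?_).mono ?_ fun _ h => h
      · have hz : s.mem j = 0 := by
          simpa [Store.setReg, e3, hmj, Function.update_apply] using hlt
        refine ((reaches_compareCmd (by simp [Store.setReg, hf 0, h0])
          (by simp [Store.setReg, hf 2, h2]) (by simp [Store.setReg, hf 3, h3])
          (by simp [Store.setReg, hf 4, h4])).seq (T₂ := 6) fun u hu => ?_).mono (by omega)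
          fun _ h => h
        obtain ⟨fu, mu, hu⟩ := hu
        have e10 : (s'.setReg 13 (s'.mem j)).reg 10 = s.reg 10 := by
          simp [Store.setReg, hf 10]
        have e11 : (s'.setReg 13 (s'.mem j)).reg 11 = j := by simp [Store.setReg, h11]
        rw [e10, e11] at hu
        have f' : ∀ i < 13, u.reg i = s'.reg i := fun i hi => by
          rw [fu i hi]
          simp (disch := omega) only [Store.setReg, Function.update_of_ne]
        refine (Reaches.simple (by simp [Cmd.IsSimple, skip]) ?_).mono (by simp [Cmd.cost, skip])
          fun _ h => h
        simp only [skip, interp, hu]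
        by_cases hb : Beats z j (s.reg 10)
        · simp only [hb, hz, if_true, and_self, and_true]
          refine ⟨fun i hi => ?_, ?_, ?_⟩
          · simp (disch := omega) only [Store.setReg, Store.setMem, Function.update_of_ne]
            exact f' i (by omega)
          · funext x
            simp only [Store.setReg, Store.setMem, Function.update_self, Function.update_apply,
              Nat.reduceEqDiff, if_false, f' 11 (by norm_num), h11, mu]
          · simp only [Store.setReg, Store.setMem, Function.update_apply, Nat.reduceEqDiff,
              if_false, if_true, f' 12 (by norm_num), f' 3 (by norm_num), e3]
        · simp only [hb, if_false, and_false, add_zero]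
          refine ⟨fun i hi => ?_, mu, ?_⟩
          · simp (disch := omega) only [Store.setReg, Function.update_of_ne]
            exact f' i (by omega)
          · simp only [Store.setReg, Function.update_apply, Nat.reduceEqDiff, if_false,
              f' 12 (by norm_num)]
      · have hz : s.mem j ≠ 0 := by
          simpa [Store.setReg, e3, hmj, Function.update_apply] using hlt
        refine (Reaches.simple (by simp [Cmd.IsSimple, skip]) ?_).mono (by simp [Cmd.cost, skip])
          fun _ h => h
        simp only [skip, interp, hz, false_and, and_false, if_false, add_zero]
        refine ⟨fun i hi => ?_, rfl, ?_⟩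
        · simp (disch := omega) only [Store.setReg, Function.update_of_ne]
        · simp [Store.setReg]
      · simp only [Store.setReg, Function.update_apply, Nat.reduceEqDiff, if_true, if_false, e3,
          hmj, Nat.lt_one_iff]
        split_ifs <;> omega
    refine (hbody.seq (T₂ := 1) fun u hu => ?_).mono (by omega) fun _ h => h
    obtain ⟨fu, mu, hu⟩ := hu
    refine (Reaches.simple (by simp [Cmd.IsSimple]) ?_).mono (by simp [Cmd.cost]) fun _ h => h
    refine ⟨fun i hi => ?_, ?_, ?_, ?_⟩
    · simp (disch := omega) only [interp, Store.setReg, Function.update_of_ne]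
      rw [fu i (by omega), hf i hi]
    · simp only [interp, Store.setReg, Function.update_self, fu 11 (by norm_num), h11,
        fu 3 (by norm_num), e3]
    · simp only [interp, Store.setReg, mu, hm]
      funext x
      simp only [Finset.mem_filter, Finset.mem_range]
      rcases lt_trichotomy x j with h | rfl | h
      · simp [h.ne, h, h.trans (Nat.lt_succ_self j)]
      · simp
      · simp [h.ne', show ¬ x < j by omega, show ¬ x < j + 1 by omega]
    · simp only [interp, Store.setReg, Function.update_apply, Nat.reduceEqDiff, if_false, hu, h12]
      rw [Finset.range_add_one, Finset.filter_insert]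
      split_ifs with hc
      · rw [Finset.card_insert_of_notMem (by simp)]
      · rfl
  · rintro s' ⟨hf, h11, -⟩
    rw [h11, hf 0 (by norm_num), h0]
    exact lt_irrefl _
  · rw [Finset.sum_add_distrib, Finset.sum_add_distrib, ← Finset.sum_filter]
    simp only [Finset.sum_const, Finset.card_range, smul_eq_mul, active]
    omega
  · rintro s' ⟨hf, -, hm, h⟩
    exact ⟨hf, hm, h⟩

theorem beaters_subset_active (st : ℕ → ℕ) (p : ℕ) : beaters z st p ⊆ active n st := by
  classical
  intro x
  simp only [beaters, active, Finset.mem_filter]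
  tauto

theorem notMem_beaters_self (st : ℕ → ℕ) (p : ℕ) : p ∉ beaters z st p := fun h => by
  simp only [beaters, Finset.mem_filter] at h
  exact not_beats_self z p h.2.2

open Classical in
/-- The effect of the update on the registers and the memory. -/
theorem reaches_updateCmd {k p : ℕ} {st : ℕ → ℕ} {s : Store} (h0 : s.reg 0 = n)
    (h1 : s.reg 1 = k) (h3 : s.reg 3 = 1) (h4 : s.reg 4 = 0) (h5 : s.reg 5 = 2)
    (h8 : s.reg 8 = (active n st).card) (h10 : s.reg 10 = p) (hp : p ∈ active n st)
    (h12 : s.reg 12 = (beaters z st p).card) (hst : ∀ x < n, st x ≤ 2)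
    (hm : s.mem = fun x => if x ∈ beaters z st p then 3 else st x) :
    Reaches z α updateCmd s (8 * n + 20) fun s' =>
      (∀ i < 10, i ≠ 1 → i ≠ 8 → s'.reg i = s.reg i) ∧ s'.mem = nextStatus z k st p ∧
      s'.reg 1 = nextQuota z k st p ∧ s'.reg 8 = nextSize z k st p := by
  let W := beaters z st p
  have hWn : ∀ x ∈ W, x < n ∧ st x = 0 := fun x hx => by
    simp only [W, beaters, Finset.mem_filter, Finset.mem_range] at hx
    exact ⟨hx.1, hx.2.1⟩
  have hpW : p ∉ W := notMem_beaters_self st p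
  -- The final statuses of unmarked active labels (`v₀`), marked labels (`v₃`) and the pivot (`w`).
  -- The pivot is unmarked, so the loop gives it `v₀`; the last instruction overwrites this by `w`.
  let v₀ : ℕ := if W.card < k then 0 else 2
  let v₃ : ℕ := if W.card < k then 1 else 0
  let w : ℕ := if W.card < k then 1 else 2
  let Inv : ℕ → Store → Prop := fun j s' =>
    (∀ i < 11, i ≠ 1 → i ≠ 8 → s'.reg i = s.reg i) ∧ s'.reg 11 = j ∧
      s'.reg 1 = nextQuota z k st p ∧ s'.reg 8 = nextSize z k st p ∧
      s'.reg 13 = v₀ ∧ s'.reg 14 = v₃ ∧ s'.reg 15 = w ∧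
      s'.mem = fun x => if x < j then (if x ∈ W then v₃ else if st x = 0 then v₀ else st x)
        else if x ∈ W then 3 else st x
  have hinit : Reaches z α (.ite 12 1
      (.const 13 0 ⨾ .const 14 1 ⨾ .const 15 1 ⨾ .add 12 12 3 ⨾ .sub 8 8 12 ⨾ .sub 1 1 12)
      (.const 13 2 ⨾ .const 14 0 ⨾ .const 15 2 ⨾ .add 8 12 4) ⨾ .const 11 0) s 14 (Inv 0) := by
    refine (Reaches.simple (by simp [Cmd.IsSimple]) ?_).mono (by simp [Cmd.cost]) fun _ h => h
    simp only [Inv, interp, h12, h1, v₀, v₃, w, nextQuota, nextSize, W]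
    by_cases hc : (beaters z st p).card < k
    · simp only [hc, if_true]
      refine ⟨fun i hi h h' => ?_, ?_⟩
      · simp (disch := omega) only [Store.setReg, Function.update_of_ne]
      · simp [Store.setReg, h12, h1, h3, h8, hm]
    · simp only [hc, if_false]
      refine ⟨fun i hi h h' => ?_, ?_⟩
      · simp (disch := omega) only [Store.setReg, Function.update_of_ne]
      · simp [Store.setReg, h12, h1, h4, hm]
  refine (hinit.seq fun s₁ h₁ => (Reaches.loop Inv (fun _ => 7) n ?_ ?_ h₁).seq
    (T₂ := 1) fun s₂ h₂ => ?_).mono ?_ fun _ h => h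
  · rintro j hj s' ⟨hf, h11, e1, e8, h13, h14, h15, hm'⟩
    have e3 : s'.reg 3 = 1 := by rw [hf 3 (by norm_num) (by norm_num) (by norm_num), h3]
    have e5 : s'.reg 5 = 2 := by rw [hf 5 (by norm_num) (by norm_num) (by norm_num), h5]
    refine ⟨by rw [h11, hf 0 (by norm_num) (by norm_num) (by norm_num), h0]; exact hj, ?_⟩
    refine (Reaches.simple (by simp [Cmd.IsSimple, skip]) ?_).mono (by simp [Cmd.cost, skip])
      fun _ h => h
    have hmj : s'.mem j = if j ∈ W then 3 else st j := by simp [hm']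
    have key : ∀ u : Store, (∀ i < 16, u.reg i = s'.reg i) →
        u.mem = (fun x => if x = j then (if j ∈ W then v₃ else if st j = 0 then v₀ else st j)
          else s'.mem x) → Inv (j + 1) (u.setReg 11 (u.reg 11 + u.reg 3)) := by
      intro u fu mu
      refine ⟨fun i hi h h' => ?_, ?_, ?_, ?_, ?_, ?_, ?_, ?_⟩
      · simp (disch := omega) only [Store.setReg, Function.update_of_ne]
        rw [fu i (by omega), hf i hi h h']
      · simp only [Store.setReg, Function.update_self]
        rw [fu 11 (by norm_num), fu 3 (by norm_num), h11, e3]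
      · simp only [Store.setReg, Function.update_apply, if_false, OfNat.one_ne_ofNat]
        rw [fu 1 (by norm_num), e1]
      · simp only [Store.setReg, Function.update_apply, Nat.reduceEqDiff, if_false]
        rw [fu 8 (by norm_num), e8]
      · simp only [Store.setReg, Function.update_apply, Nat.reduceEqDiff, if_false]
        rw [fu 13 (by norm_num), h13]
      · simp only [Store.setReg, Function.update_apply, Nat.reduceEqDiff, if_false]
        rw [fu 14 (by norm_num), h14]
      · simp only [Store.setReg, Function.update_apply, Nat.reduceEqDiff, if_false]
        rw [fu 15 (by norm_num), h15]
      · simp only [Store.setReg, mu, hm']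
        funext x
        rcases lt_trichotomy x j with h | rfl | h
        · simp [h.ne, h, h.trans (Nat.lt_succ_self j)]
        · simp
        · simp [h.ne', show ¬ x < j by omega, show ¬ x < j + 1 by omega]
    simp only [interp, skip, h11, hmj]
    apply key
    · intro i hi
      split_ifs <;> simp (disch := omega) only [Store.setReg, Store.setMem, Function.update_of_ne]
    · have hmx : s'.mem = fun x => if x = j then s'.mem j else s'.mem x := by
        funext x; split_ifs with h <;> simp [h]
      by_cases hW : j ∈ W
      · simp [hW, Store.setReg, Store.setMem, e3, e5, h11, h14]
        funext x
        simp [Function.update_apply]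
      · by_cases hz : st j = 0
        · simp [hW, hz, Store.setReg, Store.setMem, e3, h11, h13]
          funext x
          simp [Function.update_apply]
        · have h2 : ¬ 2 < st j := not_lt.2 (hst j hj)
          simp [hW, hz, h2, Store.setReg, e3, e5]
          conv_lhs => rw [hmx]
          simp [hmj, hW]
  · rintro s' ⟨hf, h11, -⟩
    rw [h11, hf 0 (by norm_num) (by norm_num) (by norm_num), h0]
    exact lt_irrefl _
  · obtain ⟨hf, h11, e1, e8, h13, h14, h15, hm'⟩ := h₂
    refine (Reaches.simple (Q := fun s' =>
      (∀ i < 10, i ≠ 1 → i ≠ 8 → s'.reg i = s.reg i) ∧ s'.mem = nextStatus z k st p ∧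
      s'.reg 1 = nextQuota z k st p ∧ s'.reg 8 = nextSize z k st p)
      (by simp [Cmd.IsSimple]) ?_).mono (by simp [Cmd.cost]) fun _ h => h
    refine ⟨fun i hi h h' => hf i (by omega) h h', ?_, e1, e8⟩
    simp only [interp, Store.setMem, hm', h15, hf 10 (by norm_num) (by norm_num) (by norm_num), h10]
    funext x
    rw [Function.update_apply]
    by_cases hxp : x = p
    · subst hxp
      simp only [if_true, nextStatus, w, W]
      split_ifs with hc
      · simp
      · simp [hp, show x ∉ beaters z st x from hpW]
    · simp only [hxp, if_false, nextStatus, v₀, v₃, W]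
      by_cases hxW : x ∈ beaters z st p
      · have := hWn x hxW
        simp only [this.1, hxW, if_true]
        split_ifs with hc <;> simp [hxW, this.2]
      · by_cases hxn : x < n
        · split_ifs with hc <;> simp [hxW, hxn, hxp, active] <;> tauto
        · split_ifs with hc <;> simp [hxW, hxn, hxp, active]
  · simp only [Finset.sum_const, Finset.card_range, smul_eq_mul]; omega

theorem active_nextStatus (k : ℕ) (st : ℕ → ℕ) (p : ℕ) :
    active n (nextStatus z k st p) = if (beaters z st p).card < k then
      active n st \ insert p (beaters z st p) else beaters z st p := by
  classical
  split_ifs with hc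
  · ext x
    simp only [active, Finset.mem_filter, nextStatus, hc, if_true, Finset.mem_sdiff,
      Finset.mem_insert]
    split_ifs with h <;> simp [h]
  · ext x
    have := @beaters_subset_active n r z st p x
    simp only [active, Finset.mem_filter, nextStatus, hc, if_false] at this ⊢
    split_ifs with h
    · simp [h.2]
    · tauto

theorem card_active_nextStatus (k : ℕ) {st : ℕ → ℕ} {p : ℕ} (hp : p ∈ active n st) :
    (active n (nextStatus z k st p)).card = nextSize z k st p := by
  rw [active_nextStatus, nextSize]
  split_ifs with hc
  · rw [Finset.card_sdiff_of_subset (Finset.insert_subset hp (beaters_subset_active st p)),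
      Finset.card_insert_of_notMem (notMem_beaters_self st p)]
  · rfl

theorem nextStatus_le_two (k : ℕ) {st : ℕ → ℕ} (hst : ∀ x < n, st x ≤ 2) (p : ℕ) :
    ∀ x < n, nextStatus z k st p x ≤ 2 := by
  intro x hx
  unfold nextStatus
  split_ifs <;> dsimp only <;> split_ifs <;> simp [hst x hx]

/-- The deterministic part of a round, for the active label with number `v`. -/
theorem reaches_round {k b v : ℕ} {s : Store} (hs : Ready n r k b s) (h12 : s.reg 12 = v)
    (hv : v < (active n s.mem).card) :
    Reaches z α (scanCmd ⨾ sweepCmd ⨾ updateCmd) s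
      ((active n s.mem).card * ((33 * r + 44) * n + 18) + 25 * n + 32) fun s' =>
      Ready n r (nextQuota z k s.mem (Nat.nth (fun x => s.mem x = 0) v)) b s' ∧
      s'.mem = nextStatus z k s.mem (Nat.nth (fun x => s.mem x = 0) v) := by
  classical
  set p := Nat.nth (fun x => s.mem x = 0) v with hpdef
  have hp : p ∈ active n s.mem := by
    rw [← count_eq_card_active] at hv
    simp only [active, Finset.mem_filter, Finset.mem_range]
    exact ⟨Nat.nth_lt_of_lt_count hv,
      Nat.nth_mem (p := fun x => s.mem x = 0) v fun hf => hv.trans_le (Nat.count_le_card hf n)⟩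
  refine ((reaches_scanCmd hs.h0 hs.h3 hs.h4 (by rwa [h12])).seq
    (T₂ := (active n s.mem).card * ((33 * r + 44) * n + 18) + 15 * n + 26) fun s₁ h₁ => ?_).mono
    (by omega) fun _ h => h
  obtain ⟨f₁, m₁, p₁⟩ := h₁
  rw [h12, ← hpdef] at p₁
  refine ((reaches_sweepCmd (by rw [f₁ 0 (by norm_num), hs.h0])
    (by rw [f₁ 2 (by norm_num), hs.h2]) (by rw [f₁ 3 (by norm_num), hs.h3])
    (by rw [f₁ 4 (by norm_num), hs.h4])).seq (T₂ := 8 * n + 20) fun s₂ h₂ => ?_).mono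
    (by rw [m₁]; omega) fun _ h => h
  obtain ⟨f₂, m₂, c₂⟩ := h₂
  rw [p₁, m₁] at m₂ c₂
  have f : ∀ i < 10, s₂.reg i = s.reg i := fun i hi => (f₂ i (by omega)).trans (f₁ i hi)
  refine (reaches_updateCmd (z := z) (k := k) (p := p) (st := s.mem)
    (by rw [f 0 (by norm_num), hs.h0]) (by rw [f 1 (by norm_num), hs.h1])
    (by rw [f 3 (by norm_num), hs.h3]) (by rw [f 4 (by norm_num), hs.h4])
    (by rw [f 5 (by norm_num), hs.h5]) (by rw [f 8 (by norm_num), hs.h8])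
    (by rw [f₂ 10 (by norm_num), p₁]) hp c₂ hs.le_two (by simpa using m₂)).mono le_rfl ?_
  rintro s₃ ⟨f₃, m₃, q₃, k₃⟩
  have g : ∀ i < 10, i ≠ 1 → i ≠ 8 → s₃.reg i = s.reg i := fun i hi h h' =>
    (f₃ i hi h h').trans (f i hi)
  refine ⟨⟨?_, q₃, ?_, ?_, ?_, ?_, ?_, ?_, ?_⟩, m₃⟩
  · rw [g 0 (by norm_num) (by norm_num) (by norm_num), hs.h0]
  · rw [g 2 (by norm_num) (by norm_num) (by norm_num), hs.h2]
  · rw [g 3 (by norm_num) (by norm_num) (by norm_num), hs.h3]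
  · rw [g 4 (by norm_num) (by norm_num) (by norm_num), hs.h4]
  · rw [g 5 (by norm_num) (by norm_num) (by norm_num), hs.h5]
  · rw [k₃, m₃, card_active_nextStatus k hp]
  · rw [g 9 (by norm_num) (by norm_num) (by norm_num), hs.h9]
  · rw [m₃]
    exact nextStatus_le_two k hs.le_two p

end Specs

/-! ## Progress of the selection -/

open Classical in
/-- In a tournament the number of losses, counting one for every player, is a triangular
number. -/
theorem two_mul_sum_card_beaten {R : ℕ → ℕ → Prop} (S : Finset ℕ) (hirr : ∀ x, ¬ R x x)
    (htot : ∀ x y, x ≠ y → (R y x ↔ ¬ R x y)) :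
    2 * ∑ x ∈ S, ({y ∈ S | R y x}.card + 1) = S.card ^ 2 + S.card := by
  have h1 : ∑ x ∈ S, {y ∈ S | R y x}.card = ∑ x ∈ S, {y ∈ S | R x y}.card := by
    simp only [Finset.card_filter]
    exact Finset.sum_comm
  have h2 : ∀ x ∈ S, {y ∈ S | R y x}.card + {y ∈ S | R x y}.card + 1 = S.card := by
    intro x hx
    have : S = insert x ({y ∈ S | R y x} ∪ {y ∈ S | R x y}) := by
      ext y
      simp only [Finset.mem_insert, Finset.mem_union, Finset.mem_filter]
      by_cases hxy : x = y
      · subst hxy; simp [hx]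
      · have := htot x y hxy
        constructor
        · intro hy; tauto
        · rintro (rfl | h | h)
          · exact hx
          · exact h.1
          · exact h.1
    conv_rhs => rw [this]
    rw [Finset.card_insert_of_notMem (by simp [hirr]), Finset.card_union_of_disjoint]
    rw [Finset.disjoint_filter]
    intro y hy h h'
    have hxy : x ≠ y := fun h0 => hirr x (by rw [← h0] at h; exact h)
    exact (htot x y hxy).1 h h'
  have h3 : ∑ x ∈ S, ({y ∈ S | R y x}.card + {y ∈ S | R x y}.card + 1) = S.card ^ 2 := by
    rw [Finset.sum_congr rfl h2, Finset.sum_const, smul_eq_mul, sq]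
  simp only [Finset.sum_add_distrib, ← h1, Finset.sum_const, smul_eq_mul, mul_one] at h3 ⊢
  omega

section Progress

variable {n r : ℕ} {z : Samples n r}

/-- The comparisons separate the set `T` of labels from its complement. -/
def Separates (z : Samples n r) (T : Finset ℕ) : Prop := ∀ y ∈ T, ∀ x < n, x ∉ T → Beats z y x

/-- The labels selected so far and the quota `k` are compatible with the target `T`. -/
structure Compatible (n : ℕ) (T : Finset ℕ) (k : ℕ) (st : ℕ → ℕ) : Prop where
  quota : (active n st ∩ T).card = k
  accepted : ∀ x < n, st x = 1 → x ∈ T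
  rejected : ∀ x < n, st x = 2 → x ∉ T

variable {T : Finset ℕ} {k : ℕ} {st : ℕ → ℕ} {p : ℕ}

/-- A label outside `T` that beats a pivot in `T` would contradict separation, by antisymmetry. -/
theorem insert_beaters_subset (hz : Separates z T) (hpn : p ∈ active n st) (hp : p ∈ T) :
    insert p (beaters z st p) ⊆ active n st ∩ T := by
  classical
  intro x hx
  rcases Finset.mem_insert.1 hx with rfl | hx
  · exact Finset.mem_inter.2 ⟨hpn, hp⟩
  · refine Finset.mem_inter.2 ⟨beaters_subset_active st p hx, ?_⟩
    simp only [beaters, Finset.mem_filter, Finset.mem_range] at hx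
    by_contra hxT
    have hne : x ≠ p := fun h => hxT (h ▸ hp)
    exact (beats_iff_not_beats z hne.symm).1 hx.2.2 (hz p hp x hx.1 hxT)

theorem inter_subset_beaters (hz : Separates z T) (hpn : p ∈ active n st) (hp : p ∉ T) :
    active n st ∩ T ⊆ beaters z st p := by
  classical
  intro x hx
  simp only [active, beaters, Finset.mem_inter, Finset.mem_filter, Finset.mem_range] at hx hpn ⊢
  exact ⟨hx.1.1, hx.1.2, hz x hx.2 p hpn.1 hp⟩

/-- The test made by the program detects the side of the pivot: a pivot in `T` and its beaters fit
among the k active labels of `T`, whereas a pivot outside `T` is beaten by all k of them. -/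
theorem card_beaters_lt_iff (hz : Separates z T) (hk : (active n st ∩ T).card = k)
    (hpn : p ∈ active n st) : (beaters z st p).card < k ↔ p ∈ T := by
  by_cases hp : p ∈ T
  · have := Finset.card_le_card (insert_beaters_subset hz hpn hp)
    rw [Finset.card_insert_of_notMem (notMem_beaters_self st p)] at this
    simp only [hp, iff_true]
    omega
  · have := Finset.card_le_card (inter_subset_beaters hz hpn hp)
    simp only [hp, iff_false]
    omega

theorem Compatible.next (hz : Separates z T) (h : Compatible n T k st) (hpn : p ∈ active n st) :
    Compatible n T (nextQuota z k st p) (nextStatus z k st p) := by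
  classical
  have hlt := card_beaters_lt_iff hz h.quota hpn
  by_cases hp : p ∈ T
  · have hsub := insert_beaters_subset hz hpn hp
    have hc := hlt.2 hp
    refine ⟨?_, ?_, ?_⟩
    · rw [active_nextStatus, nextQuota, if_pos hc, if_pos hc, ← h.quota,
        ← Finset.card_insert_of_notMem (notMem_beaters_self (z := z) st p),
        ← Finset.card_sdiff_of_subset hsub]
      congr 1
      ext x
      simp only [Finset.mem_inter, Finset.mem_sdiff]
      tauto
    · intro x hx h1
      simp only [nextStatus, hc, if_true] at h1
      split_ifs at h1 with hx'
      · exact (Finset.mem_inter.1 (hsub (Finset.mem_insert.2 hx'))).2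
      · exact h.accepted x hx h1
    · intro x hx h1
      simp only [nextStatus, hc, if_true] at h1
      split_ifs at h1 with hx'
      · cases h1
      · exact h.rejected x hx h1
  · have hsub := inter_subset_beaters hz hpn hp
    have hc := hlt.not.2 hp
    refine ⟨?_, ?_, ?_⟩
    · rw [active_nextStatus, nextQuota, if_neg hc, if_neg hc, ← h.quota]
      congr 1
      ext x
      have h1 := @hsub x
      have h2 := @beaters_subset_active n r z st p x
      simp only [Finset.mem_inter] at h1 ⊢
      tauto
    · intro x hx h1
      simp only [nextStatus, hc, if_false] at h1
      split_ifs at h1 with hx'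
      · cases h1
      · exact h.accepted x hx h1
    · intro x hx h1
      simp only [nextStatus, hc, if_false] at h1
      split_ifs at h1 with hx'
      · exact fun hxT => hx'.2 (hsub (Finset.mem_inter.2 ⟨hx'.1, hxT⟩))
      · exact h.rejected x hx h1

/-- The pivot is always removed. Separation is not assumed, so termination holds for every array of
samples. -/
theorem nextSize_lt (hpn : p ∈ active n st) : nextSize z k st p < (active n st).card := by
  have h1 : (insert p (beaters z st p)).card ≤ (active n st).card :=
    Finset.card_le_card (Finset.insert_subset hpn (beaters_subset_active st p))
  rw [Finset.card_insert_of_notMem (notMem_beaters_self st p)] at h1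
  unfold nextSize
  split_ifs <;> omega

open Classical in
/-- For a pivot in the target, the labels that are removed. -/
theorem nextSize_add_of_mem (hz : Separates z T) (hk : (active n st ∩ T).card = k)
    (hpn : p ∈ active n st) (hp : p ∈ T) :
    nextSize z k st p + ({y ∈ active n st ∩ T | Beats z y p}.card + 1) = (active n st).card := by
  have hc := (card_beaters_lt_iff hz hk hpn).2 hp
  have hW : {y ∈ active n st ∩ T | Beats z y p} = beaters z st p := by
    ext x
    have h1 := @insert_beaters_subset n r z T st p hz hpn hp x
    simp only [Finset.mem_insert, Finset.mem_inter, Finset.mem_filter, beaters, active,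
      Finset.mem_range] at h1 ⊢
    tauto
  have h1 : (insert p (beaters z st p)).card ≤ (active n st).card :=
    Finset.card_le_card (Finset.insert_subset hpn (beaters_subset_active st p))
  rw [Finset.card_insert_of_notMem (notMem_beaters_self st p)] at h1
  rw [hW, nextSize, if_pos hc]
  omega

open Classical in
/-- For a pivot outside of the target, the labels that are removed. -/
theorem nextSize_add_of_notMem (hz : Separates z T) (hk : (active n st ∩ T).card = k)
    (hpn : p ∈ active n st) (hp : p ∉ T) :
    nextSize z k st p + ({y ∈ active n st \ T | Beats z p y}.card + 1) = (active n st).card := by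
  have hc := (card_beaters_lt_iff hz hk hpn).not.2 hp
  have hW : insert p {y ∈ active n st \ T | Beats z p y} = active n st \ beaters z st p := by
    ext x
    have h1 := @inter_subset_beaters n r z T st p hz hpn hp x
    simp only [active, Finset.mem_filter, Finset.mem_range] at hpn
    by_cases hxp : x = p
    · subst hxp
      simp [notMem_beaters_self, active, hpn]
    · have h2 := beats_iff_not_beats z hxp
      simp only [Finset.mem_insert, Finset.mem_inter, Finset.mem_sdiff, Finset.mem_filter, beaters,
        active, Finset.mem_range] at h1 ⊢
      tauto
  rw [← Finset.card_insert_of_notMem (s := {y ∈ active n st \ T | Beats z p y}) (a := p)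
    (by simp [not_beats_self]), hW,
    Finset.card_sdiff_of_subset (beaters_subset_active st p), nextSize, if_neg hc]
  have := Finset.card_le_card (beaters_subset_active (z := z) st p)
  omega

/-- On average over the pivots, at least a quarter of the active labels is removed. -/
theorem sq_card_active_le (hz : Separates z T) (hk : (active n st ∩ T).card = k) :
    ((active n st).card : ℝ) ^ 2 / 4 ≤
      ∑ p ∈ active n st, (((active n st).card : ℝ) - nextSize z k st p) := by
  classical
  have h1 := two_mul_sum_card_beaten (R := Beats z) (active n st ∩ T) (not_beats_self z)
    fun x y h => beats_iff_not_beats z h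
  have h2 := two_mul_sum_card_beaten (R := fun y x => Beats z x y) (active n st \ T)
    (not_beats_self z) fun x y h => beats_iff_not_beats z h.symm
  have e1 : ∀ p ∈ active n st ∩ T, (((active n st).card : ℝ) - nextSize z k st p) =
      (({y ∈ active n st ∩ T | Beats z y p}.card + 1 : ℕ) : ℝ) := fun p hp => by
    obtain ⟨ha, hb⟩ := Finset.mem_inter.1 hp
    rw [← nextSize_add_of_mem hz hk ha hb]
    push_cast; ring
  have e2 : ∀ p ∈ active n st \ T, (((active n st).card : ℝ) - nextSize z k st p) =
      (({y ∈ active n st \ T | Beats z p y}.card + 1 : ℕ) : ℝ) := fun p hp => by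
    obtain ⟨ha, hb⟩ := Finset.mem_sdiff.1 hp
    rw [← nextSize_add_of_notMem hz hk ha hb]
    push_cast; ring
  rw [← Finset.sum_inter_add_sum_sdiff (active n st) T, Finset.sum_congr rfl e1,
    Finset.sum_congr rfl e2, ← Nat.cast_sum, ← Nat.cast_sum]
  have h1' : (2 * ((∑ x ∈ active n st ∩ T, ({y ∈ active n st ∩ T | Beats z y x}.card + 1) : ℕ) : ℝ))
      = ((active n st ∩ T).card : ℝ) ^ 2 + (active n st ∩ T).card := by exact_mod_cast h1
  have h2' : (2 * ((∑ x ∈ active n st \ T, ({y ∈ active n st \ T | Beats z x y}.card + 1) : ℕ) : ℝ))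
      = ((active n st \ T).card : ℝ) ^ 2 + (active n st \ T).card := by exact_mod_cast h2
  have h3 : ((active n st).card : ℝ) = (active n st ∩ T).card + (active n st \ T).card := by
    exact_mod_cast (Finset.card_inter_add_card_sdiff (active n st) T).symm
  rw [h3]
  -- With parts of sizes u and v, the total removed is (u² + u + v² + v)/2, which is at least (u +
  -- v)²/4.
  have := sq_nonneg (((active n st ∩ T).card : ℝ) - (active n st \ T).card)
  have p1 : (0 : ℝ) ≤ (active n st ∩ T).card := by positivity
  have p2 : (0 : ℝ) ≤ (active n st \ T).card := by positivity
  nlinarith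

theorem exp_neg_le_one_sub_half {y : ℝ} (h0 : 0 ≤ y) (h1 : y ≤ 1) :
    Real.exp (-y) ≤ 1 - y / 2 := by
  rw [Real.exp_neg]
  have := Real.add_one_le_exp y
  calc (Real.exp y)⁻¹ ≤ (y + 1)⁻¹ := by gcongr
    _ ≤ 1 - y / 2 := by rw [inv_le_iff_one_le_mul₀ (by linarith)]; nlinarith

/-- The exponential potential of the selection does not increase on average. -/
theorem sum_exp_nextSize_le (hz : Separates z T) (hk : (active n st ∩ T).card = k) {b : ℝ}
    (hn : 0 < n) :
    ∑ p ∈ active n st, Real.exp ((8 * nextSize z k st p - (b - (active n st).card)) / (8 * n)) ≤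
      (active n st).card * Real.exp ((8 * (active n st).card - b) / (8 * n)) := by
  set m := (active n st).card with hm
  have hn' : (0 : ℝ) < n := by exact_mod_cast hn
  have hmn : (m : ℝ) ≤ n := by
    have : m ≤ n := by
      rw [hm, active]
      exact (Finset.card_filter_le _ _).trans (by simp)
    exact_mod_cast this
  -- The new exponent is the old one plus the price m/(8n) of the round minus the gain (number of
  -- removed labels)/n. Since the gain lies in [0,1], its exponential can be linearized.
  have hfac : ∀ p ∈ active n st,
      Real.exp ((8 * nextSize z k st p - (b - m)) / (8 * n)) ≤
        Real.exp ((8 * m - b) / (8 * n)) * Real.exp (m / (8 * n)) *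
          (1 - (m - nextSize z k st p) / (2 * n)) := fun p hp => by
    have hlt : (nextSize z k st p : ℝ) < m := by exact_mod_cast nextSize_lt (z := z) (k := k) hp
    have h0 : (0 : ℝ) ≤ nextSize z k st p := by positivity
    have := exp_neg_le_one_sub_half (y := ((m : ℝ) - nextSize z k st p) / n)
      (div_nonneg (by linarith) hn'.le) ((div_le_one hn').2 (by linarith))
    rw [show ((8 * nextSize z k st p - (b - m)) / (8 * n) : ℝ) =
      (8 * m - b) / (8 * n) + m / (8 * n) + -(((m : ℝ) - nextSize z k st p) / n) by field_simp; ring,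
      Real.exp_add, Real.exp_add]
    refine mul_le_mul_of_nonneg_left (this.trans (le_of_eq ?_)) (by positivity)
    field_simp
  refine (Finset.sum_le_sum hfac).trans ?_
  rw [← Finset.mul_sum, Finset.sum_sub_distrib, ← Finset.sum_div, Finset.sum_const, ← hm,
    nsmul_eq_mul, mul_one]
  have h1 := sq_card_active_le hz hk
  rw [← hm] at h1
  -- An average removal of m/4, halved by the linearization, gives the factor 1 - m/(8n) ≤
  -- exp(-m/(8n)), which cancels the price. This dictates the constant 8.
  have h2 : (m : ℝ) - (∑ p ∈ active n st, ((m : ℝ) - nextSize z k st p)) / (2 * n) ≤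
      m * Real.exp (-(m / (8 * n))) := by
    have h3 := Real.one_sub_le_exp_neg (m / (8 * n) : ℝ)
    have h4 : (m : ℝ) * (1 - m / (8 * n)) ≤ m * Real.exp (-(m / (8 * n))) :=
      mul_le_mul_of_nonneg_left h3 (by positivity)
    refine le_trans ?_ h4
    have h5 : (m : ℝ) ^ 2 / 4 / (2 * n) ≤
      (∑ p ∈ active n st, ((m : ℝ) - nextSize z k st p)) / (2 * n) := by gcongr
    have h6 : (m : ℝ) * (1 - m / (8 * n)) = m - (m : ℝ) ^ 2 / 4 / (2 * n) := by field_simp; ring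
    linarith
  calc _ ≤ Real.exp ((8 * m - b) / (8 * n)) * Real.exp (m / (8 * n)) *
        (m * Real.exp (-(m / (8 * n)))) := mul_le_mul_of_nonneg_left h2 (by positivity)
    _ = _ := by
      rw [Real.exp_neg]
      field_simp

end Progress

/-! ## The selection loop -/

/-- One round of the selection: it stops if the budget does not suffice for one more round. -/
def roundCmd : Cmd :=
  .ite 9 8 (.const 8 0) (.sub 9 9 8 ⨾ .rand 12 8 ⨾ scanCmd ⨾ sweepCmd ⨾ updateCmd)

/-- The selection with random pivots. -/
def selectCmd : Cmd := .loop 4 8 roundCmd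

/-- A bound for the number of steps of the selection from `m` active labels with the
budget `b`. -/
def selectTime (n r m b : ℕ) : ℕ := 5 + m * (25 * n + 40) + b * ((33 * r + 44) * n + 18)

section Select

variable {n r : ℕ} {z : Samples n r} {α : ℝ}

theorem exec_nil (t : ℕ) (s : Store) : exec z α t ([], s) = PMF.pure ([], s) := by
  induction t with
  | zero => rfl
  | succ t ih => simp only [exec, step, PMF.pure_bind, ih]

theorem randBelow_of_pos {m : ℕ} (hm : 0 < m) :
    randBelow m = PMF.uniformOfFinset (Finset.range m) (Finset.nonempty_range_iff.2 hm.ne') :=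
  dif_pos hm

theorem randBelow_apply {m v : ℕ} (hv : v < m) : randBelow m v = (m : ℝ≥0∞)⁻¹ := by
  have hm : 0 < m := by omega
  rw [randBelow_of_pos hm, PMF.uniformOfFinset_apply, if_pos (Finset.mem_range.2 hv),
    Finset.card_range]

theorem lt_of_mem_support_randBelow {m v : ℕ} (hm : 0 < m) (hv : v ∈ (randBelow m).support) :
    v < m := by
  rw [randBelow_of_pos hm, PMF.mem_support_uniformOfFinset_iff] at hv
  exact Finset.mem_range.1 hv

theorem exec_selectCmd_of_zero {s : Store} (h4 : s.reg 4 = 0) (h8 : s.reg 8 = 0) {t : ℕ}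
    (ht : 1 ≤ t) : exec z α t ([selectCmd], s) = PMF.pure ([], s) := by
  obtain ⟨u, rfl⟩ := Nat.exists_eq_add_of_le' ht
  have := (Runs.loop_false (z := z) (α := α) (c := roundCmd) (show ¬ s.reg 4 < s.reg 8 by omega)) []
    u
  rw [selectCmd, this, exec_nil]

theorem exec_selectCmd_of_lt {s : Store} (h4 : s.reg 4 = 0) (h8 : 0 < s.reg 8)
    (h98 : s.reg 9 < s.reg 8) {t : ℕ} (ht : 4 ≤ t) :
    exec z α t ([selectCmd], s) = PMF.pure ([], s.setReg 8 0) := by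
  obtain ⟨u, rfl⟩ := Nat.exists_eq_add_of_le' ht
  have e : exec z α (u + 4) ([selectCmd], s) =
      exec z α (u + 1) ([selectCmd], s.setReg 8 0) := by
    simp only [selectCmd, roundCmd, exec, step, PMF.pure_bind, h98, if_true, h4, h8]
  rw [e, exec_selectCmd_of_zero (by simp [Store.setReg, h4]) (by simp [Store.setReg])
    (Nat.le_add_left 1 u)]

/-- The six steps are the loop test, the branch test, two sequencings, the payment and the draw. -/
theorem exec_selectCmd_of_le {s : Store} (h4 : s.reg 4 = 0) (h8 : 0 < s.reg 8)
    (h98 : s.reg 8 ≤ s.reg 9) (u : ℕ) :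
    exec z α (u + 6) ([selectCmd], s) = (randBelow (s.reg 8)).bind fun v =>
      exec z α u ([scanCmd ⨾ sweepCmd ⨾ updateCmd, selectCmd],
        (s.setReg 9 (s.reg 9 - s.reg 8)).setReg 12 v) := by
  simp only [selectCmd, roundCmd, exec, step, PMF.pure_bind, not_lt.2 h98, if_false, h4, h8,
    if_true]
  simp only [PMF.map, PMF.bind_bind, Function.comp_def, PMF.pure_bind]
  simp [Store.setReg]

/-- After a round, the selection goes on from the new status of the labels. -/
theorem exec_selectCmd_round {k b : ℕ} {s : Store} (hs : Ready n r k b s)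
    {t v : ℕ} (hv : v < (active n s.mem).card)
    (ht : (active n s.mem).card * ((33 * r + 44) * n + 18) + 25 * n + 32 ≤ t) :
    ∃ s' t', t - ((active n s.mem).card * ((33 * r + 44) * n + 18) + 25 * n + 32) ≤ t' ∧
      exec z α t ([scanCmd ⨾ sweepCmd ⨾ updateCmd, selectCmd],
        (s.setReg 9 (s.reg 9 - s.reg 8)).setReg 12 v) = exec z α t' ([selectCmd], s') ∧
      Ready n r (nextQuota z k s.mem (Nat.nth (fun x => s.mem x = 0) v))
        (b - (active n s.mem).card) s' ∧
      s'.mem = nextStatus z k s.mem (Nat.nth (fun x => s.mem x = 0) v) := by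
  have hs' : Ready n r k (b - (active n s.mem).card)
      ((s.setReg 9 (s.reg 9 - s.reg 8)).setReg 12 v) := by
    constructor <;> simp [Store.setReg, hs.h0, hs.h1, hs.h2, hs.h3, hs.h4, hs.h5, hs.h8, hs.h9]
    exact hs.le_two
  obtain ⟨s', t₀, ht₀, hr, hq⟩ := reaches_round (z := z) (α := α) hs'
    (v := v) (by simp [Store.setReg]) hv
  refine ⟨s', t - t₀, Nat.sub_le_sub_left ht₀ t, ?_, hq⟩
  have := hr [selectCmd] (t - t₀)
  rwa [Nat.sub_add_cancel (ht₀.trans ht)] at this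

theorem nth_mem_active {st : ℕ → ℕ} {v : ℕ} (hv : v < (active n st).card) :
    Nat.nth (fun x => st x = 0) v ∈ active n st := by
  rw [← count_eq_card_active] at hv
  simp only [active, Finset.mem_filter, Finset.mem_range]
  exact ⟨Nat.nth_lt_of_lt_count hv,
    Nat.nth_mem (p := fun x => st x = 0) v fun hf => hv.trans_le (Nat.count_le_card hf n)⟩

/-- Turns the average over a uniform index into the average over a uniform active pivot. -/
theorem sum_range_nth {M : Type*} [AddCommMonoid M] (st : ℕ → ℕ) (f : ℕ → M) :
    ∑ v ∈ Finset.range (active n st).card, f (Nat.nth (fun x => st x = 0) v) =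
      ∑ p ∈ active n st, f p := by
  refine Finset.sum_nbij (fun v => Nat.nth (fun x => st x = 0) v)
    (fun v hv => nth_mem_active (Finset.mem_range.1 hv)) ?_ ?_ fun _ _ => rfl
  · intro v hv w hw h
    have hc : ∀ v ∈ Finset.range (active n st).card,
        Nat.count (fun x => st x = 0) (Nat.nth (fun x => st x = 0) v) = v := fun v hv => by
      rw [Finset.mem_range, ← count_eq_card_active] at hv
      exact Nat.count_nth fun hf => hv.trans_le (Nat.count_le_card hf n)
    rw [← hc v hv, ← hc w hw]
    exact congrArg _ h
  · intro p hp
    simp only [active, Finset.coe_filter, Finset.mem_range, Set.mem_ofPred_eq] at hp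
    refine ⟨Nat.count (fun x => st x = 0) p, ?_, Nat.nth_count (p := fun x => st x = 0) hp.2⟩
    rw [Finset.coe_range, Set.mem_Iio, ← count_eq_card_active]
    exact Nat.count_strict_mono hp.2 hp.1

/-- The selection always halts in time. -/
theorem halts_selectCmd {m : ℕ} : ∀ {k b : ℕ} {s : Store}, Ready n r k b s →
    (active n s.mem).card = m → ∀ t, selectTime n r m b ≤ t →
      ∀ c ∈ (exec z α t ([selectCmd], s)).support, c.1 = [] := by
  induction m using Nat.strong_induction_on with
  | _ m ih =>
    intro k b s hs hm t ht c hc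
    rw [selectTime] at ht
    rcases Nat.eq_zero_or_pos m with h0 | hpos
    · rw [exec_selectCmd_of_zero hs.h4 (by rw [hs.h8, hm, h0]) (by omega), PMF.support_pure] at hc
      rw [Set.mem_singleton_iff.1 hc]
    · have h8 : 0 < s.reg 8 := by rw [hs.h8, hm]; exact hpos
      rcases lt_or_ge b m with hb | hb
      · rw [exec_selectCmd_of_lt hs.h4 h8 (by rw [hs.h8, hs.h9, hm]; exact hb) (by omega),
          PMF.support_pure] at hc
        rw [Set.mem_singleton_iff.1 hc]
      · have hmul : b * ((33 * r + 44) * n + 18) =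
            (b - m) * ((33 * r + 44) * n + 18) + m * ((33 * r + 44) * n + 18) := by
          rw [← add_mul, Nat.sub_add_cancel hb]
        have hmul' : m * (25 * n + 40) = (m - 1) * (25 * n + 40) + (25 * n + 40) := by
          obtain ⟨m', rfl⟩ := Nat.exists_eq_add_of_le' hpos
          rw [Nat.add_sub_cancel]; ring
        obtain ⟨u, rfl⟩ := Nat.exists_eq_add_of_le' (show 6 ≤ t by omega)
        rw [exec_selectCmd_of_le hs.h4 h8 (by rw [hs.h8, hs.h9, hm]; exact hb),
          PMF.mem_support_bind_iff] at hc
        obtain ⟨v, hv, hc⟩ := hc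
        have hv' := lt_of_mem_support_randBelow h8 hv
        rw [hs.h8] at hv'
        obtain ⟨s', t', ht', he, hs', hmem⟩ := exec_selectCmd_round (z := z) (α := α) hs
          hv' (t := u) (by rw [hm]; omega)
        rw [he] at hc
        have hlt := nextSize_lt (z := z) (k := k) (nth_mem_active hv')
        have hcard := card_active_nextStatus (z := z) k (nth_mem_active hv')
        rw [hm] at hlt
        refine ih _ hlt hs' (by rw [hmem, hcard]) t' ?_ c hc
        rw [selectTime, hm]
        rw [hm] at ht'
        have : nextSize z k s.mem (Nat.nth (fun x => s.mem x = 0) v) * (25 * n + 40) ≤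
          (m - 1) * (25 * n + 40) := Nat.mul_le_mul_right _ (by omega)
        omega

/-- If the comparisons separate the target, then it is found with high probability. -/
theorem le_prob_selectCmd {T : Finset ℕ} (hz : Separates z T) (hn : 0 < n) {m : ℕ} :
    ∀ {k b : ℕ} {s : Store}, Ready n r k b s → Compatible n T k s.mem →
    (active n s.mem).card = m → ∀ t, selectTime n r m b ≤ t →
      ENNReal.ofReal (1 - Real.exp ((8 * m - b) / (8 * n))) ≤
        (exec z α t ([selectCmd], s)).toOuterMeasure
          {c | c.1 = [] ∧ outputSet n c.2 = {i : Fin n | (i : ℕ) ∈ T}} := by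
  induction m using Nat.strong_induction_on with
  | _ m ih =>
    intro k b s hs hcomp hm t ht
    rw [selectTime] at ht
    have hn' : (0 : ℝ) < n := by exact_mod_cast hn
    rcases Nat.eq_zero_or_pos m with h0 | hpos
    · rw [exec_selectCmd_of_zero hs.h4 (by rw [hs.h8, hm, h0]) (by omega),
        PMF.toOuterMeasure_pure_apply, if_pos]
      · rw [← ENNReal.ofReal_one]
        exact ENNReal.ofReal_le_ofReal (by linarith [Real.exp_pos ((8 * m - b : ℝ) / (8 * n))])
      · refine ⟨rfl, ?_⟩
        ext i
        simp only [outputSet, Set.mem_ofPred_eq]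
        refine ⟨hcomp.accepted i i.2, fun hi => ?_⟩
        have h1 : s.mem i ≠ 0 := fun h => by
          have : (i : ℕ) ∈ active n s.mem := by simp [active, h]
          rw [Finset.card_eq_zero.1 (hm.trans h0)] at this
          exact absurd this (Finset.notMem_empty _)
        have h2 : s.mem i ≠ 2 := fun h => hcomp.rejected i i.2 h hi
        have h3 := hs.le_two i i.2
        omega
    · have h8 : 0 < s.reg 8 := by rw [hs.h8, hm]; exact hpos
      rcases lt_or_ge b m with hb | hb
      · have hb' : (b : ℝ) < m := by exact_mod_cast hb
        -- The budget is exhausted and the run may fail, but the claimed lower bound is then not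
        -- positive.
        have : (1 : ℝ) ≤ Real.exp ((8 * m - b) / (8 * n)) :=
          Real.one_le_exp (div_nonneg (by
            have : (0 : ℝ) ≤ m := by positivity
            linarith) (by positivity))
        rw [ENNReal.ofReal_of_nonpos (by linarith)]
        exact bot_le
      · have hmul : b * ((33 * r + 44) * n + 18) =
            (b - m) * ((33 * r + 44) * n + 18) + m * ((33 * r + 44) * n + 18) := by
          rw [← add_mul, Nat.sub_add_cancel hb]
        have hmul' : m * (25 * n + 40) = (m - 1) * (25 * n + 40) + (25 * n + 40) := by
          obtain ⟨m', rfl⟩ := Nat.exists_eq_add_of_le' hpos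
          rw [Nat.add_sub_cancel]; ring
        obtain ⟨u, rfl⟩ := Nat.exists_eq_add_of_le' (show 6 ≤ t by omega)
        rw [exec_selectCmd_of_le hs.h4 h8 (by rw [hs.h8, hs.h9, hm]; exact hb),
          PMF.toOuterMeasure_bind_apply, hs.h8, hm]
        let g : ℕ → ℝ := fun p =>
          Real.exp ((8 * nextSize z k s.mem p - ((b : ℝ) - m)) / (8 * n))
        have hround : ∀ v ∈ Finset.range m, (m : ℝ≥0∞)⁻¹ *
            ENNReal.ofReal (1 - g (Nat.nth (fun x => s.mem x = 0) v)) ≤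
            randBelow m v * (exec z α u ([scanCmd ⨾ sweepCmd ⨾ updateCmd, selectCmd],
              (s.setReg 9 (s.reg 9 - m)).setReg 12 v)).toOuterMeasure
                {c | c.1 = [] ∧ outputSet n c.2 = {i : Fin n | (i : ℕ) ∈ T}} := by
          intro v hv
          have hvm := Finset.mem_range.1 hv
          rw [randBelow_apply hvm]
          refine mul_le_mul_right ?_ _
          have hv' : v < (active n s.mem).card := by rw [hm]; exact hvm
          obtain ⟨s', t', ht', he, hs', hmem⟩ := exec_selectCmd_round (z := z) (α := α) hs
            hv' (t := u) (by rw [hm]; omega)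
          rw [hs.h8, hm] at he
          rw [he]
          have hlt := nextSize_lt (z := z) (k := k) (nth_mem_active hv')
          have hcard := card_active_nextStatus (z := z) k (nth_mem_active hv')
          rw [hm] at hlt
          have := ih _ hlt hs' (by rw [hmem]; exact hcomp.next hz (nth_mem_active hv'))
            (by rw [hmem, hcard]) t' (by
              rw [selectTime, hm]
              rw [hm] at ht'
              have : nextSize z k s.mem (Nat.nth (fun x => s.mem x = 0) v) * (25 * n + 40) ≤
                (m - 1) * (25 * n + 40) := Nat.mul_le_mul_right _ (by omega)
              omega)
          rw [hm, Nat.cast_sub hb] at this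
          exact this
        refine le_trans ?_ (ENNReal.sum_le_tsum (Finset.range m))
        refine le_trans ?_ (Finset.sum_le_sum hround)
        rw [← Finset.mul_sum]
        have hm' : (0 : ℝ) < m := by exact_mod_cast hpos
        have hsum := sum_exp_nextSize_le (b := b) hz hcomp.quota hn
        rw [hm, ← sum_range_nth s.mem g, hm] at hsum
        -- Some terms 1 - g may be negative; truncation at 0 is subadditive, so only this inequality
        -- is available, and it has the required direction.
        have h1 : ENNReal.ofReal (∑ v ∈ Finset.range m,
            (1 - g (Nat.nth (fun x => s.mem x = 0) v))) ≤ ∑ v ∈ Finset.range m,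
            ENNReal.ofReal (1 - g (Nat.nth (fun x => s.mem x = 0) v)) := by
          exact Finset.le_sum_of_subadditive _ ENNReal.ofReal_zero.le
            (fun _ _ => ENNReal.ofReal_add_le) _ _
        refine le_trans ?_ (mul_le_mul_right h1 _)
        rw [Finset.sum_sub_distrib, Finset.sum_const, Finset.card_range, nsmul_eq_mul, mul_one,
          ← ENNReal.ofReal_natCast m, ← ENNReal.ofReal_inv_of_pos hm',
          ← ENNReal.ofReal_mul (by positivity)]
        refine ENNReal.ofReal_le_ofReal ?_
        rw [inv_mul_eq_div, le_div_iff₀ hm']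
        linarith

end Select

/-! ## The algorithm -/

/-- Sets up the constants and, from the binary digits of the error parameter, the budget. -/
def initCmd : Cmd :=
  (.const 3 1 ⨾ .const 5 2 ⨾ .add 8 0 4 ⨾ .add 10 0 0 ⨾ .add 10 10 10 ⨾ .add 10 10 10 ⨾
    .add 9 10 10 ⨾ .const 11 0 ⨾ .const 12 0) ⨾
  .loop 12 3 (.add 11 11 3 ⨾ .digit 12 11 ⨾ .add 9 9 10)

/-- The algorithm for the Top-K problem. -/
def mainCmd : Cmd := initCmd ⨾ selectCmd

section Main

variable {n r : ℕ} {z : Samples n r} {α : ℝ}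

/-- The least τ with 2^τ α ≥ 1. Minimality gives 2^(τ-1) α < 1, hence both the logarithmic bound and
⌊2^τ α⌋ = 1; thus τ is found by reading digits until the first 1. -/
theorem exists_first_digit (h0 : 0 < α) (h1 : α < 1) : ∃ τ : ℕ, 1 ≤ 2 ^ τ * α ∧
    (τ : ℝ) ≤ 1 + Real.logb 2 (1 / α) ∧ binaryDigit α τ = 1 ∧ 0 < τ ∧
    ∀ t < τ, binaryDigit α t = 0 := by
  classical
  have hex : ∃ τ : ℕ, 1 ≤ 2 ^ τ * α := by
    obtain ⟨τ, hτ⟩ := pow_unbounded_of_one_lt (1 / α) (one_lt_two (α := ℝ))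
    exact ⟨τ, by rw [div_lt_iff₀ h0] at hτ; exact hτ.le⟩
  have hlt : ∀ t < Nat.find hex, (2 : ℝ) ^ t * α < 1 := fun t ht => not_le.1 (Nat.find_min hex ht)
  have hpos : 0 < Nat.find hex := by
    rw [Nat.find_pos]
    simpa using h1
  obtain ⟨σ, hσ⟩ := Nat.exists_eq_add_of_le' hpos
  have hσlt := hlt σ (by omega)
  have hσ1 := Nat.find_spec hex
  refine ⟨Nat.find hex, hσ1, ?_, ?_, hpos, fun t ht => ?_⟩
  · rw [hσ]
    push_cast
    have : (σ : ℝ) ≤ Real.logb 2 (1 / α) := by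
      rw [Real.le_logb_iff_rpow_le one_lt_two (by positivity), Real.rpow_natCast,
        le_div_iff₀ h0]
      exact hσlt.le
    linarith
  · have : ⌊(2 : ℝ) ^ Nat.find hex * α⌋₊ = 1 := by
      rw [Nat.floor_eq_iff (by positivity)]
      refine ⟨by simpa using hσ1, ?_⟩
      rw [hσ, pow_succ]
      push_cast
      linarith
    rw [binaryDigit, this]
  · rw [binaryDigit, Nat.floor_eq_zero.2 (hlt t ht)]

/-- The budget starts at 16n and grows by 8n per digit read. Reading begins with digit 1, which is
why τ > 0 is needed. -/
theorem reaches_initCmd {k τ : ℕ} {s : Store} (h0 : s.reg 0 = n) (h1 : s.reg 1 = k)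
    (h2 : s.reg 2 = r) (h4 : s.reg 4 = 0) (hm : s.mem = fun _ => 0)
    (hτ : binaryDigit α τ = 1) (hτ0 : 0 < τ) (hlt : ∀ t < τ, binaryDigit α t = 0) :
    Reaches z α initCmd s (6 * τ + 19) fun s' =>
      Ready n r k (8 * n * (τ + 2)) s' ∧ s'.mem = fun _ => 0 := by
  let Inv : ℕ → Store → Prop := fun j s' =>
    s'.reg 0 = n ∧ s'.reg 1 = k ∧ s'.reg 2 = r ∧ s'.reg 3 = 1 ∧ s'.reg 4 = 0 ∧ s'.reg 5 = 2 ∧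
      s'.reg 8 = n ∧ s'.reg 9 = 8 * n * (j + 2) ∧ s'.reg 10 = 8 * n ∧ s'.reg 11 = j ∧
      s'.reg 12 = (if j = τ then 1 else 0) ∧ s'.mem = fun _ => 0
  have hinit : Reaches z α (.const 3 1 ⨾ .const 5 2 ⨾ .add 8 0 4 ⨾ .add 10 0 0 ⨾ .add 10 10 10 ⨾
      .add 10 10 10 ⨾ .add 9 10 10 ⨾ .const 11 0 ⨾ .const 12 0) s 17 (Inv 0) := by
    refine (Reaches.simple (by simp [Cmd.IsSimple]) ?_).mono (by simp [Cmd.cost]) fun _ h => h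
    simp [Inv, interp, Store.setReg, h0, h1, h2, h4, hm]
    omega
  refine (hinit.seq fun s₁ h₁ => Reaches.loop Inv (fun _ => 5) τ ?_ ?_ h₁).mono ?_ ?_
  · rintro j hj s' ⟨e0, e1, e2, e3, e4, e5, e8, e9, e10, e11, e12, em⟩
    refine ⟨by rw [e12, e3, if_neg hj.ne]; exact Nat.one_pos, ?_⟩
    refine (Reaches.simple (by simp [Cmd.IsSimple]) ?_).mono (by simp [Cmd.cost]) fun _ h => h
    have hd : binaryDigit α (j + 1) = if j + 1 = τ then 1 else 0 := by
      split_ifs with h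
      · rw [h, hτ]
      · exact hlt _ (by omega)
    simp [Inv, interp, Store.setReg, e0, e1, e2, e3, e4, e5, e8, e9, e10, e11, em, hd]
    ring
  · rintro s' ⟨-, -, -, e3, -, -, -, -, -, -, e12, -⟩
    rw [e12, e3, if_pos rfl]
    exact lt_irrefl _
  · simp only [Finset.sum_const, Finset.card_range, smul_eq_mul]; omega
  · rintro s' ⟨e0, e1, e2, e3, e4, e5, e8, e9, -, -, -, em⟩
    refine ⟨⟨e0, e1, e2, e3, e4, e5, ?_, e9, by simp [em]⟩, em⟩
    rw [e8, em]
    simp [active]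

/-- After the initialization the algorithm is in the selection loop. -/
theorem exec_mainCmd {k τ : ℕ} (hτ : binaryDigit α τ = 1) (hτ0 : 0 < τ)
    (hlt : ∀ t < τ, binaryDigit α t = 0) {t T : ℕ} (ht : 6 * τ + 20 + T ≤ t) :
    ∃ s t', T ≤ t' ∧ exec z α t (initConfig mainCmd n k r) = exec z α t' ([selectCmd], s) ∧
      Ready n r k (8 * n * (τ + 2)) s ∧ s.mem = fun _ => 0 := by
  obtain ⟨s', t₀, ht₀, hr, hs⟩ := reaches_initCmd (z := z) (α := α) (k := k)
    (s := (initConfig mainCmd n k r).2) rfl rfl rfl rfl rfl hτ hτ0 hlt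
  obtain ⟨u, rfl⟩ := Nat.exists_eq_add_of_le' (show t₀ + 1 ≤ t by omega)
  refine ⟨s', u, by omega, ?_, hs⟩
  rw [← hr [selectCmd] u, ← add_assoc]
  simp only [initConfig, mainCmd, exec, step, PMF.pure_bind]

theorem card_active_zero : (active n fun _ => 0).card = n := by simp [active]

/-- The running time of the algorithm. -/
theorem haltsWithin_mainCmd (h0 : 0 < α) (h1 : α < 1) (hn : 0 < n) (hr : 0 < r) (k : ℕ) :
    ∃ t : ℕ, (t : ℝ) ≤ 4000 * ((n : ℝ) ^ 2 * r * max 1 (Real.logb 2 (1 / α))) ∧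
      HaltsWithin mainCmd α k z t := by
  obtain ⟨τ, -, hτle, hτ, hτ0, hlt⟩ := exists_first_digit h0 h1
  refine ⟨6 * τ + 20 + selectTime n r n (8 * n * (τ + 2)), ?_, fun c hc => ?_⟩
  · set M := max 1 (Real.logb 2 (1 / α)) with hM
    have hM1 : 1 ≤ M := le_max_left _ _
    have hτM : (τ : ℝ) ≤ 2 * M := by linarith [le_max_right 1 (Real.logb 2 (1 / α))]
    have hn1 : (1 : ℝ) ≤ n := by exact_mod_cast hn
    have hr1 : (1 : ℝ) ≤ r := by exact_mod_cast hr
    have hn2 : (1 : ℝ) ≤ (n : ℝ) ^ 2 := one_le_pow₀ hn1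
    have hnr : (n : ℝ) ≤ n * r := le_mul_of_one_le_right (by positivity) hr1
    have hA : (n : ℝ) ^ 2 * r ≤ (n : ℝ) ^ 2 * r * M := le_mul_of_one_le_right (by positivity) hM1
    have hn2r : (n : ℝ) ^ 2 ≤ (n : ℝ) ^ 2 * r := le_mul_of_one_le_right (by positivity) hr1
    have hM2 : M ≤ (n : ℝ) ^ 2 * r * M := le_mul_of_one_le_left (by positivity) (hn2.trans hn2r)
    have hnn : (n : ℝ) ≤ (n : ℝ) ^ 2 := by nlinarith
    have hc : ((33 * r + 44) * n + 18 : ℝ) ≤ 95 * (n * r) := by nlinarith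
    have hb : (8 * n * (τ + 2) : ℝ) ≤ 32 * (n * M) := by nlinarith
    -- The budget times the cost of a comparison contributes 32 · 95 = 3040; the lower-order terms
    -- fit into the rest of 4000.
    have hbc : (8 * n * (τ + 2) : ℝ) * ((33 * r + 44) * n + 18) ≤
        32 * (n * M) * (95 * (n * r)) := mul_le_mul hb hc (by positivity) (by positivity)
    rw [selectTime]
    push_cast
    nlinarith
  · obtain ⟨s, t', ht', he, hs, hm⟩ := exec_mainCmd (z := z) (k := k) hτ hτ0 hlt
      (le_refl (6 * τ + 20 + selectTime n r n (8 * n * (τ + 2))))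
    rw [he] at hc
    exact halts_selectCmd hs (by rw [hm, card_active_zero]) t' ht' c hc

/-- The success probability of the algorithm, if the comparisons separate the target. -/
theorem le_outputProb_mainCmd (h0 : 0 < α) (h1 : α < 1) (hn : 0 < n) {T : Finset ℕ}
    (hT : T ⊆ Finset.range n) (hz : Separates z T) :
    ENNReal.ofReal (1 - α / 2) ≤ outputProb mainCmd α T.card z {i : Fin n | (i : ℕ) ∈ T} := by
  obtain ⟨τ, hτ1, -, hτ, hτ0, hlt⟩ := exists_first_digit h0 h1
  obtain ⟨s, t', ht', he, hs, hm⟩ := exec_mainCmd (z := z) (k := T.card) hτ hτ0 hlt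
    (le_refl (6 * τ + 20 + selectTime n r n (8 * n * (τ + 2))))
  refine le_trans ?_ (le_iSup _ (6 * τ + 20 + selectTime n r n (8 * n * (τ + 2))))
  rw [he]
  have hcomp : Compatible n T T.card s.mem := by
    rw [hm]
    refine ⟨?_, by simp, by simp⟩
    congr 1
    ext x
    have := @hT x
    simp only [active, Finset.mem_inter, Finset.mem_filter] at this ⊢
    tauto
  refine le_trans (ENNReal.ofReal_le_ofReal ?_)
    (le_prob_selectCmd hz hn hs hcomp (by rw [hm, card_active_zero]) t' ht')
  have hn' : (0 : ℝ) < n := by exact_mod_cast hn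
  -- The initial potential is e^(-(τ+1)) ≤ 2^(-(τ+1)) ≤ α/2: one of the two extra units of 8n
  -- offsets the n active labels, the other gains the factor 1/2.
  have h2 : ((8 * n - (8 * n * (τ + 2) : ℕ)) / (8 * n) : ℝ) = ((τ + 1 : ℕ) : ℝ) * (-1) := by
    push_cast
    field_simp
    ring
  have h3 : Real.exp (-1) ≤ 1 / 2 := by
    rw [Real.exp_neg, one_div]
    have := Real.add_one_le_exp 1
    gcongr
    linarith
  have h4 : (1 / 2 : ℝ) ^ τ ≤ α := by
    rw [one_div, inv_pow, inv_le_iff_one_le_mul₀ (by positivity)]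
    linarith
  rw [h2, Real.exp_nat_mul]
  have h5 : Real.exp (-1) ^ (τ + 1) ≤ (1 / 2 : ℝ) ^ (τ + 1) := by gcongr
  rw [pow_succ (1 / 2 : ℝ)] at h5
  linarith

end Main

/-! ## Sums of biased signs -/

/-- **Hoeffding's lemma** for a biased sign. -/
theorem exp_centered_sign_le {p : ℝ} (h0 : 0 ≤ p) (h1 : p ≤ 1) (t : ℝ) :
    p * Real.exp (t * (1 - (2 * p - 1))) + (1 - p) * Real.exp (t * (-1 - (2 * p - 1))) ≤
      Real.exp (t ^ 2 / 2) := by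
  open MeasureTheory in
  let ν : Measure Bool := ENNReal.ofReal p • Measure.dirac true +
    ENNReal.ofReal (1 - p) • Measure.dirac false
  have hint : ∀ f : Bool → ℝ, ∫ x, f x ∂ν = p * f true + (1 - p) * f false := fun f => by
    rw [integral_add_measure (Integrable.of_finite.smul_measure ENNReal.ofReal_ne_top)
      (Integrable.of_finite.smul_measure ENNReal.ofReal_ne_top), integral_smul_measure,
      integral_smul_measure, integral_dirac, integral_dirac, ENNReal.toReal_ofReal h0,
      ENNReal.toReal_ofReal (by linarith), smul_eq_mul, smul_eq_mul]
  have hν : IsProbabilityMeasure ν := ⟨by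
    simp [ν, ← ENNReal.ofReal_add h0 (sub_nonneg.2 h1)]⟩
  let X : Bool → ℝ := fun b => if b then 1 else -1
  have h := (ProbabilityTheory.hasSubgaussianMGF_of_mem_Icc (μ := ν) (X := X) (a := -1) (b := 1)
    (Measurable.of_discrete.aemeasurable)
    (Filter.Eventually.of_forall fun b => by cases b <;> simp [X])).mgf_le t
  rw [ProbabilityTheory.mgf, hint, hint] at h
  have e : ((‖(1 : ℝ) - -1‖₊ / 2) ^ 2 : NNReal) = 1 := by
    rw [show (1 : ℝ) - -1 = 2 by norm_num]
    ext
    norm_num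
  rw [e] at h
  simp only [X, if_true, Bool.false_eq_true, if_false, NNReal.coe_one] at h
  convert h using 2 <;> ring_nf

/-- The expectation of `φ` after one more sign, which is positive with probability `p`. -/
def signStep (p : ℝ) (φ : ℤ → ℝ) (x : ℤ) : ℝ := p * φ (x + 1) + (1 - p) * φ (x - 1)

section Signs

variable {p : ℝ}

theorem signStep_mono (h0 : 0 ≤ p) (h1 : p ≤ 1) {φ ψ : ℤ → ℝ} (h : φ ≤ ψ) :
    signStep p φ ≤ signStep p ψ := fun x => by
  unfold signStep
  have := h (x + 1)
  have := h (x - 1)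
  have : 0 ≤ 1 - p := by linarith
  gcongr

theorem iterate_signStep_mono (h0 : 0 ≤ p) (h1 : p ≤ 1) (j : ℕ) {φ ψ : ℤ → ℝ} (h : φ ≤ ψ) :
    (signStep p)^[j] φ ≤ (signStep p)^[j] ψ := by
  induction j generalizing φ ψ with
  | zero => exact h
  | succ j ih => exact ih (signStep_mono h0 h1 h)

theorem iterate_signStep_const_mul (j : ℕ) (c : ℝ) (φ : ℤ → ℝ) :
    (signStep p)^[j] (fun x => c * φ x) = fun x => c * (signStep p)^[j] φ x := by
  induction j generalizing φ with
  | zero => rfl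
  | succ j ih =>
    rw [Function.iterate_succ_apply, Function.iterate_succ_apply, ← ih]
    congr 1
    funext x
    simp only [signStep]
    ring

theorem iterate_signStep_exp (j : ℕ) (t : ℝ) (x : ℤ) :
    (signStep p)^[j] (fun x => Real.exp (-(t * x))) x =
      (p * Real.exp (-t) + (1 - p) * Real.exp t) ^ j * Real.exp (-(t * x)) := by
  induction j generalizing x with
  | zero => simp
  | succ j ih =>
    have : signStep p (fun x => Real.exp (-(t * x))) = fun x : ℤ =>
        (p * Real.exp (-t) + (1 - p) * Real.exp t) * Real.exp (-(t * x)) := by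
      funext x
      simp only [signStep]
      push_cast
      rw [show -(t * ((x : ℝ) + 1)) = -t + -(t * x) by ring,
        show -(t * ((x : ℝ) - 1)) = t + -(t * x) by ring, Real.exp_add, Real.exp_add]
      ring
    rw [Function.iterate_succ_apply, this, iterate_signStep_const_mul]
    simp only [ih]
    ring

theorem iterate_signStep_exp_le (h0 : 0 ≤ p) (h1 : p ≤ 1) (j : ℕ) (t : ℝ) :
    (signStep p)^[j] (fun x => Real.exp (-(t * x))) 0 ≤
      Real.exp (j * (t ^ 2 / 2 - (2 * p - 1) * t)) := by
  rw [iterate_signStep_exp, Int.cast_zero, mul_zero, neg_zero, Real.exp_zero, mul_one,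
    Real.exp_nat_mul]
  have : 0 ≤ 1 - p := by linarith
  refine pow_le_pow_left₀ (by positivity) ?_ j
  have h := exp_centered_sign_le h0 h1 (-t)
  have h' := mul_le_mul_of_nonneg_right h (Real.exp_pos (-((2 * p - 1) * t))).le
  rw [add_mul, mul_assoc, mul_assoc, ← Real.exp_add, ← Real.exp_add, ← Real.exp_add] at h'
  ring_nf at h' ⊢
  exact h'

/-- An exponential moment of the square of a centered sum of signs. -/
theorem iterate_signStep_exp_sq_le (h0 : 0 ≤ p) (h1 : p ≤ 1) (j : ℕ) {c : ℝ} (d : ℝ)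
    (hc : 0 ≤ c) (hcj : 8 * c * j ≤ 1) :
    (signStep p)^[j] (fun x => Real.exp (c * (x - (2 * p - 1) * j) ^ 2 -
      d * (x - (2 * p - 1) * j))) 0 ≤ Real.exp ((8 * c + d ^ 2) * j) := by
  induction j generalizing c with
  | zero => simp
  | succ j ih =>
    push_cast at hcj ⊢
    -- Averaging out one centered sign e with e² ≤ 4: the cross term is linear in e with slope 2cG -
    -- d, so Hoeffding's lemma costs (2cG - d)²/2 ≤ 4c²G² + d². The coefficient of the square thus
    -- grows from c to c + 4c², and 8cj ≤ 1 keeps this growth under control along the induction.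
    have hstep : signStep p (fun x => Real.exp (c * (x - (2 * p - 1) * (j + 1)) ^ 2 -
        d * (x - (2 * p - 1) * (j + 1)))) ≤ fun x : ℤ => Real.exp (4 * c + d ^ 2) *
          Real.exp ((c + 4 * c ^ 2) * (x - (2 * p - 1) * j) ^ 2 -
            d * (x - (2 * p - 1) * j)) := by
      intro x
      simp only [signStep]
      push_cast
      set G : ℝ := x - (2 * p - 1) * j with hG
      have key : ∀ e : ℝ, e ^ 2 ≤ 4 → Real.exp (c * (G + e) ^ 2 - d * (G + e)) ≤
          Real.exp (4 * c + (c * G ^ 2 - d * G)) * Real.exp ((2 * c * G - d) * e) := by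
        intro e he
        rw [← Real.exp_add]
        apply Real.exp_le_exp.2
        nlinarith [mul_le_mul_of_nonneg_left he hc]
      have k1 := key (1 - (2 * p - 1)) (by nlinarith)
      have k2 := key (-1 - (2 * p - 1)) (by nlinarith)
      have hh := exp_centered_sign_le h0 h1 (2 * c * G - d)
      have e1 : (x : ℝ) + 1 - (2 * p - 1) * (j + 1) = G + (1 - (2 * p - 1)) := by rw [hG]; ring
      have e2 : (x : ℝ) - 1 - (2 * p - 1) * (j + 1) = G + (-1 - (2 * p - 1)) := by rw [hG]; ring
      rw [e1, e2]
      calc _ ≤ p * (Real.exp (4 * c + (c * G ^ 2 - d * G)) *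
              Real.exp ((2 * c * G - d) * (1 - (2 * p - 1)))) +
            (1 - p) * (Real.exp (4 * c + (c * G ^ 2 - d * G)) *
              Real.exp ((2 * c * G - d) * (-1 - (2 * p - 1)))) :=
            add_le_add (mul_le_mul_of_nonneg_left k1 h0)
              (mul_le_mul_of_nonneg_left k2 (by linarith))
        _ = Real.exp (4 * c + (c * G ^ 2 - d * G)) *
            (p * Real.exp ((2 * c * G - d) * (1 - (2 * p - 1))) +
              (1 - p) * Real.exp ((2 * c * G - d) * (-1 - (2 * p - 1)))) := by ring
        _ ≤ Real.exp (4 * c + (c * G ^ 2 - d * G)) * Real.exp ((2 * c * G - d) ^ 2 / 2) := by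
            gcongr
        _ ≤ _ := by
            rw [← Real.exp_add, ← Real.exp_add]
            apply Real.exp_le_exp.2
            nlinarith [sq_nonneg (2 * c * G + d)]
    rw [Function.iterate_succ_apply]
    refine (iterate_signStep_mono h0 h1 j hstep 0).trans ?_
    rw [iterate_signStep_const_mul]
    have hj : (0 : ℝ) ≤ j := by positivity
    have hcj' : 8 * c * j ≤ 1 := by nlinarith
    have hih := ih (c := c + 4 * c ^ 2) (by positivity)
      (by nlinarith [mul_le_mul_of_nonneg_left hcj' hc])
    refine (mul_le_mul_of_nonneg_left hih (Real.exp_pos _).le).trans ?_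
    rw [← Real.exp_add]
    apply Real.exp_le_exp.2
    nlinarith [mul_le_mul_of_nonneg_left hcj' hc]

/-- Fubini for independent signs. -/
theorem signStep_iterate_comm (j : ℕ) (g : ℤ → ℤ → ℝ) (a b : ℤ) :
    signStep p (fun y => (signStep p)^[j] (fun x => g x y) a) b =
      (signStep p)^[j] (fun x => signStep p (g x) b) a := by
  induction j generalizing g with
  | zero => rfl
  | succ j ih =>
    simp only [Function.iterate_succ_apply]
    rw [ih (fun x y => signStep p (fun x => g x y) x)]
    refine congrFun (congrArg _ (funext fun x => ?_)) _
    simp only [signStep]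
    ring

theorem iterate_signStep_comm (i j : ℕ) (g : ℤ → ℤ → ℝ) (a b : ℤ) :
    (signStep p)^[i] (fun y => (signStep p)^[j] (fun x => g x y) a) b =
      (signStep p)^[j] (fun x => (signStep p)^[i] (g x) b) a := by
  induction i generalizing g with
  | zero => rfl
  | succ i ih =>
    simp only [Function.iterate_succ_apply]
    rw [← ih (fun x => signStep p (g x))]
    refine congrFun (congrArg _ (funext fun y => ?_)) _
    exact signStep_iterate_comm j g a y

/-- The expectation of a function of two sums of signs after one more sign, which is added to the
first sum before the sums are exchanged. -/
def swapStep (p : ℝ) (f : ℤ → ℤ → ℝ) (a b : ℤ) : ℝ := signStep p (f b) a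

/-- Two exchanges add one sign to each sum and restore their order. -/
theorem iterate_swapStep_even (j : ℕ) (f : ℤ → ℤ → ℝ) (a b : ℤ) :
    (swapStep p)^[2 * j] f a b = (signStep p)^[j] (fun x => (signStep p)^[j] (f x) b) a := by
  induction j generalizing f with
  | zero => rfl
  | succ j ih =>
    rw [show 2 * (j + 1) = 2 * j + 1 + 1 by ring, Function.iterate_succ_apply,
      Function.iterate_succ_apply, ih, Function.iterate_succ_apply]
    refine congrFun (congrArg _ (funext fun x => ?_)) _
    simp only [Function.iterate_succ_apply]
    exact (signStep_iterate_comm j (fun y x' => signStep p (f x') y) b x).symm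

theorem iterate_swapStep_odd (j : ℕ) (f : ℤ → ℤ → ℝ) (a b : ℤ) :
    (swapStep p)^[2 * j + 1] f a b =
      (signStep p)^[j] (fun x => (signStep p)^[j + 1] (f x) a) b := by
  rw [Function.iterate_succ_apply, iterate_swapStep_even]
  simp only [Function.iterate_succ_apply]
  exact iterate_signStep_comm j j (fun y x => signStep p (f y) x) b a

/-- After `m` signs, the two sums are independent and have almost the same size. -/
theorem exists_iterate_swapStep (m : ℕ) (f : ℤ → ℤ → ℝ) :
    ∃ a b : ℕ, a + b = m ∧ a ≤ b ∧ b ≤ a + 1 ∧ (swapStep p)^[m] f 0 0 =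
      (signStep p)^[a] (fun x => (signStep p)^[b] (f x) 0) 0 := by
  obtain ⟨j, rfl | rfl⟩ := m.even_or_odd'
  · exact ⟨j, j, by ring, le_rfl, by omega, iterate_swapStep_even j f 0 0⟩
  · exact ⟨j, j + 1, by ring, by omega, le_rfl, iterate_swapStep_odd j f 0 0⟩

/-- The left side is the exponent left by Hoeffding's lemma for the second class, given the sum x of
the first. The right side is quadratic in the centered x - μa, ready for averaging. The drift uses
|x| ≥ x and wb ≥ 1/4; the +1 in |x| + 1 supplies -μθ/4 even if the first class is empty. -/
theorem weighted_exponent_le {a b m μ w θ x : ℝ} (hm : 1 ≤ m) (ha : 0 ≤ a) (hab : a + b = m)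
    (hle : a ≤ b) (hμ : 0 ≤ μ) (hθ : 0 ≤ θ) (hw1 : 1 / (m + 1) ≤ w) (hw2 : w ≤ 2 / m) :
    b * ((θ * ((|x| + 1) * w)) ^ 2 / 2 - μ * (θ * ((|x| + 1) * w))) ≤
      (4 * θ ^ 2 + 4 * θ ^ 2 * μ ^ 2 * a - μ * θ / 4 - μ ^ 2 * θ * a / 4) +
      (8 * θ ^ 2 / m * (x - μ * a) ^ 2 - μ * θ / 4 * (x - μ * a)) := by
  have hm' : 0 < m := by linarith
  have hb : 0 ≤ b := ha.trans hle
  have hw0 : 0 ≤ w := le_trans (by positivity) hw1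
  have hwm : w * m ≤ 2 := by rwa [le_div_iff₀ hm'] at hw2
  have hwm1 : 1 ≤ w * (m + 1) := by rwa [div_le_iff₀ (by positivity)] at hw1
  have hwb : 1 / 4 ≤ w * b := by nlinarith
  have hw2b : w ^ 2 * b ≤ 4 / m := by
    rw [le_div_iff₀ hm']
    nlinarith [mul_nonneg hw0 hb, mul_nonneg hw0 hm'.le]
  set t := θ * ((|x| + 1) * w) with ht
  have hx := sq_abs x
  have hxa := abs_nonneg x
  have hxx := le_abs_self x
  have t1 : b * (t ^ 2 / 2) ≤ θ ^ 2 * (x ^ 2 + 1) * (4 / m) := by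
    have : b * (t ^ 2 / 2) = θ ^ 2 * ((|x| + 1) ^ 2 / 2) * (w ^ 2 * b) := by
      rw [ht]; ring
    rw [this]
    have h2 : (|x| + 1) ^ 2 / 2 ≤ x ^ 2 + 1 := by
      nlinarith [sq_nonneg (|x| - 1)]
    gcongr
  have t2 : μ * θ / 4 * (x + 1) ≤ b * (μ * t) := by
    have : b * (μ * t) = μ * θ * (|x| + 1) * (w * b) := by rw [ht]; ring
    rw [this]
    have h2 : μ * θ * (|x| + 1) * (1 / 4) ≤ μ * θ * (|x| + 1) * (w * b) := by
      gcongr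
    have h3 : μ * θ * (x + 1) ≤ μ * θ * (|x| + 1) := by gcongr
    linarith
  have t3 : θ ^ 2 * (x ^ 2 + 1) * (4 / m) ≤
      8 * θ ^ 2 / m * (x - μ * a) ^ 2 + 4 * θ ^ 2 * μ ^ 2 * a + 4 * θ ^ 2 := by
    have h2 : x ^ 2 ≤ 2 * (x - μ * a) ^ 2 + 2 * (μ * a) ^ 2 := by
      nlinarith [sq_nonneg (x - 2 * (μ * a))]
    have h3 : 2 * (μ * a) ^ 2 ≤ μ ^ 2 * a * m := by
      nlinarith [mul_nonneg (mul_nonneg (sq_nonneg μ) ha) (by linarith : (0 : ℝ) ≤ b - a)]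
    have h4 : x ^ 2 + 1 ≤ 2 * (x - μ * a) ^ 2 + μ ^ 2 * a * m + m := by linarith
    calc θ ^ 2 * (x ^ 2 + 1) * (4 / m)
        ≤ θ ^ 2 * (2 * (x - μ * a) ^ 2 + μ ^ 2 * a * m + m) * (4 / m) := by gcongr
      _ = _ := by field_simp; ring
  linarith [show b * (t ^ 2 / 2 - μ * t) = b * (t ^ 2 / 2) - b * (μ * t) by ring]

/-- The constant 36 is 4 + 64/2, by a/m ≤ 1/2. As m may be 2a + 1, the odd sign is paid for by -μθ/4
≤ -μ²θ/4. -/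
theorem averaged_exponent_le {a b m μ θ : ℝ} (hm : 1 ≤ m) (ha : 0 ≤ a) (hab : a + b = m)
    (hle : a ≤ b) (hle' : b ≤ a + 1) (hμ0 : 0 ≤ μ) (hμ1 : μ ≤ 1) (hθ0 : 0 ≤ θ)
    (hθ1 : θ ≤ 1 / 40) :
    (4 * θ ^ 2 + 4 * θ ^ 2 * μ ^ 2 * a - μ * θ / 4 - μ ^ 2 * θ * a / 4) +
      (8 * (8 * θ ^ 2 / m) + (μ * θ / 4) ^ 2) * a ≤ 36 * θ ^ 2 - θ * μ ^ 2 * m / 16 := by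
  have hm' : 0 < m := by linarith
  have ham : a / m ≤ 1 / 2 := by rw [div_le_iff₀ hm']; linarith
  have e1 : (8 * (8 * θ ^ 2 / m) + (μ * θ / 4) ^ 2) * a =
      64 * θ ^ 2 * (a / m) + μ ^ 2 * a * θ ^ 2 / 16 := by ring
  have e2 : 64 * θ ^ 2 * (a / m) ≤ 64 * θ ^ 2 * (1 / 2) := by gcongr
  have hθ2 : θ ^ 2 ≤ θ / 40 := by rw [sq]; linarith [mul_le_mul_of_nonneg_left hθ1 hθ0]
  have e3 : μ ^ 2 * a * θ ^ 2 ≤ μ ^ 2 * a * (θ / 40) := by gcongr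
  have e4 : μ ^ 2 * θ ≤ μ * θ := by
    have : μ ^ 2 ≤ μ := by rw [sq]; exact mul_le_of_le_one_left hμ0 hμ1
    gcongr
  have e5 : θ * μ ^ 2 * m ≤ θ * μ ^ 2 * (2 * a + 1) := by
    have : m ≤ 2 * a + 1 := by linarith
    gcongr
  have e6 : 0 ≤ μ ^ 2 * a * θ := by positivity
  have e7 : 0 ≤ μ * θ := by positivity
  rw [e1]
  linarith

/-- The exponential moment of the statistic of one coordinate, for a given number of signs. -/
theorem iterate_swapStep_exp_le (h0 : 1 / 2 ≤ p) (h1 : p ≤ 1) {m : ℕ} (hm : 0 < m) {θ w : ℝ}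
    (hθ0 : 0 ≤ θ) (hθ1 : θ ≤ 1 / 40) (hw1 : 1 / ((m : ℝ) + 1) ≤ w) (hw2 : w ≤ 2 / m) :
    (swapStep p)^[m] (fun x y => Real.exp (-(θ * ((|(x : ℝ)| + 1) * w) * y))) 0 0 ≤
      Real.exp (36 * θ ^ 2 - θ * (2 * p - 1) ^ 2 * m / 16) := by
  obtain ⟨a, b, hab, hle, hle', he⟩ := exists_iterate_swapStep (p := p) m
    fun x y => Real.exp (-(θ * ((|(x : ℝ)| + 1) * w) * y))
  rw [he]
  have hp0 : 0 ≤ p := by linarith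
  have hm' : (0 : ℝ) < m := by exact_mod_cast hm
  have hm1 : (1 : ℝ) ≤ m := by exact_mod_cast hm
  have hab' : (a : ℝ) + b = m := by exact_mod_cast hab
  have hle1 : (a : ℝ) ≤ b := by exact_mod_cast hle
  have hle2 : (b : ℝ) ≤ a + 1 := by exact_mod_cast hle'
  have ha0 : (0 : ℝ) ≤ a := by positivity
  have hμ0 : 0 ≤ 2 * p - 1 := by linarith
  have hμ1 : 2 * p - 1 ≤ 1 := by linarith
  have hinner : (fun x : ℤ => (signStep p)^[b]
      (fun y => Real.exp (-(θ * ((|(x : ℝ)| + 1) * w) * y))) 0) ≤ fun x : ℤ =>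
      Real.exp (4 * θ ^ 2 + 4 * θ ^ 2 * (2 * p - 1) ^ 2 * a - (2 * p - 1) * θ / 4 -
        (2 * p - 1) ^ 2 * θ * a / 4) *
      Real.exp (8 * θ ^ 2 / m * (x - (2 * p - 1) * a) ^ 2 -
        (2 * p - 1) * θ / 4 * (x - (2 * p - 1) * a)) := by
    intro x
    refine (iterate_signStep_exp_le hp0 h1 b _).trans ?_
    dsimp only
    rw [← Real.exp_add]
    exact Real.exp_le_exp.2 (weighted_exponent_le hm1 ha0 hab' hle1 hμ0 hθ0 hw1 hw2)
  refine (iterate_signStep_mono hp0 h1 a hinner 0).trans ?_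
  rw [iterate_signStep_const_mul]
  have ham : (a : ℝ) / m ≤ 1 / 2 := by rw [div_le_iff₀ hm']; linarith
  have hsq := iterate_signStep_exp_sq_le hp0 h1 a (c := 8 * θ ^ 2 / m) ((2 * p - 1) * θ / 4)
    (by positivity) (by
      calc 8 * (8 * θ ^ 2 / m) * a = 64 * θ ^ 2 * (a / m) := by ring
        _ ≤ 64 * (1 / 40) ^ 2 * (1 / 2) := by gcongr
        _ ≤ 1 := by norm_num)
  refine (mul_le_mul_of_nonneg_left hsq (Real.exp_pos _).le).trans ?_
  rw [← Real.exp_add]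
  exact Real.exp_le_exp.2 (averaged_exponent_le hm1 ha0 hab' hle1 hle2 hμ0 hμ1 hθ0 hθ1)

end Signs

/-! ## The statistic of one coordinate -/

/-- The expectation of `F` after a tally received the sign `1` with probability `p₁`, the sign
`-1` with probability `p₂`, and nothing otherwise. -/
def tallyStep (p₁ p₂ : ℝ) (F : Tally → ℝ) (T : Tally) : ℝ :=
  p₁ * F (T.push 1 0) + p₂ * F (T.push 0 1) + (1 - (p₁ + p₂)) * F T

/-- The exponential of the statistic of one coordinate. -/
def tallyExp (r : ℕ) (θ : ℝ) (T : Tally) : ℝ :=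
  Real.exp (-(θ / r * (T.weight r * ((T.bp : ℝ) - T.bm))))

theorem iterate_tallyStep_add (p₁ p₂ : ℝ) (j : ℕ) (F G : Tally → ℝ) (c d : ℝ) (T : Tally) :
    (tallyStep p₁ p₂)^[j] (fun T => c * F T + d * G T) T =
      c * (tallyStep p₁ p₂)^[j] F T + d * (tallyStep p₁ p₂)^[j] G T := by
  induction j generalizing F G with
  | zero => rfl
  | succ j ih =>
    simp only [Function.iterate_succ_apply]
    rw [← ih]
    refine congrFun (congrArg _ (funext fun T => ?_)) _
    simp only [tallyStep]
    ring

/-- If the number of nonzero signs is fixed, a geometric bound can be averaged. -/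
theorem iterate_tallyStep_le {s p : ℝ} (hs0 : 0 ≤ s) (hs1 : s ≤ 1) {q : ℝ} (T : Tally)
    (r : ℕ) (F : Tally → ℝ) {K : ℝ}
    (h : ∀ m ≤ r, (tallyStep p (1 - p))^[m] F T ≤ K * q ^ m) :
    (tallyStep (s * p) (s * (1 - p)))^[r] F T ≤ K * (1 - s + s * q) ^ r := by
  induction r generalizing F K with
  | zero => simpa using h 0 le_rfl
  | succ r ih =>
    -- Condition on whether the next pair differs. A differing pair shifts the geometric hypothesis
    -- by one, which replaces `K` by `K * q`; this sums the binomial law without writing it down.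
    have e : tallyStep (s * p) (s * (1 - p)) F =
        fun T => (1 - s) * F T + s * tallyStep p (1 - p) F T := by
      funext T
      simp only [tallyStep]
      ring
    rw [Function.iterate_succ_apply, e, iterate_tallyStep_add]
    have h1 := ih F fun m hm => h m (by omega)
    have h2 := ih (tallyStep p (1 - p) F) (K := K * q) fun m hm => by
      have := h (m + 1) (by omega)
      rw [Function.iterate_succ_apply] at this
      rw [mul_assoc, ← pow_succ']
      exact this
    have h1' := mul_le_mul_of_nonneg_left h1 (sub_nonneg.2 hs1)
    have h2' := mul_le_mul_of_nonneg_left h2 hs0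
    refine (add_le_add h1' h2').trans (le_of_eq ?_)
    ring

theorem Tally.total_push_pos (T : Tally) : (T.push 1 0).total = T.total + 1 := by
  simp only [Tally.push, Tally.total, if_true, Nat.zero_lt_one]; ring

theorem Tally.total_push_neg (T : Tally) : (T.push 0 1).total = T.total + 1 := by
  simp only [Tally.push, Tally.total, not_lt_zero, if_true, if_false, Nat.zero_lt_one]; ring

/-- With a fixed number of signs the final total is deterministic, so the total inside the weight
can be frozen. -/
theorem iterate_tallyStep_congr {p : ℝ} {m M : ℕ} {F G : Tally → ℝ}
    (h : ∀ T : Tally, T.total = M → F T = G T) {T : Tally} (hT : T.total + m = M) :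
    (tallyStep p (1 - p))^[m] F T = (tallyStep p (1 - p))^[m] G T := by
  induction m generalizing F G M with
  | zero => exact h T hT
  | succ m ih =>
    rw [Function.iterate_succ_apply, Function.iterate_succ_apply]
    refine ih (M := T.total + m) (fun T' hT' => ?_) rfl
    simp only [tallyStep]
    rw [h _ (by rw [Tally.total_push_pos]; omega), h _ (by rw [Tally.total_push_neg]; omega)]
    ring

theorem iterate_tallyStep_swapStep {p : ℝ} (m : ℕ) (f : ℤ → ℤ → ℝ) (T : Tally) :
    (tallyStep p (1 - p))^[m] (fun T => f ((T.ap : ℤ) - T.am) ((T.bp : ℤ) - T.bm)) T =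
      (swapStep p)^[m] f ((T.ap : ℤ) - T.am) ((T.bp : ℤ) - T.bm) := by
  induction m generalizing f with
  | zero => rfl
  | succ m ih =>
    rw [Function.iterate_succ_apply, Function.iterate_succ_apply, ← ih]
    refine congrFun (congrArg _ (funext fun T => ?_)) _
    simp only [tallyStep, swapStep, signStep, Tally.push, not_lt_zero, if_true, if_false,
      Nat.zero_lt_one]
    push_cast
    rw [show (T.ap : ℤ) + 1 - T.am = T.ap - T.am + 1 by ring,
      show (T.ap : ℤ) - (T.am + 1) = T.ap - T.am - 1 by ring]
    ring

/-- The natural quotient is ⌈r/(m+1)⌉, an integer substitute for r/m; rounding up costs at most a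
factor 2 because m ≤ r. -/
theorem ceil_div_bounds {m r : ℕ} (hm : 0 < m) (hmr : m ≤ r) :
    1 / ((m : ℝ) + 1) ≤ ((r + m) / (m + 1) : ℕ) / (r : ℝ) ∧
      ((r + m) / (m + 1) : ℕ) / (r : ℝ) ≤ 2 / m := by
  have hm' : (0 : ℝ) < m := by exact_mod_cast hm
  have hr' : (0 : ℝ) < r := by exact_mod_cast hm.trans_le hmr
  have h1 : r ≤ (r + m) / (m + 1) * (m + 1) := by
    have := Nat.div_add_mod (r + m) (m + 1)
    have := Nat.mod_lt (r + m) (by omega : 0 < m + 1)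
    have := Nat.mul_comm (m + 1) ((r + m) / (m + 1))
    omega
  have h2 : (r + m) / (m + 1) * m ≤ 2 * r :=
    (Nat.mul_le_mul_left _ (Nat.le_succ m)).trans
      ((Nat.div_mul_le_self (r + m) (m + 1)).trans (by omega))
  have h1' : (r : ℝ) ≤ ((r + m) / (m + 1) : ℕ) * ((m : ℝ) + 1) := by exact_mod_cast h1
  have h2' : (((r + m) / (m + 1) : ℕ) : ℝ) * m ≤ 2 * r := by exact_mod_cast h2
  constructor
  · rw [div_le_div_iff₀ (by positivity) hr']
    linarith
  · rw [div_le_div_iff₀ hr' hm']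
    linarith

theorem abs_sub_cast (a b : ℕ) : ((a - b + (b - a) : ℕ) : ℝ) = |(a : ℝ) - b| := by
  rcases le_total a b with h | h
  · rw [Nat.sub_eq_zero_of_le h, zero_add, Nat.cast_sub h, abs_sub_comm,
      abs_of_nonneg (sub_nonneg.2 (by exact_mod_cast h))]
  · rw [Nat.sub_eq_zero_of_le h, add_zero, Nat.cast_sub h,
      abs_of_nonneg (sub_nonneg.2 (by exact_mod_cast h))]

theorem iterate_tallyExp_le {p θ : ℝ} (h0 : 1 / 2 ≤ p) (h1 : p ≤ 1) (hθ0 : 0 ≤ θ)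
    (hθ1 : θ ≤ 1 / 40) {m r : ℕ} (hmr : m ≤ r) :
    (tallyStep p (1 - p))^[m] (tallyExp r θ) ⟨0, 0, 0, 0⟩ ≤
      Real.exp (36 * θ ^ 2) * Real.exp (-(θ * (2 * p - 1) ^ 2 / 16)) ^ m := by
  rcases Nat.eq_zero_or_pos m with rfl | hm
  · simp only [Function.iterate_zero, id_eq, tallyExp, pow_zero, mul_one]
    simp only [CharP.cast_eq_zero, sub_self, mul_zero, neg_zero]
    exact Real.exp_le_exp.2 (by positivity)
  · set w : ℝ := ((r + m) / (m + 1) : ℕ) / (r : ℝ) with hw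
    obtain ⟨hw1, hw2⟩ := ceil_div_bounds hm hmr
    have hcongr : ∀ T : Tally, T.total = m → tallyExp r θ T =
        (fun x y : ℤ => Real.exp (-(θ * ((|(x : ℝ)| + 1) * w) * y)))
          ((T.ap : ℤ) - T.am) ((T.bp : ℤ) - T.bm) := fun T hT => by
      simp only [tallyExp, Tally.weight, hT]
      push_cast
      rw [← abs_sub_cast, hw]
      push_cast
      congr 1
      ring
    rw [iterate_tallyStep_congr hcongr (by simp [Tally.total])]
    refine (iterate_tallyStep_swapStep (p := p) m (fun x y : ℤ =>
      Real.exp (-(θ * ((|(x : ℝ)| + 1) * w) * y))) ⟨0, 0, 0, 0⟩).trans_le ?_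
    refine (iterate_swapStep_exp_le h0 h1 hm hθ0 hθ1 hw1 hw2).trans (le_of_eq ?_)
    rw [← Real.exp_nat_mul, ← Real.exp_add]
    congr 1
    ring

/-- The exponential moment of the statistic of one coordinate. -/
theorem iterate_tallyStep_exp_le {p q θ : ℝ} (hp : p ∈ Set.Icc (0 : ℝ) 1)
    (hq : q ∈ Set.Icc (0 : ℝ) 1) (hqp : q ≤ p) (hθ0 : 0 ≤ θ) (hθ1 : θ ≤ 1 / 40) (r : ℕ) :
    (tallyStep (p * (1 - q)) (q * (1 - p)))^[r] (tallyExp r θ) ⟨0, 0, 0, 0⟩ ≤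
      Real.exp (36 * θ ^ 2 - θ / 32 * (r * ((p - q) ^ 2 / (p * (1 - q) + q * (1 - p))))) := by
  obtain ⟨hp0, hp1⟩ := hp
  obtain ⟨hq0, hq1⟩ := hq
  set s := p * (1 - q) + q * (1 - p) with hs
  have h1 : 0 ≤ p * (1 - q) := mul_nonneg hp0 (by linarith)
  have h2 : 0 ≤ q * (1 - p) := mul_nonneg hq0 (by linarith)
  have hs0 : 0 ≤ s := add_nonneg h1 h2
  have hs1 : s ≤ 1 := by nlinarith [mul_nonneg hp0 hq0, mul_nonneg (sub_nonneg.2 hp1) (sub_nonneg.2 hq1)]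
  rcases hs0.eq_or_lt with hz | hpos
  · have e1 : p * (1 - q) = 0 := by linarith
    have e2 : q * (1 - p) = 0 := by linarith
    have : tallyStep (p * (1 - q)) (q * (1 - p)) = id := by
      funext F T
      simp [tallyStep, e1, e2]
    rw [this, Function.iterate_id, ← hz]
    simp only [id_eq, tallyExp, CharP.cast_eq_zero, sub_self, mul_zero, neg_zero, div_zero, sub_zero]
    exact Real.exp_le_exp.2 (by positivity)
  -- The conditional probability that a sign is positive, given that the pair differs. Its bias μ
  -- satisfies sμ = p - q, so sμ² = (p-q)²/s in the final exponent.
  · set c := p * (1 - q) / s with hc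
    have e1 : p * (1 - q) = s * c := by rw [hc]; field_simp
    have e2 : q * (1 - p) = s * (1 - c) := by linarith
    have hc1 : c ≤ 1 := by rw [hc, div_le_one hpos]; linarith
    have hc0 : 1 / 2 ≤ c := by rw [hc, div_le_div_iff₀ two_pos hpos]; nlinarith
    have hμ : s * (2 * c - 1) = p - q := by linarith
    set μ := 2 * c - 1 with hμdef
    have hμ0 : 0 ≤ μ := by linarith
    have hμ1 : μ ≤ 1 := by linarith
    have hbound := iterate_tallyStep_le hs0 hs1 ⟨0, 0, 0, 0⟩ r (tallyExp r θ)
      fun m hm => iterate_tallyExp_le hc0 hc1 hθ0 hθ1 hm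
    rw [← hμdef] at hbound
    rw [e1, e2]
    refine hbound.trans ?_
    set κ := θ * μ ^ 2 / 16 with hκ
    have hμ2 : μ ^ 2 ≤ 1 := pow_le_one₀ hμ0 hμ1
    have hκ0 : 0 ≤ κ := by positivity
    have hκ1 : κ ≤ 1 := by rw [hκ]; nlinarith
    have h3 : 1 - s + s * Real.exp (-κ) ≤ Real.exp (-(s * κ / 2)) := by
      have h4 := mul_le_mul_of_nonneg_left (exp_neg_le_one_sub_half hκ0 hκ1) hs0
      have h5 := Real.one_sub_le_exp_neg (s * κ / 2)
      linarith
    have h6 : (1 - s + s * Real.exp (-κ)) ^ r ≤ Real.exp (-(s * κ / 2)) ^ r :=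
      pow_le_pow_left₀ (add_nonneg (by linarith) (by positivity)) h3 r
    refine (mul_le_mul_of_nonneg_left h6 (Real.exp_pos _).le).trans (le_of_eq ?_)
    rw [← Real.exp_nat_mul, ← Real.exp_add]
    congr 1
    rw [← hμ, hκ]
    field_simp
    ring

/-! ## Expectations over samples -/

/-- The weight of a Boolean under the Bernoulli distribution with mean `p`. -/
def boolWeight (p : ℝ) (b : Bool) : ℝ := if b then p else 1 - p

/-- A finite sequence of Booleans as a sequence of numbers. -/
def extend {r : ℕ} (x : Fin r → Bool) (l : ℕ) : ℕ := if h : l < r then (x ⟨l, h⟩).toNat else 0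

theorem tally_congr {f g f' g' : ℕ → ℕ} {r : ℕ} (hf : ∀ l < r, f l = f' l)
    (hg : ∀ l < r, g l = g' l) : tally f g r = tally f' g' r := by
  induction r with
  | zero => rfl
  | succ r ih =>
    rw [tally, tally, ih (fun l hl => hf l (by omega)) (fun l hl => hg l (by omega)),
      hf r (by omega), hg r (by omega)]

theorem tally_snoc {r : ℕ} (x y : Fin r → Bool) (a b : Bool) :
    tally (extend (Fin.snoc x a : Fin (r + 1) → Bool))
      (extend (Fin.snoc y b : Fin (r + 1) → Bool)) (r + 1) =
      (tally (extend x) (extend y) r).push a.toNat b.toNat := by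
  have h : ∀ (x : Fin r → Bool) (a : Bool), ∀ l < r,
      extend (Fin.snoc x a : Fin (r + 1) → Bool) l = extend x l := fun x a l hl => by
    simp only [extend, hl, hl.trans (Nat.lt_succ_self r), dif_pos, Fin.snoc]
    rfl
  have h' : ∀ (x : Fin r → Bool) (a : Bool),
      extend (Fin.snoc x a : Fin (r + 1) → Bool) r = a.toNat := fun x a => by
    simp [extend, Fin.snoc]
  rw [tally, h', h', tally_congr (h x a) (h y b)]

theorem sum_snoc {r : ℕ} (g : (Fin (r + 1) → Bool) → ℝ) :
    ∑ x, g x = ∑ x : Fin r → Bool, ∑ a, g (Fin.snoc x a) := by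
  rw [← (Fin.snocEquiv fun _ => Bool).sum_comp, Fintype.sum_prod_type, Finset.sum_comm]
  rfl

/-- The expectation over two sequences of samples is an iterated step. -/
theorem sum_tally (p q : ℝ) (r : ℕ) (F : Tally → ℝ) :
    ∑ x : Fin r → Bool, ∑ y : Fin r → Bool,
      (∏ l, boolWeight p (x l)) * (∏ l, boolWeight q (y l)) * F (tally (extend x) (extend y) r) =
      (tallyStep (p * (1 - q)) (q * (1 - p)))^[r] F ⟨0, 0, 0, 0⟩ := by
  induction r generalizing F with
  | zero => simp [tally]
  | succ r ih =>
    rw [Function.iterate_succ_apply, ← ih, sum_snoc]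
    refine Finset.sum_congr rfl fun x _ => ?_
    have : ∀ a : Bool, ∑ y : Fin (r + 1) → Bool,
        (∏ l, boolWeight p ((Fin.snoc x a : Fin (r + 1) → Bool) l)) *
          (∏ l, boolWeight q (y l)) *
          F (tally (extend (Fin.snoc x a : Fin (r + 1) → Bool)) (extend y) (r + 1)) =
        ∑ y : Fin r → Bool, ∑ b : Bool, ((∏ l, boolWeight p (x l)) * boolWeight p a) *
          ((∏ l, boolWeight q (y l)) * boolWeight q b) *
          F ((tally (extend x) (extend y) r).push a.toNat b.toNat) := fun a => by
      rw [sum_snoc]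
      refine Finset.sum_congr rfl fun y _ => Finset.sum_congr rfl fun b _ => ?_
      rw [tally_snoc, Fin.prod_univ_castSucc, Fin.prod_univ_castSucc]
      simp only [Fin.snoc_castSucc, Fin.snoc_last]
    simp only [this]
    rw [Finset.sum_comm]
    refine Finset.sum_congr rfl fun y _ => ?_
    have hpp : ∀ T : Tally, T.push 1 1 = T := fun T => by simp [Tally.push]
    have hnn : ∀ T : Tally, T.push 0 0 = T := fun T => by simp [Tally.push]
    simp only [Fintype.sum_bool, Bool.toNat_true, Bool.toNat_false, hpp, hnn, boolWeight, if_true,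
      Bool.false_eq_true, if_false, tallyStep]
    ring

/-! ## The information of a pair of rows -/

/-- The squared difference of two probabilities, relative to the probability that the two
samples differ. -/
def sqGap (p q : ℝ) : ℝ := (p - q) ^ 2 / (p * (1 - q) + q * (1 - p))

theorem sqGap_symm (p q : ℝ) : sqGap (1 - q) (1 - p) = sqGap p q := by
  unfold sqGap
  congr 1 <;> ring

/-- With d = p - q, e = p' - p and s the denominator at p, cross-multiplication leaves de(2s -
d(1-2q)) + e²s ≥ 0, and d(1-2q) ≤ 2s. Zero denominators are treated apart. -/
theorem sqGap_mono_left {p p' q : ℝ} (h0 : 0 ≤ q) (hqp : q ≤ p) (hpp : p ≤ p') (h1 : p' ≤ 1) :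
    sqGap p q ≤ sqGap p' q := by
  unfold sqGap
  have n1 : 0 ≤ p * (1 - q) + q * (1 - p) := by
    have := mul_nonneg (h0.trans hqp) (by linarith : 0 ≤ 1 - q)
    have := mul_nonneg h0 (by linarith : 0 ≤ 1 - p)
    linarith
  have n2 : (p' - q) ^ 2 ≤ p' * (1 - q) + q * (1 - p') := by
    have := mul_nonneg (by linarith : 0 ≤ p') (by linarith : 0 ≤ 1 - p')
    have := mul_nonneg h0 (by linarith : 0 ≤ 1 - q)
    nlinarith
  have hr : 0 ≤ (p' - q) ^ 2 / (p' * (1 - q) + q * (1 - p')) :=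
    div_nonneg (sq_nonneg _) ((sq_nonneg _).trans n2)
  rcases eq_or_lt_of_le hqp with rfl | hlt
  · simpa using hr
  rcases n1.eq_or_lt with hz | hpos
  · rw [← hz, div_zero]
    exact hr
  have hpos' : 0 < p' * (1 - q) + q * (1 - p') :=
    (pow_pos (by linarith : 0 < p' - q) 2).trans_le n2
  rw [div_le_div_iff₀ hpos hpos']
  set d := p - q with hd
  set e := p' - p with he
  have h2 : p' = p + e := by rw [he]; ring
  have h3 : p' * (1 - q) + q * (1 - p') = p * (1 - q) + q * (1 - p) + e * (1 - 2 * q) := by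
    rw [h2]; ring
  have h4 : p' - q = d + e := by rw [hd, he]; ring
  have h5 : d * (1 - 2 * q) ≤ 2 * (p * (1 - q) + q * (1 - p)) := by
    have := mul_nonneg h0 (by linarith : 0 ≤ 1 - q)
    rw [hd]
    nlinarith
  have hd0 : 0 ≤ d := by rw [hd]; linarith
  have he0 : 0 ≤ e := by rw [he]; linarith
  rw [h3, h4]
  have h6 := mul_le_mul_of_nonneg_left h5 (mul_nonneg hd0 he0)
  nlinarith [mul_nonneg (sq_nonneg e) n1]

/-- Lowering the lower end is raising the upper end after the reflection t ↦ 1 - t. -/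
theorem sqGap_mono {p p' q q' : ℝ} (h0 : 0 ≤ q') (hqq : q' ≤ q) (hqp : q ≤ p) (hpp : p ≤ p')
    (h1 : p' ≤ 1) : sqGap p q ≤ sqGap p' q' := by
  refine (sqGap_mono_left (h0.trans hqq) hqp hpp h1).trans ?_
  rw [← sqGap_symm p' q, ← sqGap_symm p' q']
  exact sqGap_mono_left (by linarith) (by linarith) (by linarith) (by linarith)

/-- The left side is the relative entropy to a fair coin, bounded by the χ²-divergence via log(2y) ≤
2y - 1 for y = x and y = 1 - x. -/
theorem log_two_sub_binEntropy_le {x : ℝ} (h0 : 0 ≤ x) (h1 : x ≤ 1) :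
    Real.log 2 - Real.binEntropy x ≤ (2 * x - 1) ^ 2 := by
  have key : ∀ y : ℝ, 0 ≤ y → y * Real.log 2 - y * Real.log y⁻¹ ≤ y * (2 * y - 1) := by
    intro y hy
    rcases hy.eq_or_lt with rfl | hy
    · simp
    · rw [Real.log_inv, ← mul_sub]
      have := Real.log_le_sub_one_of_pos (show 0 < 2 * y by positivity)
      rw [Real.log_mul two_ne_zero hy.ne'] at this
      exact mul_le_mul_of_nonneg_left (by linarith) hy.le
  have k1 := key x h0
  have k2 := key (1 - x) (by linarith)
  rw [Real.binEntropy]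
  nlinarith

theorem log_two_mul_info_le {p q : ℝ} (hp : p ∈ Set.Icc (0 : ℝ) 1) (hq : q ∈ Set.Icc (0 : ℝ) 1) :
    Real.log 2 * info p q ≤ sqGap p q := by
  obtain ⟨hp0, hp1⟩ := hp
  obtain ⟨hq0, hq1⟩ := hq
  unfold info sqGap entropyBits
  have h1 : 0 ≤ p * (1 - q) := mul_nonneg hp0 (by linarith)
  have h2 : 0 ≤ q * (1 - p) := mul_nonneg hq0 (by linarith)
  have hdiff : p * (1 - q) - q * (1 - p) = p - q := by ring
  set s := p * (1 - q) + q * (1 - p) with hs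
  have hs0 : 0 ≤ s := add_nonneg h1 h2
  rcases hs0.eq_or_lt with hz | hpos
  · rw [← hz]; simp
  set x := p * (1 - q) / s with hx
  have hx0 : 0 ≤ x := by positivity
  have hx1 : x ≤ 1 := by rw [hx, div_le_one hpos]; linarith
  have hl : 0 < Real.log 2 := Real.log_pos one_lt_two
  have e : Real.log 2 * (s * (1 - Real.binEntropy x / Real.log 2)) =
      s * (Real.log 2 - Real.binEntropy x) := by field_simp
  rw [e, le_div_iff₀ hpos]
  have h3 := mul_le_mul_of_nonneg_left (log_two_sub_binEntropy_le hx0 hx1) hs0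
  have h4 : s * x = p * (1 - q) := by rw [hx]; field_simp
  have h5 : (p - q) ^ 2 = s * (2 * x - 1) ^ 2 * s := by
    have : s * (2 * x - 1) = p - q := by linarith
    rw [← this]; ring
  rw [h5]
  exact mul_le_mul_of_nonneg_right h3 hs0

theorem boolWeight_nonneg {p : ℝ} (hp : p ∈ Set.Icc (0 : ℝ) 1) (b : Bool) : 0 ≤ boolWeight p b := by
  cases b
  · simpa [boolWeight] using hp.2
  · simpa [boolWeight] using hp.1

/-! ## Product weights -/

section Product

variable {ι β : Type*} [Fintype ι] [Fintype β] [DecidableEq ι]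

open Classical in
/-- The marginal of two coordinates under product weights. -/
theorem sum_prod_mul_pair {w : ι → β → ℝ} (hw : ∀ i, ∑ b, w i b = 1) {y x : ι} (hyx : y ≠ x)
    (F : β → β → ℝ) :
    ∑ z : ι → β, (∏ i, w i (z i)) * F (z y) (z x) = ∑ a, ∑ b, w y a * w x b * F a b := by
  -- The weights with the coordinates y and x pinned to a and b; pinning keeps the product form, so
  -- each sum over z factors.
  let g : β → β → ι → β → ℝ := fun a b i c =>
    if i = y then (if c = a then w y c else 0)
    else if i = x then (if c = b then w x c else 0) else w i c
  have h1 : ∀ z : ι → β, (∏ i, w i (z i)) * F (z y) (z x) =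
      ∑ a, ∑ b, (∏ i, g a b i (z i)) * F a b := fun z => by
    rw [Finset.sum_eq_single (z y), Finset.sum_eq_single (z x)]
    · congr 1
      refine Finset.prod_congr rfl fun i _ => ?_
      simp only [g]
      split_ifs with h1 h2
      · rw [h1]
      · exact absurd (by rw [h1]) h2
      · rename_i h2 _
        rw [h2]
      · rename_i h3 h4
        exact absurd (by rw [h3]) h4
      · rfl
    · intro b _ hb
      rw [Finset.prod_eq_zero (Finset.mem_univ x), zero_mul]
      simp [g, hyx.symm, Ne.symm hb]
    · simp
    · intro a _ ha
      refine Finset.sum_eq_zero fun b _ => ?_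
      rw [Finset.prod_eq_zero (Finset.mem_univ y), zero_mul]
      simp [g, Ne.symm ha]
    · simp
  have h2 : ∀ a b, ∑ z : ι → β, ∏ i, g a b i (z i) = w y a * w x b := fun a b => by
    rw [← Fintype.prod_sum, Fintype.prod_eq_mul y x hyx]
    · simp [g, hyx.symm]
    · rintro i ⟨hi, hi'⟩
      simp [g, hi, hi', hw]
  simp only [h1]
  rw [Finset.sum_comm]
  refine Finset.sum_congr rfl fun a _ => ?_
  rw [Finset.sum_comm]
  refine Finset.sum_congr rfl fun b _ => ?_
  rw [← Finset.sum_mul, h2]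

theorem sum_sum_prod (h : ι → β → β → ℝ) :
    ∑ a : ι → β, ∑ b : ι → β, ∏ c, h c (a c) (b c) = ∏ c, ∑ a, ∑ b, h c a b := by
  have : ∀ c, ∑ a, ∑ b, h c a b = ∑ ab : β × β, h c ab.1 ab.2 := fun c =>
    (Fintype.sum_prod_type fun ab : β × β => h c ab.1 ab.2).symm
  simp only [this]
  rw [Fintype.prod_sum, ← (Equiv.arrowProdEquivProdArrow ι (fun _ => β) fun _ => β).symm.sum_comp,
    Fintype.sum_prod_type]
  rfl

end Product

/-! ## The law of the samples -/

section Law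

variable {n r : ℕ} {P : Matrix (Fin n) (Fin n) ℝ}

/-- The probability of an array of samples. -/
def sampleWeight (P : Matrix (Fin n) (Fin n) ℝ) (π : Equiv.Perm (Fin n)) (z : Samples n r) : ℝ :=
  ∏ i, ∏ j, ∏ l, boolWeight (P (π.symm i) (π.symm j)) (z i j l)

theorem sampleWeight_nonneg (hP : IsSST P) (π : Equiv.Perm (Fin n)) (z : Samples n r) :
    0 ≤ sampleWeight P π z :=
  Finset.prod_nonneg fun _ _ => Finset.prod_nonneg fun _ _ => Finset.prod_nonneg fun _ _ =>
    boolWeight_nonneg (hP.mem_Icc _ _) _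

theorem sampleLaw_apply (hP : IsSST P) (π : Equiv.Perm (Fin n)) (z : Samples n r) :
    sampleLaw hP π r z = ENNReal.ofReal (sampleWeight P π z) := by
  have h : ∀ p b, bernoulliWeight p b = ENNReal.ofReal (boolWeight p b) := fun p b => by
    cases b <;> simp [bernoulliWeight, boolWeight]
  rw [sampleLaw, PMF.ofFintype_apply, sampleWeight, ENNReal.ofReal_prod_of_nonneg]
  · refine Finset.prod_congr rfl fun i _ => ?_
    rw [ENNReal.ofReal_prod_of_nonneg]
    · refine Finset.prod_congr rfl fun j _ => ?_
      rw [ENNReal.ofReal_prod_of_nonneg]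
      · exact Finset.prod_congr rfl fun l _ => h _ _
      · exact fun _ _ => boolWeight_nonneg (hP.mem_Icc _ _) _
    · exact fun _ _ => Finset.prod_nonneg fun _ _ => boolWeight_nonneg (hP.mem_Icc _ _) _
  · exact fun _ _ => Finset.prod_nonneg fun _ _ => Finset.prod_nonneg fun _ _ =>
      boolWeight_nonneg (hP.mem_Icc _ _) _

theorem sum_rowWeight (P : Matrix (Fin n) (Fin n) ℝ) (π : Equiv.Perm (Fin n)) (i : Fin n) :
    ∑ a : Fin n → Fin r → Bool, ∏ j, ∏ l, boolWeight (P (π.symm i) (π.symm j)) (a j l) = 1 := by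
  have h : ∀ j : Fin n, ∑ a : Fin r → Bool, ∏ l, boolWeight (P (π.symm i) (π.symm j)) (a l) = 1 :=
    fun j => by
      rw [← Fintype.prod_sum]
      simp [boolWeight]
  rw [← Fintype.prod_sum fun j (a : Fin r → Bool) => ∏ l, boolWeight (P (π.symm i) (π.symm j)) (a l)]
  simp [h]

theorem sum_sampleWeight (P : Matrix (Fin n) (Fin n) ℝ) (π : Equiv.Perm (Fin n)) :
    ∑ z : Samples n r, sampleWeight P π z = 1 := by
  unfold sampleWeight
  rw [← Fintype.prod_sum fun i (a : Fin n → Fin r → Bool) =>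
    ∏ j, ∏ l, boolWeight (P (π.symm i) (π.symm j)) (a j l)]
  simp [sum_rowWeight]

theorem coordTally_eq (z : Samples n r) (y x c : Fin n) :
    coordTally z y x c = tally (extend (z y c)) (extend (z x c)) r := by
  have h : ∀ y : Fin n, (fun l => readSample z y c l) = extend (z y c) := fun y => by
    funext l
    by_cases hl : l < r <;> simp [readSample, extend, hl]
  rw [coordTally, h, h]

/-- The exponential moment of the statistic that compares two labels. -/
theorem sum_sampleWeight_mul_exp (π : Equiv.Perm (Fin n)) {y x : Fin n} (hyx : y ≠ x) (θ : ℝ) :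
    ∑ z : Samples n r, sampleWeight P π z * ∏ c : Fin n, tallyExp r θ (coordTally z y x c) =
      ∏ c : Fin n, (tallyStep (P (π.symm y) (π.symm c) * (1 - P (π.symm x) (π.symm c)))
        (P (π.symm x) (π.symm c) * (1 - P (π.symm y) (π.symm c))))^[r] (tallyExp r θ)
          ⟨0, 0, 0, 0⟩ := by
  simp only [sampleWeight, coordTally_eq]
  rw [sum_prod_mul_pair (w := fun i (a : Fin n → Fin r → Bool) =>
      ∏ j, ∏ l, boolWeight (P (π.symm i) (π.symm j)) (a j l)) (sum_rowWeight P π) hyx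
    fun a b => ∏ c : Fin n, tallyExp r θ (tally (extend (a c)) (extend (b c)) r)]
  simp only [← sum_tally, ← sum_sum_prod, Finset.prod_mul_distrib]

/-- Chernoff's step: a comparison lost by y forces a nonpositive total statistic, even with the tie
rule, so the exponential dominates the indicator of the error. -/
theorem one_le_prod_of_not_beats {z : Samples n r} {y x : Fin n} (h : ¬ Beats z y x) {θ : ℝ}
    (hθ : 0 ≤ θ) : 1 ≤ ∏ c : Fin n, tallyExp r θ (coordTally z y x c) := by
  have h1 : evidence z y x ≤ counterEvidence z y x := by
    rw [Beats, not_lt] at h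
    omega
  have h2 : (evidence z y x : ℝ) ≤ counterEvidence z y x := by exact_mod_cast h1
  simp only [evidence, counterEvidence, Finset.sum_range] at h2
  push_cast at h2
  simp only [tallyExp]
  rw [← Real.exp_sum]
  refine Real.one_le_exp ?_
  rw [Finset.sum_neg_distrib, ← Finset.mul_sum]
  simp only [mul_sub, Finset.sum_sub_distrib]
  rw [← mul_sub, ← mul_neg]
  exact mul_nonneg (by positivity) (by linarith)

theorem prob_not_beats_le (hP : IsSST P) (π : Equiv.Perm (Fin n)) {y x : Fin n}
    (hyx : π.symm y < π.symm x) {θ : ℝ} (hθ0 : 0 ≤ θ) (hθ1 : θ ≤ 1 / 40) :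
    ∑ z : Samples n r, sampleWeight P π z * (∏ c : Fin n, tallyExp r θ (coordTally z y x c)) ≤
      Real.exp (36 * θ ^ 2 * n - θ / 32 *
        (r * ∑ c, sqGap (P (π.symm y) c) (P (π.symm x) c))) := by
  rw [sum_sampleWeight_mul_exp π (fun h => hyx.ne (by rw [h]))]
  refine (Finset.prod_le_prod (fun c _ => ?_) fun c _ => iterate_tallyStep_exp_le
    (hP.mem_Icc _ _) (hP.mem_Icc _ _) (hP.antitone _ _ hyx _) hθ0 hθ1 r).trans (le_of_eq ?_)
  · rw [← sum_tally]
    refine Finset.sum_nonneg fun a _ => Finset.sum_nonneg fun b _ => ?_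
    refine mul_nonneg (mul_nonneg ?_ ?_) (Real.exp_pos _).le
    all_goals exact Finset.prod_nonneg fun _ _ => boolWeight_nonneg (hP.mem_Icc _ _) _
  · rw [← Real.exp_sum, ← π.symm.sum_comp fun c => sqGap (P (π.symm y) c) (P (π.symm x) c),
      Finset.sum_sub_distrib, Finset.sum_const, Finset.card_univ, Fintype.card_fin, nsmul_eq_mul,
      ← Finset.mul_sum, ← Finset.mul_sum]
    simp only [sqGap]
    congr 1
    ring

end Law

/-! ### Union bound over the cut and success probability -/

section Success

variable {n r : ℕ} {P : Matrix (Fin n) (Fin n) ℝ}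

/-- The labels of the `k` best items, as numbers. -/
def topLabels (π : Equiv.Perm (Fin n)) (k : ℕ) : Finset ℕ :=
  ({i | (π.symm i : ℕ) < k} : Finset (Fin n)).map Fin.valEmbedding

theorem mem_topLabels {π : Equiv.Perm (Fin n)} {k : ℕ} {i : Fin n} :
    (i : ℕ) ∈ topLabels π k ↔ (π.symm i : ℕ) < k := by
  simp [topLabels, Fin.val_inj]

theorem topLabels_subset (π : Equiv.Perm (Fin n)) (k : ℕ) : topLabels π k ⊆ Finset.range n := by
  intro x hx
  obtain ⟨i, -, rfl⟩ := Finset.mem_map.1 hx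
  exact Finset.mem_range.2 i.2

theorem card_topLabels (π : Equiv.Perm (Fin n)) {k : ℕ} (hk : k ≤ n) :
    (topLabels π k).card = k := by
  rw [topLabels, Finset.card_map]
  have : ({i | (π.symm i : ℕ) < k} : Finset (Fin n)) =
      ({i | (i : ℕ) < k} : Finset (Fin n)).map π.toEmbedding := by
    ext i
    simp only [Finset.mem_filter, Finset.mem_univ, true_and, Finset.mem_map, Equiv.coe_toEmbedding]
    exact ⟨fun h => ⟨_, h, π.apply_symm_apply i⟩, by rintro ⟨j, hj, rfl⟩; simpa using hj⟩
  rw [this, Finset.card_map, Fin.card_filter_val_lt, min_eq_right hk]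

theorem exists_not_beats {π : Equiv.Perm (Fin n)} {k : ℕ} {z : Samples n r}
    (h : ¬ Separates z (topLabels π k)) : ∃ y x : Fin n, (π.symm y : ℕ) < k ∧
      k ≤ (π.symm x : ℕ) ∧ ¬ Beats z y x := by
  simp only [Separates, not_forall] at h
  obtain ⟨y, hy, x, hx, hxT, hb⟩ := h
  have hyn := Finset.mem_range.1 (topLabels_subset π k hy)
  refine ⟨⟨y, hyn⟩, ⟨x, hx⟩, ?_, ?_, hb⟩
  · exact mem_topLabels.1 hy
  · exact not_lt.1 fun hlt => hxT (mem_topLabels (i := ⟨x, hx⟩).2 hlt)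

/-- The information of the rows `k` and `k + 1` bounds the gap of all pairs of rows that are
separated by them. -/
theorem log_two_mul_infoVec_le (hP : IsSST P) {k : ℕ} (hkn : k < n) (hk : 0 < k) {u v : Fin n}
    (hu : (u : ℕ) < k) (hv : k ≤ (v : ℕ)) :
    Real.log 2 * infoVec (P ⟨k - 1, by omega⟩) (P ⟨k, hkn⟩) ≤ ∑ c, sqGap (P u c) (P v c) := by
  have hanti : ∀ a b : Fin n, a ≤ b → ∀ c, P b c ≤ P a c := fun a b hab c => by
    rcases hab.eq_or_lt with rfl | h
    · exact le_rfl
    · exact hP.antitone a b h c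
  rw [infoVec, Finset.mul_sum]
  refine Finset.sum_le_sum fun c _ =>
    (log_two_mul_info_le (hP.mem_Icc _ _) (hP.mem_Icc _ _)).trans ?_
  refine sqGap_mono (hP.mem_Icc v c).1 ?_ ?_ ?_ (hP.mem_Icc u c).2
  · exact hanti _ _ (Fin.mk_le_of_le_val hv) c
  · exact hanti _ _ (Fin.mk_le_mk.2 (by omega)) c
  · exact hanti _ _ (Fin.le_def.2 (by simp only; omega)) c

/-- The choice θ = 1/(40√n) turns the noise term into 36/1600, and 7776/(40 · 32) > 6 makes the
signal at least 6L with L = ln(2n/α) ≥ 1. The difference leaves more than the 2L needed for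
(α/(2n))². -/
theorem error_exponent_le {n D r α : ℝ} (hn : 2 ≤ n) (hα0 : 0 < α) (hα1 : α < 1)
    (h : Real.log 2 * (7776 * √n * Real.logb 2 (2 * n / α)) ≤ r * D) :
    Real.exp (36 * (1 / (40 * √n)) ^ 2 * n - 1 / (40 * √n) / 32 * (r * D)) ≤
      (α / (2 * n)) ^ 2 := by
  have hn0 : 0 < n := by linarith
  have hs : 0 < √n := Real.sqrt_pos.2 hn0
  have hs2 : √n ^ 2 = n := Real.sq_sqrt hn0.le
  set L := Real.log (2 * n / α) with hL
  have hL2 : Real.log 2 * Real.logb 2 (2 * n / α) = L := by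
    rw [Real.logb, hL]
    field_simp [(Real.log_pos one_lt_two).ne']
  have hL1 : 1 ≤ L := by
    rw [hL, Real.le_log_iff_exp_le (by positivity), le_div_iff₀ hα0]
    have := Real.exp_one_lt_d9
    nlinarith
  have e1 : 36 * (1 / (40 * √n)) ^ 2 * n = 36 / 1600 := by
    rw [div_pow, mul_pow, hs2]
    field_simp
    norm_num
  have e2 : 6 * L ≤ 1 / (40 * √n) / 32 * (r * D) := by
    have : 7776 * √n * L ≤ r * D := by rw [← hL2]; linarith
    calc 6 * L ≤ 1 / (40 * √n) / 32 * (7776 * √n * L) := by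
          have : 1 / (40 * √n) / 32 * (7776 * √n * L) = 7776 / 1280 * L := by field_simp; ring
          rw [this]
          linarith
      _ ≤ _ := by gcongr
  have e3 : (α / (2 * n)) ^ 2 = Real.exp (-(2 * L)) := by
    have : α / (2 * n) = Real.exp (-L) := by
      rw [Real.exp_neg, hL, Real.exp_log (by positivity), inv_div]
    rw [this, ← Real.exp_nat_mul]
    congr 1
    push_cast
    ring
  rw [e1, e3]
  exact Real.exp_le_exp.2 (by linarith)

open Classical in
/-- With high probability, the comparisons separate the best items from the others. -/
theorem prob_not_separates_le (hP : IsSST P) {k : ℕ} (hkn : k < n) (hk : 0 < k) {α : ℝ}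
    (hα0 : 0 < α) (hα1 : α < 1)
    (hr : 7776 * √(n : ℝ) * Real.logb 2 (2 * n / α) ≤
      r * infoVec (P ⟨k - 1, by omega⟩) (P ⟨k, hkn⟩)) (π : Equiv.Perm (Fin n)) :
    ∑ z : Samples n r, sampleWeight P π z *
      (if Separates z (topLabels π k) then 0 else 1) ≤ α / 2 := by
  have hn : (2 : ℝ) ≤ n := by exact_mod_cast (by omega : 2 ≤ n)
  set θ : ℝ := 1 / (40 * √(n : ℝ)) with hθ
  have hs1 : 1 ≤ √(n : ℝ) := Real.one_le_sqrt.2 (by linarith)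
  have hθ0 : 0 ≤ θ := by positivity
  have hθ1 : θ ≤ 1 / 40 := by
    rw [hθ]
    exact one_div_le_one_div_of_le (by norm_num) (by linarith)
  let B : Finset (Fin n × Fin n) := {q | (π.symm q.1 : ℕ) < k ∧ k ≤ (π.symm q.2 : ℕ)}
  have hz : ∀ z : Samples n r, sampleWeight P π z *
      (if Separates z (topLabels π k) then 0 else 1) ≤ ∑ q ∈ B, sampleWeight P π z *
        ∏ c : Fin n, tallyExp r θ (coordTally z q.1 q.2 c) := fun z => by
    have hnn : ∀ q ∈ B, 0 ≤ sampleWeight P π z *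
        ∏ c : Fin n, tallyExp r θ (coordTally z q.1 q.2 c) := fun q _ =>
      mul_nonneg (sampleWeight_nonneg hP π z)
        (Finset.prod_nonneg fun _ _ => (Real.exp_pos _).le)
    split_ifs with h
    · rw [mul_zero]
      exact Finset.sum_nonneg hnn
    · obtain ⟨y, x, hy, hx, hb⟩ := exists_not_beats h
      refine le_trans ?_ (Finset.single_le_sum hnn
        (Finset.mem_filter.2 ⟨Finset.mem_univ (y, x), hy, hx⟩))
      exact mul_le_mul_of_nonneg_left (one_le_prod_of_not_beats hb hθ0)
        (sampleWeight_nonneg hP π z)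
  refine (Finset.sum_le_sum fun z _ => hz z).trans ?_
  rw [Finset.sum_comm]
  have hq : ∀ q ∈ B, ∑ z : Samples n r, sampleWeight P π z *
      ∏ c : Fin n, tallyExp r θ (coordTally z q.1 q.2 c) ≤ (α / (2 * n)) ^ 2 := fun q hq => by
    obtain ⟨hy, hx⟩ := (Finset.mem_filter.1 hq).2
    refine (prob_not_beats_le hP π (Fin.lt_def.2 (hy.trans_le hx)) hθ0 hθ1).trans ?_
    refine error_exponent_le hn hα0 hα1 ?_
    have h1 := log_two_mul_infoVec_le hP hkn hk hy hx
    have h2 := mul_le_mul_of_nonneg_left hr (Real.log_pos one_lt_two).le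
    have h3 := mul_le_mul_of_nonneg_left h1 (Nat.cast_nonneg (α := ℝ) r)
    linarith
  refine (Finset.sum_le_sum hq).trans ?_
  rw [Finset.sum_const, nsmul_eq_mul]
  have hcard : (B.card : ℝ) ≤ (n : ℝ) ^ 2 := by
    have : B.card ≤ n ^ 2 := by
      refine (Finset.card_le_univ B).trans ?_
      simp [sq]
    exact_mod_cast this
  calc (B.card : ℝ) * (α / (2 * n)) ^ 2 ≤ (n : ℝ) ^ 2 * (α / (2 * n)) ^ 2 := by gcongr
    _ = α ^ 2 / 4 := by field_simp; ring
    _ ≤ α / 2 := by nlinarith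

/-- The success probability of the algorithm. -/
theorem le_successProb_mainCmd (hP : IsSST P) {k : ℕ} (hkn : k < n) (hk : 0 < k) {α : ℝ}
    (hα0 : 0 < α) (hα1 : α < 1)
    (hr : 7776 * √(n : ℝ) * Real.logb 2 (2 * n / α) ≤
      r * infoVec (P ⟨k - 1, by omega⟩) (P ⟨k, hkn⟩)) :
    ENNReal.ofReal (1 - α) ≤ successProb mainCmd α k hP r := by
  classical
  have hπ : ∀ π : Equiv.Perm (Fin n), ENNReal.ofReal (1 - α) ≤
      ∑ z : Samples n r, sampleLaw hP π r z * outputProb mainCmd α k z (topSet π k) := by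
    intro π
    have hz : ∀ z : Samples n r, ENNReal.ofReal (sampleWeight P π z *
        ((1 - (if Separates z (topLabels π k) then 0 else 1)) * (1 - α / 2))) ≤
        sampleLaw hP π r z * outputProb mainCmd α k z (topSet π k) := fun z => by
      rw [sampleLaw_apply, ENNReal.ofReal_mul (sampleWeight_nonneg hP π z)]
      refine mul_le_mul_right ?_ _
      split_ifs with h
      · rw [sub_zero, one_mul]
        have := le_outputProb_mainCmd hα0 hα1 (by omega) (topLabels_subset π k) h
        rw [card_topLabels π hkn.le] at this
        convert this using 2
        ext i
        exact mem_topLabels.symm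
      · simp
    refine le_trans ?_ (Finset.sum_le_sum fun z _ => hz z)
    rw [← ENNReal.ofReal_sum_of_nonneg]
    · refine ENNReal.ofReal_le_ofReal ?_
      simp only [← mul_assoc]
      rw [← Finset.sum_mul]
      simp only [mul_sub, mul_one, Finset.sum_sub_distrib]
      rw [sum_sampleWeight]
      -- Separation and selection each fail with probability at most α/2, and (1 - α/2)² ≥ 1 - α.
      have := prob_not_separates_le hP hkn hk hα0 hα1 hr π
      nlinarith
    · intro z _
      refine mul_nonneg (sampleWeight_nonneg hP π z) (mul_nonneg ?_ (by linarith))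
      split_ifs <;> norm_num
  calc ENNReal.ofReal (1 - α)
      = ∑ π : Equiv.Perm (Fin n), PMF.uniformOfFintype (Equiv.Perm (Fin n)) π *
          ENNReal.ofReal (1 - α) := by
        rw [← Finset.sum_mul, ← tsum_fintype (L := .unconditional _), PMF.tsum_coe, one_mul]
    _ ≤ _ := Finset.sum_le_sum fun π _ => mul_le_mul_right (hπ π) _

theorem succeedsFrom_mainCmd (hP : IsSST P) {k : ℕ} (hkn : k < n) (hk : 0 < k) {α : ℝ}
    (hα0 : 0 < α) (hα1 : α < 1) :
    SucceedsFrom mainCmd α k hP (ENNReal.ofReal (1 - α))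
      (ENNReal.ofReal (7776 * √(n : ℝ) * Real.logb 2 (2 * n / α)) /
        ENNReal.ofReal (infoVec (P ⟨k - 1, by omega⟩) (P ⟨k, hkn⟩))) := by
  intro r hr
  refine le_successProb_mainCmd hP hkn hk hα0 hα1 ?_
  have hn : (2 : ℝ) ≤ n := by exact_mod_cast (by omega : 2 ≤ n)
  have hnum : 0 < 7776 * √(n : ℝ) * Real.logb 2 (2 * n / α) := by
    have : 0 < Real.logb 2 (2 * n / α) :=
      Real.logb_pos one_lt_two (by rw [lt_div_iff₀ hα0]; linarith)
    positivity
  set I := infoVec (P ⟨k - 1, by omega⟩) (P ⟨k, hkn⟩)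
  rcases le_or_gt I 0 with hI | hI
  -- Without information the threshold is ∞, which no natural number r reaches.
  · rw [ENNReal.ofReal_of_nonpos hI, ENNReal.div_zero (ENNReal.ofReal_pos.2 hnum).ne', top_le_iff] at hr
    exact absurd hr (ENNReal.natCast_ne_top r)
  · rw [← ENNReal.ofReal_div_of_pos hI, ← ENNReal.ofReal_natCast,
      ENNReal.ofReal_le_ofReal_iff (by positivity), div_le_iff₀ hI] at hr
    exact hr

end Success

end TopK

end

theorem mainTheorem5 :
    ∃ (A : TopK.Cmd) (C : ℝ), ∀ α : ℝ, 0 < α → α < 1 →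
      ∀ (n k : ℕ) (hk : 0 < k) (hkn : k < n),
        (∀ (r : ℕ) (z : TopK.Samples n r), 0 < r →
          ∃ t : ℕ, (t : ℝ) ≤ C * ((n : ℝ) ^ 2 * r * max 1 (Real.logb 2 (1 / α))) ∧
            TopK.HaltsWithin A α k z t) ∧
        ∀ (P : Matrix (Fin n) (Fin n) ℝ) (hP : TopK.IsSST P) (ρ : ENNReal),
          ρ = ENNReal.ofReal (7776 * √(n : ℝ) * Real.logb 2 (2 * n / α)) /
              ENNReal.ofReal (TopK.infoVec (P ⟨k - 1, by omega⟩) (P ⟨k, hkn⟩)) →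
            TopK.SucceedsFrom A α k hP (ENNReal.ofReal (1 - α)) ρ ∧
            TopK.rMin A α k hP (ENNReal.ofReal (1 - α)) ≤ ρ := by
  refine ⟨TopK.mainCmd, 4000, fun α hα0 hα1 n k hk hkn => ⟨fun r z hr =>
    TopK.haltsWithin_mainCmd hα0 hα1 (by omega) hr k, ?_⟩⟩
  rintro P hP ρ rfl
  have h := TopK.succeedsFrom_mainCmd hP hkn hk hα0 hα1
  exact ⟨h, sInf_le h⟩
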